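/- Let $M$ be a smooth manifold and let $A\to M$ be a Lie algebroid: a smooth vector bundle of finite rank with an $\mathbb{R}$-bilinear Lie bracket on $\Gamma(A)$ and a smooth vector bundle morphism $\rho\colon A\to TM$ such that $[a,fb]=f[a,b]+\rho(a)(f)\,b$. Write $\Omega^k(A)=\Gamma(\wedge^kA^*)$, let $\mathbf d_A\colon\Omega^k(A)\to\Omega^{k+1}(A)$ be the Lie algebroid differential $$(\mathbf d_A\theta)(a_0,\dots,a_k)=\sum_i(-1)^i\rho(a_i)\bigl(\theta(a_0,\dots,\widehat{a_i},\dots,a_k)\bigr)+\sum_{i<j}(-1)^{i+j}\theta([a_i,a_j],a_0,\dots,\widehat{a_i},\dots,\widehat{a_j},\dots,a_k),$$ and let $H^k(A)$ be its cohomology (closed $k$-forms modulo exact $k$-forms). Let $\underline E=\bigoplus_{z}E_z[z]$ be a graded vector bundle of finite rank over $M$: smooth vector bundles $E_z\to M$ of finite rank, for $z$ in a finite subset of $\mathbb Z$. Set $\Omega(A,\underline E)_m=\bigoplus_{p+z=m}\Omega^p(A,E_z)$ and $\Omega(A,\underline{\mathrm{End}}(\underline E))_m=\bigoplus_{p+(j-l)=m}\Omega^p(A,\mathrm{Hom}(E_l,E_j))$,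 where $\Omega^p(A,F)=\Gamma(\wedge^pA^*\otimes F)$. An element $K=\sum K^{p,l,j}$ of $\Omega(A,\underline{\mathrm{End}}(\underline E))$ defines the operator $\widehat K$ on $\Omega(A,\underline E)$ with $$\widehat{K^{p,l,j}}(\eta)=(-1)^{q(j-l)}K^{p,l,j}\wedge\eta\in\Omega^{p+q}(A,E_j)\qquad\text{for }\eta\in\Omega^q(A,E_l),$$ and with $\widehat{K^{p,l,j}}(\eta)=0$ for $\eta\in\Omega^q(A,E_{l'})$, $l'\neq l$. Its graded trace is the form $\mathrm{gtr}(K)=\sum_{p,z}(-1)^z\,\mathrm{tr}(K^{p,z,z})$ on $A$. A connection up to homotopy of $A$ on $\underline E$ is an $\mathbb R$-linear operator $\mathcal D$ on $\Omega(A,\underline E)$ that maps $\Omega(A,\underline E)_m$ to $\Omega(A,\underline E)_{m+1}$ for all $m$ and satisfies $\mathcal D(\theta\wedge\eta)=\mathbf d_A\theta\wedge\eta+(-1)^{k}\theta\wedge\mathcal D\eta$ for all $\theta\in\Omega^k(A)$ and $\eta\in\Omega(A,\underline E)$. Let $i\geq1$. Then: 1. For every connection up to homotopy $\mathcal D$ of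 $A$ on $\underline E$ there is a unique $R_{\mathcal D}^i\in\Omega(A,\underline{\mathrm{End}}(\underline E))_{2i}$ with $\widehat{R_{\mathcal D}^i}=\mathcal D^{2i}$. 2. The form $\mathrm{gtr}(R_{\mathcal D}^i)\in\Omega^{2i}(A)$ is $\mathbf d_A$-closed. 3. The class $[\mathrm{gtr}(R_{\mathcal D}^i)]\in H^{2i}(A)$ does not depend on the choice of the connection up to homotopy $\mathcal D$ of $A$ on $\underline E$. 4. Consequently the $i$-th $A$-Pontryagin character of $\underline E$ is well defined: connections up to homotopy of $A$ on $\underline E$ exist, and there is exactly one class $\sigma_A^i(\underline E)\in H^{2i}(A)$ with $\sigma_A^i(\underline E)=[\mathrm{gtr}(R_{\mathcal D}^i)]$ for some (hence for every) connection up to homotopy $\mathcal D$. -/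

import Mathlib

open Bundle
open scoped Manifold ContDiff

noncomputable section

namespace Algd

/-! ### Alternating maps over a commutative `ℝ`-algebra -/

section Algebra

variable {R L : Type*} [CommRing R] [AddCommGroup L] [Module R L]

/-- The wedge product of alternating maps, with respect to a bilinear map `B`:
`(α ∧ β)(a₁, …, a_s)` is the sum over the `(p, q)`-shuffles `τ` of
`sgn(τ) B(α(a_τ(1), …, a_τ(p)), β(a_τ(p+1), …, a_τ(s)))`, where `s = p + q`. -/
def wedge {N₁ N₂ N₃ : Type*} [AddCommGroup N₁] [Module R N₁] [AddCommGroup N₂] [Module R N₂]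
    [AddCommGroup N₃] [Module R N₃] (B : N₁ →ₗ[R] N₂ →ₗ[R] N₃) {p q s : ℕ} (h : p + q = s)
    (α : L [⋀^Fin p]→ₗ[R] N₁) (β : L [⋀^Fin q]→ₗ[R] N₂) : L [⋀^Fin s]→ₗ[R] N₃ :=
  ((TensorProduct.lift B).compAlternatingMap (α.domCoprod β)).domDomCongr
    (finSumFinEquiv.trans (finCongr h))

variable [Algebra ℝ R] [Module ℝ L] [IsScalarTower ℝ R L]

variable (R) in
/-- The `ℝ`-linear derivations of the ring `R`. -/
abbrev SelfDerivation := Derivation ℝ R R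

variable (R L) in
/-- The alternating `R`-multilinear maps `L^k → R`. -/
abbrev ScalarAlt (k : ℕ) := L [⋀^Fin k]→ₗ[R] R

instance scalarAltAddCommGroup (k : ℕ) : AddCommGroup (ScalarAlt R L k) :=
  AlternatingMap.instAddCommGroup

/-- The sum of `(-1)^(i+j) θ([a_i, a_j], a_0, …, â_i, …, â_j, …, a_k)` over `0 ≤ i < j ≤ k`.
(The pairs `i < j` are written as `(i.castSucc, j.succ)` with `i ≤ j`.) -/
def koszulBracketSum (br : L →ₗ[ℝ] L →ₗ[ℝ] L) :
    {k : ℕ} → (L [⋀^Fin k]→ₗ[R] R) → (Fin (k + 1) → L) → R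
  | 0, _, _ => 0
  | k + 1, θ, a => ∑ i : Fin (k + 1), ∑ j ≥ i, (-1 : ℤ) ^ ((i : ℕ) + j + 1) •
      θ (Matrix.vecCons (br (a i.castSucc) (a j.succ)) (j.removeNth (i.castSucc.removeNth a)))

/-- The Koszul formula: the sum of `(-1)^i ρ(a_i)(θ(a_0, …, â_i, …, a_k))` over `i`, plus the sum of
`(-1)^(i+j) θ([a_i, a_j], a_0, …, â_i, …, â_j, …, a_k)` over `i < j`. -/
def koszul (br : L →ₗ[ℝ] L →ₗ[ℝ] L) (an : L →ₗ[R] Derivation ℝ R R) {k : ℕ}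
    (θ : L [⋀^Fin k]→ₗ[R] R) (a : Fin (k + 1) → L) : R :=
  ∑ i : Fin (k + 1), (-1 : ℤ) ^ (i : ℕ) • an (a i) (θ (i.removeNth a)) + koszulBracketSum br θ a

section
variable (br : L →ₗ[ℝ] L →ₗ[ℝ] L) (an : L →ₗ[R] Derivation ℝ R R) {k : ℕ}

/-- An alternating `R`-multilinear map, as an `ℝ`-multilinear one. -/
def altRestrict (θ : L [⋀^Fin k]→ₗ[R] R) : L [⋀^Fin k]→ₗ[ℝ] R :=
  { θ.toMultilinearMap.restrictScalars ℝ with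
    map_eq_zero_of_eq' := θ.map_eq_zero_of_eq' }

/-- `x ↦ ρ(x) ∘ θ`, used to show that the Koszul formula is alternating and multilinear. -/
def koszulAnchorPart (θ : L [⋀^Fin k]→ₗ[R] R) : L →ₗ[ℝ] L [⋀^Fin k]→ₗ[ℝ] R where
  toFun x := ((an x : R →ₗ[ℝ] R)).compAlternatingMap (altRestrict θ)
  map_add' x y := by ext; simp
  map_smul' c x := by
    ext v
    simp only [LinearMap.compAlternatingMap_apply, RingHom.id_apply, AlternatingMap.smul_apply]
    rw [← algebraMap_smul R c x, map_smul]
    simp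

/-- The Koszul formula, written as an antisymmetrization. -/
def koszulAlt : {k : ℕ} → (L [⋀^Fin k]→ₗ[R] R) → L [⋀^Fin (k + 1)]→ₗ[ℝ] R
  | 0, θ => AlternatingMap.alternatizeUncurryFin (koszulAnchorPart an θ)
  | _ + 1, θ => AlternatingMap.alternatizeUncurryFin (koszulAnchorPart an θ) -
      (2⁻¹ : ℝ) • AlternatingMap.alternatizeUncurryFin (AlternatingMap.alternatizeUncurryFinLM ∘ₗ
        (br.compr₂ (altRestrict θ).curryLeft))

theorem koszul_eq_koszulAlt (hbr : ∀ x, br x x = 0) (θ : L [⋀^Fin k]→ₗ[R] R)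
    (a : Fin (k + 1) → L) : koszul br an θ a = koszulAlt br an θ a := by
  have hanti : ∀ x y, br y x = - br x y := fun x y => by
    have := hbr (x + y)
    simp only [map_add, LinearMap.add_apply, hbr, zero_add, add_zero] at this
    exact eq_neg_of_add_eq_zero_left this
  cases k with
  | zero =>
    simp [koszul, koszulAlt, koszulBracketSum, AlternatingMap.alternatizeUncurryFin_apply]
    rfl
  | succ k =>
    simp only [koszul, koszulAlt, koszulBracketSum, AlternatingMap.sub_apply,
      AlternatingMap.smul_apply,
      AlternatingMap.alternatizeUncurryFin_alternatizeUncurryFinLM_comp_apply]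
    rw [AlternatingMap.alternatizeUncurryFin_apply, sub_eq_add_neg]
    congr 1
    rw [Finset.smul_sum, ← Finset.sum_neg_distrib]
    refine Finset.sum_congr rfl fun i _ => ?_
    rw [Finset.smul_sum, ← Finset.sum_neg_distrib]
    refine Finset.sum_congr rfl fun j _ => ?_
    simp only [LinearMap.compr₂_apply]
    rw [hanti (a i.castSucc), map_neg]
    simp only [AlternatingMap.neg_apply, sub_neg_eq_add, ← two_smul ℝ, smul_comm (_ : ℤ) (2 : ℝ),
      smul_smul]
    rw [pow_succ]
    simp
    rfl

set_option linter.unusedSectionVars false in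
theorem koszul_cons_smul (hbr : ∀ x, br x x = 0)
    (hleib : ∀ (x y : L) (r : R), br x (r • y) = r • br x y + an x r • y)
    (θ : L [⋀^Fin k]→ₗ[R] R) (r : R) (x : L) (v : Fin k → L) :
    koszul br an θ (Fin.cons (r • x) v) = r * koszul br an θ (Fin.cons x v) := by
  have hanti : ∀ x y, br y x = - br x y := fun x y => by
    have := hbr (x + y)
    simp only [map_add, LinearMap.add_apply, hbr, zero_add, add_zero] at this
    exact eq_neg_of_add_eq_zero_left this
  have hleib' : ∀ (x y : L), br (r • x) y = r • br x y - an y r • x := fun x y => by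
    rw [hanti, hleib, hanti x y]; simp [sub_eq_add_neg, add_comm]
  have hsign : ∀ (c : ℤ) (z : R), c • (r * z) = r * (c • z) := fun c z => (mul_smul_comm c r z).symm
  cases k with
  | zero => simp [koszul, koszulBracketSum]
  | succ k =>
    have key : ∀ (i : Fin k) (j : Fin (k + 1)), i.succ ≤ j →
        θ (Matrix.vecCons (br ((Fin.cons (r • x) v : Fin (k+2) → L) i.succ.castSucc)
            ((Fin.cons (r • x) v : Fin (k+2) → L) j.succ))
          (j.removeNth (i.succ.castSucc.removeNth (Fin.cons (r • x) v : Fin (k+2) → L)))) =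
        r * θ (Matrix.vecCons (br ((Fin.cons x v : Fin (k+2) → L) i.succ.castSucc)
            ((Fin.cons x v : Fin (k+2) → L) j.succ))
          (j.removeNth (i.succ.castSucc.removeNth (Fin.cons x v : Fin (k+2) → L)))) := by
      intro i j hij
      cases k with
      | zero => exact i.elim0
      | succ k =>
        obtain ⟨j, rfl⟩ := Fin.exists_succ_eq.mpr
          (Fin.pos_iff_ne_zero.mp (lt_of_lt_of_le (Fin.succ_pos i) hij))
        have e : ∀ y : L, j.succ.removeNth
            (i.succ.castSucc.removeNth (Fin.cons y v : Fin (k + 3) → L)) =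
            Matrix.vecCons y (j.removeNth (i.castSucc.removeNth v)) := fun y => by
          ext l
          refine Fin.cases ?_ (fun l => ?_) l <;> simp [Fin.removeNth]
        rw [e, e]
        simp only [← Fin.succ_castSucc, Fin.cons_succ]
        have := congrArg (fun f => f (j.removeNth (i.castSucc.removeNth v)))
          (map_smul (θ.curryLeft (br (v i.castSucc) (v j.succ))).curryLeft r x)
        exact this
    have hadd : ∀ (j : Fin (k + 1)) (y z : L), θ (Matrix.vecCons (r • y - z) (j.removeNth v)) =
        r * θ (Matrix.vecCons y (j.removeNth v)) - θ (Matrix.vecCons z (j.removeNth v)) := by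
      intro j y z
      have := congrArg (fun f => f (j.removeNth v)) (map_sub θ.curryLeft (r • y) z)
      rw [map_smul] at this
      exact this
    have hsm : ∀ (j : Fin (k + 1)) (c : R) (y : L), θ (Matrix.vecCons (c • y) (j.removeNth v)) =
        c * θ (Matrix.vecCons y (j.removeNth v)) := by
      intro j c y
      have := congrArg (fun f => f (j.removeNth v)) (map_smul θ.curryLeft c y)
      exact this
    have e1 : ∀ (j : Fin (k + 1)) (y : L), j.succ.removeNth (Fin.cons y v : Fin (k + 2) → L) =
        Matrix.vecCons y (j.removeNth v) := fun j y => by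
      ext l
      refine Fin.cases ?_ (fun l => ?_) l <;> simp [Fin.removeNth]
    have e0 : ∀ y : L, (0 : Fin (k + 2)).removeNth (Fin.cons y v : Fin (k + 2) → L) = v :=
      fun y => by simp
    have key2 : ∀ i : Fin k, ∑ j ≥ i.succ, (-1 : ℤ) ^ ((i.succ : ℕ) + j + 1) •
        θ (Matrix.vecCons (br ((Fin.cons (r • x) v : Fin (k+2) → L) i.succ.castSucc)
            ((Fin.cons (r • x) v : Fin (k+2) → L) j.succ))
          (j.removeNth (i.succ.castSucc.removeNth (Fin.cons (r • x) v : Fin (k+2) → L)))) =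
        r * ∑ j ≥ i.succ, (-1 : ℤ) ^ ((i.succ : ℕ) + j + 1) •
        θ (Matrix.vecCons (br ((Fin.cons x v : Fin (k+2) → L) i.succ.castSucc)
            ((Fin.cons x v : Fin (k+2) → L) j.succ))
          (j.removeNth (i.succ.castSucc.removeNth (Fin.cons x v : Fin (k+2) → L)))) := by
      intro i
      rw [Finset.mul_sum]
      refine Finset.sum_congr rfl fun j hj => ?_
      rw [key i j (by simpa using hj), hsign]
    have hdec : ∀ y : L, koszul br an θ (Fin.cons y v) =
        an y (θ v) + ∑ j : Fin (k + 1), (-1 : ℤ) ^ ((j : ℕ) + 1) •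
          an (v j) (θ (Matrix.vecCons y (j.removeNth v))) +
        (∑ j : Fin (k + 1), (-1 : ℤ) ^ ((j : ℕ) + 1) •
          θ (Matrix.vecCons (br y (v j)) (j.removeNth v)) +
        ∑ i : Fin k, ∑ j ≥ i.succ, (-1 : ℤ) ^ ((i.succ : ℕ) + j + 1) •
          θ (Matrix.vecCons (br ((Fin.cons y v : Fin (k+2) → L) i.succ.castSucc)
            ((Fin.cons y v : Fin (k+2) → L) j.succ))
          (j.removeNth (i.succ.castSucc.removeNth (Fin.cons y v : Fin (k+2) → L))))) := by
      intro y
      have hI : Finset.Ici (0 : Fin (k + 1)) = Finset.univ := by ext; simp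
      simp only [koszul, koszulBracketSum]
      congr 1
      · rw [Fin.sum_univ_succ]
        simp only [e1, e0, Fin.cons_zero, Fin.cons_succ, Fin.val_zero, pow_zero, one_smul,
          Fin.val_succ]
      · rw [Fin.sum_univ_succ]
        simp only [e0, Fin.castSucc_zero, Fin.cons_zero, Fin.cons_succ, Fin.val_zero, zero_add, hI]
    rw [hdec, hdec]
    simp only [key2, ← Finset.mul_sum]
    simp only [hleib', hadd, hsm, Derivation.leibniz, map_smul, Derivation.smul_apply, smul_eq_mul]
    have h1 : ∀ j : Fin (k + 1), (-1 : ℤ) ^ ((j : ℕ) + 1) •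
        (r * (an (v j)) (θ (Matrix.vecCons x (j.removeNth v))) +
          θ (Matrix.vecCons x (j.removeNth v)) * (an (v j)) r) =
        r * ((-1 : ℤ) ^ ((j : ℕ) + 1) • (an (v j)) (θ (Matrix.vecCons x (j.removeNth v)))) +
        (-1 : ℤ) ^ ((j : ℕ) + 1) • (θ (Matrix.vecCons x (j.removeNth v)) * (an (v j)) r) :=
      fun j => by rw [smul_add, hsign]
    have h2 : ∀ j : Fin (k + 1), (-1 : ℤ) ^ ((j : ℕ) + 1) •
        (r * θ (Matrix.vecCons (br x (v j)) (j.removeNth v)) -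
          (an (v j)) r * θ (Matrix.vecCons x (j.removeNth v))) =
        r * ((-1 : ℤ) ^ ((j : ℕ) + 1) • θ (Matrix.vecCons (br x (v j)) (j.removeNth v))) -
        (-1 : ℤ) ^ ((j : ℕ) + 1) • (θ (Matrix.vecCons x (j.removeNth v)) * (an (v j)) r) :=
      fun j => by rw [smul_sub, hsign, mul_comm ((an (v j)) r)]
    simp only [h1, h2, Finset.sum_add_distrib, Finset.sum_sub_distrib, ← Finset.mul_sum]
    ring

/-- The Koszul formula gives an alternating `R`-multilinear map. -/
def ceDifferentialFun (hbr : ∀ x, br x x = 0)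
    (hleib : ∀ (x y : L) (r : R), br x (r • y) = r • br x y + an x r • y)
    (θ : L [⋀^Fin k]→ₗ[R] R) : L [⋀^Fin (k + 1)]→ₗ[R] R where
  toFun := koszul br an θ
  map_update_add' v p x y := by
    have hd : ‹DecidableEq (Fin (k + 1))› = instDecidableEqFin _ := Subsingleton.elim _ _
    subst hd
    simp only [koszul_eq_koszulAlt br an hbr, AlternatingMap.map_update_add]
  map_update_smul' v p r x := by
    have hd : ‹DecidableEq (Fin (k + 1))› = instDecidableEqFin _ := Subsingleton.elim _ _
    subst hd
    have h : ∀ y : L, koszul br an θ (Function.update v p y) =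
        (-1) ^ (p : ℕ) • koszul br an θ (Fin.cons y (p.removeNth v)) := fun y => by
      rw [koszul_eq_koszulAlt br an hbr, koszul_eq_koszulAlt br an hbr, ← Fin.insertNth_removeNth,
        AlternatingMap.map_insertNth]
      rfl
    rw [h, h, koszul_cons_smul br an hbr hleib, smul_eq_mul, mul_smul_comm]
  map_eq_zero_of_eq' v i j hv hij := by
    rw [koszul_eq_koszulAlt br an hbr]
    exact AlternatingMap.map_eq_zero_of_eq _ _ hv hij

/-- The differential `θ ↦ dθ` given by the Koszul formula, for an alternating bracket on `L` that
satisfies the Leibniz rule with respect to the anchor. -/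
def ceDifferential (hbr : ∀ x, br x x = 0)
    (hleib : ∀ (x y : L) (r : R), br x (r • y) = r • br x y + an x r • y) (k : ℕ) :
    ScalarAlt R L k →ₗ[ℝ] ScalarAlt R L (k + 1) where
  toFun θ := ceDifferentialFun br an hbr hleib θ
  map_add' θ₁ θ₂ := by
    ext a
    cases k <;>
    simp [ceDifferentialFun, koszul, koszulBracketSum, Finset.sum_add_distrib, smul_add] <;> abel
  map_smul' c θ := by
    ext a
    cases k <;>
    simp [ceDifferentialFun, koszul, koszulBracketSum, Finset.smul_sum, smul_add,
      smul_comm _ c]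

end
end Algebra

/-! ### Smooth functions, sections and vector fields -/

section Geometry

variable {n : ℕ} {M : Type*} [TopologicalSpace M] [ChartedSpace (EuclideanSpace ℝ (Fin n)) M]

variable (n M) in
/-- The ring `C^∞(M)` of smooth real functions on `M`. -/
def SmoothFun : Type _ := C^∞⟮𝓡 n, M; ℝ⟯

namespace SmoothFun

instance : CommRing (SmoothFun n M) := inferInstanceAs (CommRing C^∞⟮𝓡 n, M; ℝ⟯)

instance : Algebra ℝ (SmoothFun n M) := inferInstanceAs (Algebra ℝ C^∞⟮𝓡 n, M; ℝ⟯)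

instance : FunLike (SmoothFun n M) M ℝ := inferInstanceAs (FunLike C^∞⟮𝓡 n, M; ℝ⟯ M ℝ)

theorem contMDiff (f : SmoothFun n M) : ContMDiff (𝓡 n) 𝓘(ℝ, ℝ) ∞ f := f.2

theorem mdifferentiableAt (f : SmoothFun n M) {x : M} : MDifferentiableAt (𝓡 n) 𝓘(ℝ, ℝ) f x :=
  f.contMDiff.mdifferentiableAt (by simp)

@[ext] theorem ext {f g : SmoothFun n M} (h : ∀ x, f x = g x) : f = g := DFunLike.ext f g h

@[simp] theorem mk_apply (f : M → ℝ) (hf) (x : M) :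
    (show SmoothFun n M from ⟨f, hf⟩) x = f x := rfl

@[simp] theorem add_apply (f g : SmoothFun n M) (x : M) : (f + g) x = f x + g x := rfl

@[simp] theorem mul_apply (f g : SmoothFun n M) (x : M) : (f * g) x = f x * g x := rfl

@[simp] theorem zero_apply (x : M) : (0 : SmoothFun n M) x = 0 := rfl

@[simp] theorem one_apply (x : M) : (1 : SmoothFun n M) x = 1 := rfl

@[simp] theorem smul_apply (c : ℝ) (f : SmoothFun n M) (x : M) : (c • f) x = c * f x := rfl

end SmoothFun

section Sections

variable {F : Type*} [NormedAddCommGroup F] [NormedSpace ℝ F] {E : M → Type*}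
  [∀ x, AddCommGroup (E x)] [∀ x, Module ℝ (E x)] [∀ x, TopologicalSpace (E x)]
  [TopologicalSpace (TotalSpace F E)] [FiberBundle F E] [VectorBundle ℝ F E]

/-- The module structure of `Γ(E)` over `C^∞(M)`. -/
instance sectionSMul : SMul (SmoothFun n M) Cₛ^∞⟮𝓡 n; F, E⟯ :=
  ⟨fun f s => ⟨fun x => f x • s x, f.contMDiff.smul_section s.contMDiff⟩⟩

@[simp] theorem section_smul_apply (f : SmoothFun n M) (s : Cₛ^∞⟮𝓡 n; F, E⟯) (x : M) :
    (f • s) x = f x • s x := rfl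

instance sectionModule : Module (SmoothFun n M) Cₛ^∞⟮𝓡 n; F, E⟯ where
  one_smul s := by ext x; simp
  mul_smul f g s := by ext x; simp [mul_smul]
  smul_zero f := by ext x; simp
  smul_add f s t := by ext x; simp
  add_smul f g s := by ext x; simp [add_smul]
  zero_smul s := by ext x; simp

instance sectionTower : IsScalarTower ℝ (SmoothFun n M) Cₛ^∞⟮𝓡 n; F, E⟯ :=
  ⟨fun c f s => by ext x; exact mul_smul c (f x) (s x)⟩

instance sectionSMulComm : SMulCommClass (SmoothFun n M) ℝ Cₛ^∞⟮𝓡 n; F, E⟯ :=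
  ⟨fun f c s => by ext x; exact smul_comm (f x) c (s x)⟩

end Sections

section Hom

variable {F : Type*} [NormedAddCommGroup F] [NormedSpace ℝ F] {E : M → Type*}
  [∀ x, AddCommGroup (E x)] [∀ x, Module ℝ (E x)] [∀ x, TopologicalSpace (E x)]
  [TopologicalSpace (TotalSpace F E)] [FiberBundle F E] [VectorBundle ℝ F E]
  {F' : Type*} [NormedAddCommGroup F'] [NormedSpace ℝ F'] {E' : M → Type*}
  [∀ x, AddCommGroup (E' x)] [∀ x, Module ℝ (E' x)] [∀ x, TopologicalSpace (E' x)]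
  [∀ x, IsTopologicalAddGroup (E' x)] [∀ x, ContinuousSMul ℝ (E' x)]
  [TopologicalSpace (TotalSpace F' E')] [FiberBundle F' E'] [VectorBundle ℝ F' E']

variable (n F E F' E') in
/-- The smooth sections of the vector bundle `Hom(E, E')`. -/
abbrev HomSection :=
  Cₛ^∞⟮𝓡 n; F →L[ℝ] F', fun x : M => E x →L[ℝ] E' x⟯

/-- The evaluation `Γ(Hom(E, E')) × Γ(E) → Γ(E')`. -/
def homEval : HomSection n F E F' E' →ₗ[(SmoothFun n M)]
    Cₛ^∞⟮𝓡 n; F, E⟯ →ₗ[(SmoothFun n M)] Cₛ^∞⟮𝓡 n; F', E'⟯ :=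
  LinearMap.mk₂ _ (fun φ e => ⟨fun x => φ x (e x), φ.contMDiff.clm_bundle_apply e.contMDiff⟩)
    (fun φ ψ e => by ext x; simp) (fun f φ e => by ext x; simp)
    (fun φ e e' => by ext x; simp) (fun f φ e => by ext x; simp)

end Hom

section Trace

variable {F : Type*} [NormedAddCommGroup F] [NormedSpace ℝ F] [FiniteDimensional ℝ F]
  {E : M → Type*}
  [∀ x, AddCommGroup (E x)] [∀ x, Module ℝ (E x)] [∀ x, TopologicalSpace (E x)]
  [∀ x, IsTopologicalAddGroup (E x)] [∀ x, ContinuousSMul ℝ (E x)]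
  [TopologicalSpace (TotalSpace F E)] [FiberBundle F E] [VectorBundle ℝ F E]

theorem contMDiff_trace (φ : HomSection n F E F E) :
    ContMDiff (𝓡 n) 𝓘(ℝ, ℝ) ∞ fun x => LinearMap.trace ℝ (E x) (φ x : E x →ₗ[ℝ] E x) := by
  intro x₀
  have h := ((contMDiffAt_hom_bundle _).1 (φ.contMDiff x₀)).2
  let T : (F →L[ℝ] F) →L[ℝ] ℝ := LinearMap.toContinuousLinearMap
    (LinearMap.trace ℝ F ∘ₗ ContinuousLinearMap.coeLM ℝ)
  have h2 := (T.contMDiff (n := ∞)).contMDiffAt.comp x₀ h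
  refine h2.congr_of_eventuallyEq ?_
  filter_upwards [(trivializationAt F E x₀).open_baseSet.mem_nhds
    (FiberBundle.mem_baseSet_trivializationAt' x₀)] with x hx
  simp only [Function.comp, T]
  rw [ContinuousLinearMap.inCoordinates_eq hx hx]
  exact (LinearMap.trace_conj' (φ x : E x →ₗ[ℝ] E x)
    ((trivializationAt F E x₀).continuousLinearEquivAt ℝ x hx).toLinearEquiv).symm

/-- The fibrewise trace `Γ(End(E)) → C^∞(M)`. -/
def homTrace : Module.Dual (SmoothFun n M) (HomSection n F E F E) where
  toFun φ := ⟨fun x => LinearMap.trace ℝ (E x) (φ x : E x →ₗ[ℝ] E x), contMDiff_trace φ⟩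
  map_add' φ ψ := by
    ext x
    exact map_add (LinearMap.trace ℝ (E x)) (φ x : E x →ₗ[ℝ] E x) (ψ x)
  map_smul' f φ := by
    ext x
    exact map_smul (LinearMap.trace ℝ (E x)) (f x) (φ x : E x →ₗ[ℝ] E x)

end Trace

variable [IsManifold (𝓡 n) ∞ M]
variable {FA : Type*} [NormedAddCommGroup FA] [NormedSpace ℝ FA] {A : M → Type*}
  [∀ x, AddCommGroup (A x)] [∀ x, Module ℝ (A x)] [∀ x, TopologicalSpace (A x)]
  [TopologicalSpace (TotalSpace FA A)] [FiberBundle FA A] [VectorBundle ℝ FA A]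

variable (n M) in
/-- The smooth vector fields on `M`. -/
abbrev VectorField := Cₛ^∞⟮𝓡 n; EuclideanSpace ℝ (Fin n), (TangentSpace (𝓡 n) : M → Type)⟯

theorem contMDiff_vectorFieldDeriv (X : VectorField n M) (f : SmoothFun n M) :
    ContMDiff (𝓡 n) 𝓘(ℝ, ℝ) ∞ fun x => mvfderiv (𝓡 n) f x (X x) :=
  (contMDiff_snd_tangentBundle_modelSpace ℝ 𝓘(ℝ, ℝ)).comp
    ((f.contMDiff.contMDiff_tangentMap (m := ∞) le_rfl).comp X.contMDiff)

/-- The action `X ↦ (f ↦ X(f) = df(X))` of vector fields on functions. -/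
def vectorFieldDeriv : VectorField n M →ₗ[(SmoothFun n M)] SelfDerivation (SmoothFun n M) where
  toFun X := Derivation.mk'
    { toFun := fun f => ⟨fun x => mvfderiv (𝓡 n) f x (X x), contMDiff_vectorFieldDeriv X f⟩
      map_add' := fun f g => by
        ext x
        exact congrArg (fun T => T (X x)) (mvfderiv_add f.mdifferentiableAt g.mdifferentiableAt)
      map_smul' := fun c f => by
        ext x
        have h := congrArg (fun T => T (X x)) (mvfderiv_smul (a := fun _ : M => c)
          (mdifferentiableAt_const (x := x)) (f.mdifferentiableAt (x := x)))
        simp only [mvfderiv_const] at h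
        refine h.trans ?_
        simp
        rfl }
    (fun f g => by
      ext x
      exact congrArg (fun T => T (X x))
        (mvfderiv_mul (f.mdifferentiableAt (x := x)) (g.mdifferentiableAt (x := x))))
  map_add' X Y := by
    ext f x
    exact map_add (mvfderiv (𝓡 n) f x) (X x) (Y x)
  map_smul' g X := by
    ext f x
    exact map_smul (mvfderiv (𝓡 n) f x) (g x) (X x)

/-! ### Lie algebroids, their differential forms and their cohomology -/

variable (n FA A) in
/-- A Lie algebroid structure on the smooth vector bundle `A → M`: a Lie bracket on `Γ(A)` and an
anchor `ρ : A → TM`, a smooth vector bundle morphism over the identity, such that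
`[a, f b] = f [a, b] + ρ(a)(f) b`. -/
structure LieAlgebroid where
  bracket : Cₛ^∞⟮𝓡 n; FA, A⟯ →ₗ[ℝ] Cₛ^∞⟮𝓡 n; FA, A⟯ →ₗ[ℝ] Cₛ^∞⟮𝓡 n; FA, A⟯
  anchor : HomSection n FA A (EuclideanSpace ℝ (Fin n)) (TangentSpace (𝓡 n) : M → Type)
  bracket_self : ∀ a, bracket a a = 0
  jacobi : ∀ a b c, bracket a (bracket b c) + bracket b (bracket c a) + bracket c (bracket a b) = 0
  leibniz : ∀ (a b : Cₛ^∞⟮𝓡 n; FA, A⟯) (f : SmoothFun n M),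
    bracket a (f • b) = f • bracket a b + vectorFieldDeriv (homEval anchor a) f • b

variable (n FA A) in
/-- `Ω^k(A)`, as the space of alternating `C^∞(M)`-multilinear maps `Γ(A)^k → C^∞(M)`. -/
abbrev ScalarForm (k : ℕ) := ScalarAlt (SmoothFun n M) Cₛ^∞⟮𝓡 n; FA, A⟯ k

variable (n FA A) in
/-- `Ω^k(A, E) = Γ(⋀^k A^* ⊗ E)`, as the space of alternating `C^∞(M)`-multilinear maps
`Γ(A)^k → Γ(E)`. -/
abbrev BundleForm (F : Type*) [NormedAddCommGroup F] [NormedSpace ℝ F] (E : M → Type*)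
    [∀ x, AddCommGroup (E x)] [∀ x, Module ℝ (E x)] [∀ x, TopologicalSpace (E x)]
    [TopologicalSpace (TotalSpace F E)] [FiberBundle F E] [VectorBundle ℝ F E] (k : ℕ) :=
  Cₛ^∞⟮𝓡 n; FA, A⟯ [⋀^Fin k]→ₗ[(SmoothFun n M)] Cₛ^∞⟮𝓡 n; F, E⟯

namespace LieAlgebroid

variable (𝓐 : LieAlgebroid n FA A)

/-- `a ↦ (f ↦ ρ(a)(f))`. -/
def anchorDeriv : Cₛ^∞⟮𝓡 n; FA, A⟯ →ₗ[(SmoothFun n M)] SelfDerivation (SmoothFun n M) :=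
  vectorFieldDeriv ∘ₗ homEval 𝓐.anchor

/-- The Lie algebroid differential `d_A : Ω^k(A) → Ω^(k+1)(A)`. -/
def d (k : ℕ) : ScalarForm n FA A k →ₗ[ℝ] ScalarForm n FA A (k + 1) :=
  ceDifferential 𝓐.bracket 𝓐.anchorDeriv 𝓐.bracket_self 𝓐.leibniz k

/-- The `d_A`-closed `k`-forms. -/
def closedForms (k : ℕ) : Submodule ℝ (ScalarForm n FA A k) := LinearMap.ker (𝓐.d k)

/-- The `d_A`-exact `k`-forms. -/
def exactForms : (k : ℕ) → Submodule ℝ (ScalarForm n FA A k)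
  | 0 => ⊥
  | k + 1 => LinearMap.range (𝓐.d k)

/-- The Lie algebroid cohomology `H^k(A)`: closed forms modulo exact forms. -/
abbrev Cohomology (k : ℕ) := 𝓐.closedForms k ⧸ (𝓐.exactForms k).submoduleOf (𝓐.closedForms k)

/-- The cohomology class of a closed form. -/
def cohomologyClass {k : ℕ} (θ : ScalarForm n FA A k) (h : θ ∈ 𝓐.closedForms k) :
    𝓐.Cohomology k :=
  Submodule.Quotient.mk ⟨θ, h⟩

end LieAlgebroid

/-! ### Graded vector bundles and connections up to homotopy

A graded vector bundle `⊕_z E_z[z]` with grading concentrated in finitely many degrees is given by a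
finite set `S` of integers and a smooth vector bundle `E z` for each `z ∈ S`. -/

section Graded

variable {S : Finset ℤ} {F : S → Type*} [∀ z, NormedAddCommGroup (F z)]
  [∀ z, NormedSpace ℝ (F z)] {E : S → M → Type*} [∀ z x, AddCommGroup (E z x)]
  [∀ z x, Module ℝ (E z x)] [∀ z x, TopologicalSpace (E z x)]
  [∀ z, TopologicalSpace (TotalSpace (F z) (E z))] [∀ z, FiberBundle (F z) (E z)]
  [∀ z, VectorBundle ℝ (F z) (E z)]

variable (n FA A F E) in
/-- `Ω(A, E) = ⊕_{p, z} Ω^p(A, E_z)`. (There is no difference between the sum and the product,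
since `S` is finite and `Ω^p(A, E_z) = 0` for `p` larger than the rank of `A`.) -/
abbrev GradedForm := ∀ (p : ℕ) (z : S), BundleForm n FA A (F z) (E z) p

/-- `η` is homogeneous of total degree `m`: it lies in `⊕_{p + z = m} Ω^p(A, E_z)`. -/
def GradedForm.IsHomogeneous (m : ℤ) (η : GradedForm n FA A F E) : Prop :=
  ∀ (p : ℕ) (z : S), (p : ℤ) + z ≠ m → η p z = 0

/-- The product `θ ∧ η` of `θ ∈ Ω^l(A)` and `η ∈ Ω(A, E)`. -/
def GradedForm.wedge {l : ℕ} (θ : ScalarForm n FA A l) (η : GradedForm n FA A F E) :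
    GradedForm n FA A F E := fun p z =>
  if h : l ≤ p then
    Algd.wedge (LinearMap.lsmul (SmoothFun n M) Cₛ^∞⟮𝓡 n; F z, E z⟯) (Nat.add_sub_cancel' h)
      θ (η (p - l) z)
  else 0

variable (F E) in
/-- A connection up to homotopy of the Lie algebroid on `⊕_z E_z[z]`: a linear operator on
`Ω(A, E)` that raises the total degree by one and satisfies
`D(θ ∧ η) = d_A θ ∧ η + (-1)^l θ ∧ D η` for `θ ∈ Ω^l(A)`. -/
structure ConnectionUpToHomotopy (𝓐 : LieAlgebroid n FA A) where
  op : GradedForm n FA A F E →ₗ[ℝ] GradedForm n FA A F E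
  degree : ∀ (m : ℤ) (η : GradedForm n FA A F E), η.IsHomogeneous m → (op η).IsHomogeneous (m + 1)
  leibniz : ∀ (l : ℕ) (θ : ScalarForm n FA A l) (η : GradedForm n FA A F E),
    op (.wedge θ η) = .wedge (𝓐.d l θ) η + (-1 : ℝ) ^ l • .wedge θ (op η)

variable [∀ z x, IsTopologicalAddGroup (E z x)] [∀ z x, ContinuousSMul ℝ (E z x)]

variable (n FA A F E) in
/-- `Ω(A, End(E)) = ⊕_{p, l, j} Ω^p(A, Hom(E_l, E_j))`. -/
abbrev EndForm := ∀ (p : ℕ) (l j : S),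
  BundleForm n FA A (F l →L[ℝ] F j) (fun x => E l x →L[ℝ] E j x) p

/-- `K` is homogeneous of total degree `m`: it lies in `⊕_{p + (j - l) = m} Ω^p(A, Hom(E_l, E_j))`.
-/
def EndForm.IsHomogeneous (m : ℤ) (K : EndForm n FA A F E) : Prop :=
  ∀ (p : ℕ) (l j : S), (p : ℤ) + ((j : ℤ) - l) ≠ m → K p l j = 0

/-- The operator `K̂` on `Ω(A, E)` given by `K ∈ Ω(A, End(E))`. With the Koszul sign rule, a component
`K^{p,l,j} ∈ Ω^p(A, Hom(E_l, E_j))` acts on `η ∈ Ω^q(A, E_l)` by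
`(-1)^(q (j - l)) K^{p,l,j} ∧ η ∈ Ω^(p+q)(A, E_j)`; in this way `K̂` is graded `Ω(A)`-linear,
`K̂(θ ∧ η) = (-1)^(m l) θ ∧ K̂(η)` for `K` of total degree `m` and `θ` of degree `l`. -/
def EndForm.hat (K : EndForm n FA A F E) (η : GradedForm n FA A F E) : GradedForm n FA A F E :=
  fun s j => ∑ l : S, ∑ p : Fin (s + 1),
    ((((s - p : ℕ) : ℤ) * ((j : ℤ) - l)).negOnePow : ℤ) •
      Algd.wedge homEval (Nat.add_sub_cancel' (Nat.lt_succ_iff.mp p.isLt)) (K p l j) (η (s - p) l)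

/-- `K` is the power `R_D^i` of the curvature form of `D`, that is, the element of
`Ω(A, End(E))` of total degree `2i` whose operator is `D^(2i)`. -/
def ConnectionUpToHomotopy.IsCurvaturePower {𝓐 : LieAlgebroid n FA A}
    (D : ConnectionUpToHomotopy F E 𝓐) (i : ℕ) (K : EndForm n FA A F E) : Prop :=
  K.IsHomogeneous (2 * i) ∧ ∀ η : GradedForm n FA A F E, K.hat η = (D.op ^ (2 * i)) η

variable [∀ z, FiniteDimensional ℝ (F z)]

/-- The component in `Ω^p(A)` of the graded trace of `K ∈ Ω(A, End(E))`: the sum over `z` of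
`(-1)^z tr` applied to the component of `K` in `Ω^p(A, End(E_z))`. -/
def EndForm.gtr (K : EndForm n FA A F E) (p : ℕ) : ScalarForm n FA A p :=
  ∑ z : S, ((z : ℤ).negOnePow : ℤ) • homTrace.compAlternatingMap (K p z z)

/-- `σ ∈ H^(2i)(A)` is the class of `gtr(R_D^i)`, which is a closed form. -/
def ConnectionUpToHomotopy.IsCharacter {𝓐 : LieAlgebroid n FA A}
    (D : ConnectionUpToHomotopy F E 𝓐) (i : ℕ) (σ : 𝓐.Cohomology (2 * i)) : Prop :=
  ∃ K : EndForm n FA A F E, D.IsCurvaturePower i K ∧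
    ∃ h : K.gtr (2 * i) ∈ 𝓐.closedForms (2 * i), σ = 𝓐.cohomologyClass (K.gtr (2 * i)) h

end Graded

end Geometry

end Algd

end

/-! Everything takes place in the algebra of operators on `Ω(A, E)`. The Lie algebroid enters
through an `AnchoredBracket`: the reduced ring `R` of smooth functions, the `R`-module of sections
of `A`, the bracket and the anchor. Identities between forms are proved by induction on the degree.
A form of positive degree is determined by its contractions (`tot_succ_ext`), and contraction is an
antiderivation of the wedge product (`intr_tw`). In this way Cartan's calculus gives the Leibniz
rule and `d² = 0` (`AnchoredBracket.td_tmul`, `AnchoredBracket.td_td`).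

Curvature powers: since `d² = 0`, the square of a connection up to homotopy `D` is graded linear
over the forms (`IsConn.sq_mem`), and hence so is `D^(2i)`. A graded linear operator is determined
by its values on the sections of the `E_z`. Linear maps between modules of sections are sections of
Hom bundles (`homEval_surjective`). Hence each graded linear operator is `K̂` for exactly one `K`
(`exists_hatOp_eq`, `hatOp_injective`).

Closedness: for `T` graded linear, `gtr [D, T] = d gtr T` with the graded commutator
(`IsConn.trace_commutator`). In a frame `[D, T]` is the entrywise differential of the matrix of `T`
plus a graded commutator of matrices, whose graded trace vanishes. Taking `T = D^(2i)`, which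
commutes with `D`, shows that the trace is closed.

Independence: put `w = D' - D` and `D_t = D + t w`. The derivative of `D_t^(2i)` is the
anticommutator of `D_t` with a polynomial in `t` whose coefficients are graded linear of odd degree
`2i - 1`. Integrating coefficient by coefficient from `0` to `1` exhibits `gtr(D'^(2i)) -
gtr(D^(2i))` as exact (`pow_sub_pow_mem`, `IsConn.exists_trace_pow_sub`).

Existence: a module of sections is a retract of a product of copies of `R` (`exists_retract`), and
compressing the componentwise differential to it gives a connection (`exists_isConn`).

Frames exist only locally. They are made global by cut-off functions, so frame identities hold up to
a factor `f`. The factor is cancelled at the end because at each point some such factor is nonzero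
(`Separating`). -/

noncomputable section

namespace Algd

/-! ### Contraction of a wedge product: the shuffle sum as a recursion on the degree. -/

section WedgeRecursion

open Equiv

/-- A permutation `σ` is determined by the position `i` with `σ i = 0` and by the permutation `e` of
the remaining indices. It is the cycle taking `i` to `0`, of sign `(-1)^i`, followed by the
extension of `e` that fixes `0`. -/
theorem sum_perm_fin_succ {s : ℕ} {L N : Type*} [AddCommGroup N] (g : (Fin (s + 1) → L) → N)
    (v : Fin (s + 1) → L) :
    ∑ σ : Perm (Fin (s + 1)), Perm.sign σ • g (v ∘ σ) =
      ∑ i : Fin (s + 1), (-1 : ℤˣ) ^ (i : ℕ) • ∑ e : Perm (Fin s),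
        Perm.sign e • g (i.insertNth (v 0) (Fin.tail v ∘ e)) := by
  have hbij : Function.Bijective (fun x : Fin (s + 1) × Perm (Fin s) =>
      Perm.decomposeFin.symm (0, x.2) * x.1.cycleRange) := by
    rw [Fintype.bijective_iff_injective_and_card]
    refine ⟨?_, by simp [Fintype.card_perm, Nat.factorial_succ]⟩
    rintro ⟨i, e⟩ ⟨j, e'⟩ h
    have h' : Perm.decomposeFin.symm (0, e) * i.cycleRange =
      Perm.decomposeFin.symm (0, e') * j.cycleRange := h
    have h0 : (Perm.decomposeFin.symm (0, e') * j.cycleRange) i = 0 := by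
      rw [← h']; simp
    have h1 : j.cycleRange i = 0 := by
      apply (Perm.decomposeFin.symm (0, e')).injective
      simpa using h0
    have hij : i = j := by
      apply j.cycleRange.injective
      rw [h1, Fin.cycleRange_self]
    subst hij
    have := mul_right_cancel h'
    simpa using this
  rw [← (Equiv.ofBijective _ hbij).sum_comp, Fintype.sum_prod_type]
  refine Finset.sum_congr rfl fun i _ => ?_
  rw [Finset.smul_sum]
  refine Finset.sum_congr rfl fun e _ => ?_
  have hv : v ∘ (Perm.decomposeFin.symm (0, e)) = Fin.cons (v 0) (Fin.tail v ∘ e) := by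
    ext k
    refine Fin.cases ?_ (fun k => ?_) k <;> simp [Fin.tail]
  simp only [Equiv.ofBijective_apply, Perm.sign_mul, Fin.sign_cycleRange,
    Perm.decomposeFin.symm_sign, if_true, one_mul, Perm.coe_mul]
  rw [mul_comm, mul_smul, ← Function.comp_assoc, hv, Fin.cons_comp_cycleRange]

variable {R L : Type*} [CommRing R] [AddCommGroup L] [Module R L]
  {N₁ N₂ N₃ : Type*} [AddCommGroup N₁] [Module R N₁] [AddCommGroup N₂] [Module R N₂]
  [AddCommGroup N₃] [Module R N₃] (B : N₁ →ₗ[R] N₂ →ₗ[R] N₃)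

/-- The value of the tensor product of two multilinear maps on a tuple, the first map being fed
with the first `p` entries. -/
def splitApply {p q s : ℕ} (h : p + q = s) (α : (Fin p → L) → N₁) (β : (Fin q → L) → N₂)
    (w : Fin s → L) : N₃ :=
  B (α fun i => w ⟨i, by omega⟩) (β fun j => w ⟨p + j, by omega⟩)

/-- Shuffles represent the cosets of `S_p × S_q`, so the sum over all permutations counts each
shuffle `p! q!` times. Summing over the full group is what makes the decomposition by the position
of the first argument available. -/
theorem factorial_smul_wedge_apply {p q s : ℕ} (h : p + q = s)
    (α : L [⋀^Fin p]→ₗ[R] N₁) (β : L [⋀^Fin q]→ₗ[R] N₂) (v : Fin s → L) :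
    (p.factorial * q.factorial) • wedge B h α β v =
      ∑ σ : Perm (Fin s), Perm.sign σ • splitApply B h α β (v ∘ σ) := by
  subst h
  have key := congrArg (fun f => TensorProduct.lift B (f (v ∘ finSumFinEquiv)))
    (MultilinearMap.domCoprod_alternization_eq α β)
  simp only [Fintype.card_fin, AlternatingMap.smul_apply, map_nsmul] at key
  refine Eq.trans ?_ (key.symm.trans ?_)
  · simp [wedge]
  · rw [MultilinearMap.alternatization_apply, map_sum,
      ← (Equiv.permCongr finSumFinEquiv).sum_comp]
    refine Finset.sum_congr rfl fun σ _ => ?_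
    have h1 : ∀ k : Fin p, finSumFinEquiv.symm ⟨k, by omega⟩ = (Sum.inl k : Fin p ⊕ Fin q) :=
      fun k => (Equiv.symm_apply_eq _).2 rfl
    have h2 : ∀ k : Fin q, finSumFinEquiv.symm ⟨p + k, by omega⟩ = (Sum.inr k : Fin p ⊕ Fin q) :=
      fun k => (Equiv.symm_apply_eq _).2 rfl
    simp [splitApply, MultilinearMap.domCoprod_apply, Function.comp_def, Perm.sign_permCongr,
      Units.smul_def, h1, h2]

/-- The inserted entry lies in the block of `α`. Moving it to the front of that block costs
`(-1)^i`, which cancels the sign present. -/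
theorem splitApply_insertNth_left {p q s : ℕ} (h : p + 1 + q = s + 1)
    (α : L [⋀^Fin (p + 1)]→ₗ[R] N₁) (β : (Fin q → L) → N₂) (x : L) (w : Fin s → L)
    (i : Fin (p + 1)) :
    (-1 : ℤˣ) ^ (i : ℕ) •
      splitApply B h α β (Fin.insertNth (α := fun _ => L) ⟨i, by omega⟩ x w) =
      splitApply B (show p + q = s by omega) (α.curryLeft x) β w := by
  have e1 : (fun k : Fin (p + 1) => Fin.insertNth (α := fun _ => L) (⟨i, by omega⟩ : Fin (s + 1))
      x w ⟨k, by omega⟩) = i.insertNth (α := fun _ => L) x fun k : Fin p => w ⟨k, by omega⟩ := by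
    rw [Fin.eq_insertNth_iff]
    constructor
    · simp
    · ext k
      have : (⟨(i.succAbove k : Fin (p + 1)), by omega⟩ : Fin (s + 1)) =
          (⟨i, by omega⟩ : Fin (s + 1)).succAbove (⟨k, by omega⟩ : Fin s) := by
        ext; simp only [Fin.succAbove, Fin.lt_def]; split_ifs <;> (simp_all; try omega)
      simp only [Fin.removeNth]
      rw [this, Fin.insertNth_apply_succAbove]
  have e2 : (fun k : Fin q => Fin.insertNth (α := fun _ => L) (⟨i, by omega⟩ : Fin (s + 1))
      x w ⟨p + 1 + k, by omega⟩) = fun k : Fin q => w ⟨p + k, by omega⟩ := by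
    ext k
    have : (⟨p + 1 + k, by omega⟩ : Fin (s + 1)) =
          (⟨i, by omega⟩ : Fin (s + 1)).succAbove (⟨p + k, by omega⟩ : Fin s) := by
      ext; simp only [Fin.succAbove, Fin.lt_def]; split_ifs <;> (simp_all; try omega)
    rw [this, Fin.insertNth_apply_succAbove]
  simp only [splitApply]
  rw [e1, e2, AlternatingMap.map_insertNth]
  simp [Units.smul_def, smul_smul, ← mul_pow]

/-- Here the entry lies in the block of `β`. Only its move inside this block is compensated, and
`(-1)^p` remains from passing the arguments of `α`. -/
theorem splitApply_insertNth_right {p q s : ℕ} (h : p + (q + 1) = s + 1)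
    (α : (Fin p → L) → N₁) (β : L [⋀^Fin (q + 1)]→ₗ[R] N₂) (x : L) (w : Fin s → L)
    (i : Fin (q + 1)) :
    (-1 : ℤˣ) ^ (p + i : ℕ) •
      splitApply B h α β (Fin.insertNth (α := fun _ => L) ⟨p + i, by omega⟩ x w) =
      (-1 : ℤˣ) ^ p • splitApply B (show p + q = s by omega) α (β.curryLeft x) w := by
  have e1 : (fun k : Fin (q + 1) => Fin.insertNth (α := fun _ => L)
      (⟨p + i, by omega⟩ : Fin (s + 1)) x w ⟨p + k, by omega⟩) =
      i.insertNth (α := fun _ => L) x fun k : Fin q => w ⟨p + k, by omega⟩ := by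
    rw [Fin.eq_insertNth_iff]
    constructor
    · simp
    · ext k
      have : (⟨p + (i.succAbove k : Fin (q + 1)), by omega⟩ : Fin (s + 1)) =
          (⟨p + i, by omega⟩ : Fin (s + 1)).succAbove (⟨p + k, by omega⟩ : Fin s) := by
        ext; simp only [Fin.succAbove, Fin.lt_def]; split_ifs <;> (simp_all; try omega)
      simp only [Fin.removeNth]
      rw [this, Fin.insertNth_apply_succAbove]
  have e2 : (fun k : Fin p => Fin.insertNth (α := fun _ => L) (⟨p + i, by omega⟩ : Fin (s + 1))
      x w ⟨k, by omega⟩) = fun k : Fin p => w ⟨k, by omega⟩ := by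
    ext k
    have : (⟨k, by omega⟩ : Fin (s + 1)) =
          (⟨p + i, by omega⟩ : Fin (s + 1)).succAbove (⟨k, by omega⟩ : Fin s) := by
      ext; simp only [Fin.succAbove, Fin.lt_def]; split_ifs <;> (simp_all; try omega)
    rw [this, Fin.insertNth_apply_succAbove]
  simp only [splitApply]
  rw [e1, e2, AlternatingMap.map_insertNth, pow_add, mul_smul]
  congr 1
  simp [Units.smul_def, smul_smul, ← mul_pow]

theorem factorial_smul_wedge_succ {p q s : ℕ} (h : p + q = s + 1)
    (α : L [⋀^Fin p]→ₗ[R] N₁) (β : L [⋀^Fin q]→ₗ[R] N₂) (x : L) (v : Fin s → L) :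
    (p.factorial * q.factorial) • (wedge B h α β).curryLeft x v =
      (∑ i : Fin p, ∑ e : Perm (Fin s), Perm.sign e • (-1 : ℤˣ) ^ (i : ℕ) • splitApply B h α β
        (Fin.insertNth (α := fun _ => L) ⟨i, by omega⟩ x (v ∘ e))) +
      ∑ i : Fin q, ∑ e : Perm (Fin s), Perm.sign e • (-1 : ℤˣ) ^ (p + i : ℕ) • splitApply B h α β
        (Fin.insertNth (α := fun _ => L) ⟨p + i, by omega⟩ x (v ∘ e)) := by
  rw [AlternatingMap.curryLeft_apply_apply, factorial_smul_wedge_apply, sum_perm_fin_succ,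
    ← (finCongr h).sum_comp, Fin.sum_univ_add]
  simp only [Finset.smul_sum]
  congr 1 <;>
  · refine Finset.sum_congr rfl fun i _ => Finset.sum_congr rfl fun e _ => ?_
    rw [smul_comm]
    rfl

-- Positive integers are units in an `ℝ`-algebra, so the factorials of the permutation sums can be
-- cancelled.
variable (R) in
theorem nsmul_cancel [Algebra ℝ R] {c : ℕ} (hc : c ≠ 0) {a b : N₃} (h : c • a = c • b) : a = b := by
  have hu : IsUnit (c : R) := by
    have : (c : R) = algebraMap ℝ R c := by simp
    rw [this]
    exact (IsUnit.mk0 _ (by exact_mod_cast hc)).map _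
  rw [← Nat.cast_smul_eq_nsmul R, ← Nat.cast_smul_eq_nsmul R] at h
  exact hu.smul_left_cancel.mp h

theorem wedge_sum_left {p q s : ℕ} (h : p + 1 + q = s + 1)
    (α : L [⋀^Fin (p + 1)]→ₗ[R] N₁) (β : L [⋀^Fin q]→ₗ[R] N₂) (x : L) (v : Fin s → L) :
    (∑ i : Fin (p + 1), ∑ e : Perm (Fin s), Perm.sign e • (-1 : ℤˣ) ^ (i : ℕ) • splitApply B h α β
        (Fin.insertNth (α := fun _ => L) ⟨i, by omega⟩ x (v ∘ e))) =
      ((p + 1).factorial * q.factorial) •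
        wedge B (show p + q = s by omega) (α.curryLeft x) β v := by
  simp only [splitApply_insertNth_left, Finset.sum_const, ← factorial_smul_wedge_apply,
    Finset.card_univ, Fintype.card_fin, smul_smul, Nat.factorial_succ, mul_assoc]

theorem wedge_sum_right {p q s : ℕ} (h : p + (q + 1) = s + 1)
    (α : L [⋀^Fin p]→ₗ[R] N₁) (β : L [⋀^Fin (q + 1)]→ₗ[R] N₂) (x : L) (v : Fin s → L) :
    (∑ i : Fin (q + 1), ∑ e : Perm (Fin s), Perm.sign e • (-1 : ℤˣ) ^ (p + i : ℕ) •
      splitApply B h α β (Fin.insertNth (α := fun _ => L) ⟨p + i, by omega⟩ x (v ∘ e))) =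
      (p.factorial * (q + 1).factorial) • (-1 : ℤ) ^ p •
        wedge B (show p + q = s by omega) α (β.curryLeft x) v := by
  simp only [splitApply_insertNth_right, Finset.sum_const, smul_comm (Perm.sign _) ((-1 : ℤˣ) ^ p),
    ← Finset.smul_sum, ← factorial_smul_wedge_apply, Finset.card_univ, Fintype.card_fin]
  rw [smul_comm ((-1 : ℤˣ) ^ p) (_ : ℕ), smul_smul, Nat.factorial_succ, mul_left_comm, Units.smul_def]
  simp

theorem wedge_zero_zero (h : 0 + 0 = 0) (α : L [⋀^Fin 0]→ₗ[R] N₁) (β : L [⋀^Fin 0]→ₗ[R] N₂)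
    (v : Fin 0 → L) : wedge B h α β v = B (α v) (β v) := by
  have := factorial_smul_wedge_apply B h α β v
  simp only [Nat.factorial_zero, mul_one, one_smul] at this
  rw [this]
  simp only [Finset.univ_unique, Finset.sum_singleton, Perm.default_eq, Perm.sign_one, one_smul]
  simp only [splitApply]
  rw [Subsingleton.elim (fun i : Fin 0 => (v ∘ (1 : Perm (Fin 0))) ⟨i, by omega⟩) v,
    Subsingleton.elim (fun j : Fin 0 => (v ∘ (1 : Perm (Fin 0))) ⟨0 + j, by omega⟩) v]

variable [Algebra ℝ R]

/-- The antiderivation rule `i_x(α ∧ β) = i_x α ∧ β ± α ∧ i_x β`: the first argument lands in the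
block of `α` or in that of `β`. When one degree is zero the corresponding term is missing, which is
why two boundary versions follow. -/
theorem wedge_curryLeft_succ_succ {p q s : ℕ} (h : p + 1 + (q + 1) = s + 1)
    (α : L [⋀^Fin (p + 1)]→ₗ[R] N₁) (β : L [⋀^Fin (q + 1)]→ₗ[R] N₂) (x : L) :
    (wedge B h α β).curryLeft x = wedge B (show p + (q + 1) = s by omega) (α.curryLeft x) β +
      (-1 : ℤ) ^ (p + 1) • wedge B (show p + 1 + q = s by omega) α (β.curryLeft x) := by
  ext v
  refine nsmul_cancel R (c := (p + 1).factorial * (q + 1).factorial) (by positivity) ?_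
  rw [factorial_smul_wedge_succ, wedge_sum_left, wedge_sum_right, AlternatingMap.add_apply, smul_add,
    AlternatingMap.smul_apply]

theorem wedge_curryLeft_succ_zero {p s : ℕ} (h : p + 1 + 0 = s + 1)
    (α : L [⋀^Fin (p + 1)]→ₗ[R] N₁) (β : L [⋀^Fin 0]→ₗ[R] N₂) (x : L) :
    (wedge B h α β).curryLeft x = wedge B (show p + 0 = s by omega) (α.curryLeft x) β := by
  ext v
  refine nsmul_cancel R (c := (p + 1).factorial * (0).factorial) (by positivity) ?_
  rw [factorial_smul_wedge_succ, wedge_sum_left]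
  simp

theorem wedge_curryLeft_zero_succ {q s : ℕ} (h : 0 + (q + 1) = s + 1)
    (α : L [⋀^Fin 0]→ₗ[R] N₁) (β : L [⋀^Fin (q + 1)]→ₗ[R] N₂) (x : L) :
    (wedge B h α β).curryLeft x = wedge B (show 0 + q = s by omega) α (β.curryLeft x) := by
  ext v
  refine nsmul_cancel R (c := (0).factorial * (q + 1).factorial) (by positivity) ?_
  rw [factorial_smul_wedge_succ, wedge_sum_right]
  simp

end WedgeRecursion

/-! ### Signs with integer exponents. -/

section Sign

/-- The sign `(-1)^n`, as an integer. -/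
def zsign (n : ℤ) : ℤ := (n.negOnePow : ℤˣ)

theorem zsign_add (a b : ℤ) : zsign (a + b) = zsign a * zsign b := by
  simp [zsign, Int.negOnePow_add]

theorem zsign_congr {a b : ℤ} (h : Even (a - b)) : zsign a = zsign b := by
  simp [zsign, (Int.negOnePow_eq_iff a b).2 h]

theorem zsign_natCast (k : ℕ) : zsign k = (-1) ^ k := by
  simp [zsign, Int.negOnePow_def]

@[simp] theorem zsign_zero : zsign 0 = 1 := by simp [zsign]

end Sign

/-! ### The algebra of inhomogeneous forms, where products need no transport between degrees. -/

section TotalForms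

variable {R L : Type*} [CommRing R] [AddCommGroup L] [Module R L]
  {N N₁ N₂ N₃ N₁' N₂' N₃' : Type*} [AddCommGroup N] [Module R N]
  [AddCommGroup N₁] [Module R N₁] [AddCommGroup N₂] [Module R N₂]
  [AddCommGroup N₃] [Module R N₃] [AddCommGroup N₁'] [Module R N₁'] [AddCommGroup N₂']
  [Module R N₂'] [AddCommGroup N₃'] [Module R N₃']

variable (R L N) in
/-- Inhomogeneous alternating forms on `L` with values in `N`. -/
abbrev Tot := ∀ k : ℕ, L [⋀^Fin k]→ₗ[R] N

/-- The interior product with `x`. -/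
def intr (x : L) : Tot R L N →ₗ[R] Tot R L N where
  toFun α k := (α (k + 1)).curryLeft x
  map_add' _ _ := rfl
  map_smul' _ _ := rfl

theorem intr_apply (x : L) (α : Tot R L N) (k : ℕ) (v : Fin k → L) :
    intr x α k v = α (k + 1) (Matrix.vecCons x v) := rfl

theorem intr_add_left (x y : L) (α : Tot R L N) : intr (x + y) α = intr x α + intr y α := by
  funext k
  exact map_add (α (k + 1)).curryLeft x y

theorem intr_neg_left (x : L) (α : Tot R L N) : intr (-x) α = -intr x α := by
  funext k
  exact map_neg (α (k + 1)).curryLeft x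

/-- Polarization of `i_z i_z = 0` at `z = x + y`. -/
theorem intr_intr (x y : L) (α : Tot R L N) : intr x (intr y α) = -intr y (intr x α) := by
  have h := fun z : L => show intr z (intr z α) = 0 by
    funext k; exact (α (k + 2)).curryLeft_same z
  have h' := h (x + y)
  simp only [intr_add_left, map_add, h, zero_add, add_zero] at h'
  exact eq_neg_of_add_eq_zero_right h'

/-- The induction principle behind most identities below: compare in degree `0`, then compare all
contractions. -/
theorem tot_succ_ext {α β : Tot R L N} {k : ℕ} (h : ∀ x, intr x α k = intr x β k) :
    α (k + 1) = β (k + 1) := by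
  ext v
  have := congrArg (fun f => f (Fin.tail v)) (h (v 0))
  simp only [intr_apply, Matrix.vecCons, Fin.cons_self_tail] at this
  exact this

/-- The sign involution, equal to `(-1)^k` on the forms of degree `k`. -/
def sgn : Tot R L N →ₗ[R] Tot R L N where
  toFun α k := (-1 : ℤ) ^ k • α k
  map_add' _ _ := by funext k; simp
  map_smul' r α := by funext k; exact smul_comm ((-1 : ℤ) ^ k) r (α k)

theorem sgn_apply (α : Tot R L N) (k : ℕ) : sgn α k = (-1 : ℤ) ^ k • α k := rfl

theorem sgn_sgn (α : Tot R L N) : sgn (sgn α) = α := by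
  funext k
  rw [sgn_apply, sgn_apply, smul_smul, ← mul_pow]
  norm_num

theorem intr_sgn (x : L) (α : Tot R L N) : intr x (sgn α) = -sgn (intr x α) := by
  ext k v
  simp only [intr_apply, sgn_apply, Pi.neg_apply, AlternatingMap.smul_apply,
    AlternatingMap.neg_apply]
  rw [pow_succ, mul_neg, mul_one, neg_smul]

/-- Composition of the values with a linear map. -/
def postc (g : N →ₗ[R] N₁) : Tot R L N →ₗ[R] Tot R L N₁ where
  toFun α k := g.compAlternatingMap (α k)
  map_add' _ _ := by ext; simp
  map_smul' _ _ := by ext; simp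

theorem postc_apply (g : N →ₗ[R] N₁) (α : Tot R L N) (k : ℕ) :
    postc g α k = g.compAlternatingMap (α k) := rfl

theorem intr_postc (g : N →ₗ[R] N₁) (x : L) (α : Tot R L N) :
    intr x (postc g α) = postc g (intr x α) := rfl

theorem sgn_postc (g : N →ₗ[R] N₁) (α : Tot R L N) : sgn (postc g α) = postc g (sgn α) := by
  ext k v
  simp [sgn_apply, postc_apply]

/-- A constant, as an inhomogeneous form. -/
def ofConst : N →ₗ[R] Tot R L N :=
  LinearMap.single R (fun k : ℕ => L [⋀^Fin k]→ₗ[R] N) 0 ∘ₗ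
    (AlternatingMap.constLinearEquivOfIsEmpty (R' := R) (M'' := L) (N'' := N) (ι := Fin 0)
      : N →ₗ[R] L [⋀^Fin 0]→ₗ[R] N)

theorem ofConst_zero_apply (a : N) (v : Fin 0 → L) : (ofConst a : Tot R L N) 0 v = a := by
  simp [ofConst]

theorem ofConst_succ (a : N) (k : ℕ) : (ofConst a : Tot R L N) (k + 1) = 0 := by
  simp [ofConst]

theorem intr_ofConst (x : L) (a : N) : intr x (ofConst a : Tot R L N) = 0 := by
  ext k v
  rw [intr_apply, ofConst_succ]
  rfl

theorem sgn_ofConst (a : N) : sgn (ofConst a : Tot R L N) = ofConst a := by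
  funext k
  cases k with
  | zero => simp [sgn_apply]
  | succ k => simp [sgn_apply, ofConst_succ]

variable (B : N₁ →ₗ[R] N₂ →ₗ[R] N₃) (B' : N₁' →ₗ[R] N₂' →ₗ[R] N₃')

/-- The wedge product as a bilinear map. -/
def wedgeLin {p q s : ℕ} (h : p + q = s) :
    (L [⋀^Fin p]→ₗ[R] N₁) →ₗ[R] (L [⋀^Fin q]→ₗ[R] N₂) →ₗ[R] L [⋀^Fin s]→ₗ[R] N₃ :=
  LinearMap.mk₂ R (wedge B h)
    (fun a a' b => by
      simp only [wedge, ← AlternatingMap.domCoprod'_apply, TensorProduct.add_tmul, map_add]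
      ext; simp)
    (fun c a b => by
      simp only [wedge, ← AlternatingMap.domCoprod'_apply, ← TensorProduct.smul_tmul', map_smul]
      ext; simp)
    (fun a b b' => by
      simp only [wedge, ← AlternatingMap.domCoprod'_apply, TensorProduct.tmul_add, map_add]
      ext; simp)
    (fun c a b => by
      simp only [wedge, ← AlternatingMap.domCoprod'_apply, TensorProduct.tmul_smul, map_smul]
      ext; simp)

/-- The `(p, q)` component of the wedge product in degree `s`; it is `0` unless `p + q = s`. -/
def wedgeTerm (s p q : ℕ) :
    (L [⋀^Fin p]→ₗ[R] N₁) →ₗ[R] (L [⋀^Fin q]→ₗ[R] N₂) →ₗ[R] L [⋀^Fin s]→ₗ[R] N₃ :=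
  if h : p + q = s then wedgeLin B h else 0

theorem wedgeTerm_of_eq {s p q : ℕ} (h : p + q = s) (α : L [⋀^Fin p]→ₗ[R] N₁)
    (β : L [⋀^Fin q]→ₗ[R] N₂) : wedgeTerm B s p q α β = wedge B h α β := by
  simp [wedgeTerm, h, wedgeLin]

/-- The wedge product of inhomogeneous forms. -/
def tw : Tot R L N₁ →ₗ[R] Tot R L N₂ →ₗ[R] Tot R L N₃ :=
  LinearMap.mk₂ R (fun α β s => ∑ x ∈ Finset.HasAntidiagonal.antidiagonal s, wedgeTerm B s x.1 x.2 (α x.1) (β x.2))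
    (fun _ _ _ => by funext s; simp [Finset.sum_add_distrib])
    (fun _ _ _ => by funext s; simp [Finset.smul_sum])
    (fun _ _ _ => by funext s; simp [Finset.sum_add_distrib])
    (fun _ _ _ => by funext s; simp [Finset.smul_sum])

theorem tw_apply (α : Tot R L N₁) (β : Tot R L N₂) (s : ℕ) : tw B α β s =
    ∑ x ∈ Finset.HasAntidiagonal.antidiagonal s, wedgeTerm B s x.1 x.2 (α x.1) (β x.2) := rfl

theorem tw_zero_apply (α : Tot R L N₁) (β : Tot R L N₂) (v : Fin 0 → L) :
    tw B α β 0 v = B (α 0 v) (β 0 v) := by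
  rw [tw_apply, Finset.HasAntidiagonal.antidiagonal_zero, Finset.sum_singleton]
  rw [wedgeTerm_of_eq B (p := 0) (q := 0) (s := 0) rfl, wedge_zero_zero]

theorem tw_single_left {p : ℕ} (a : L [⋀^Fin p]→ₗ[R] N₁) (β : Tot R L N₂) (s : ℕ) :
    tw B (Pi.single p a) β s =
      if h : p ≤ s then wedge B (Nat.add_sub_cancel' h) a (β (s - p)) else 0 := by
  rw [tw_apply]
  split_ifs with h
  · rw [Finset.sum_eq_single (p, s - p), Pi.single_eq_same, wedgeTerm_of_eq]
    · rintro ⟨i, j⟩ hx hne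
      have hi : i ≠ p := by
        rintro rfl
        simp only [Finset.HasAntidiagonal.mem_antidiagonal] at hx
        exact hne (by simp; omega)
      simp [Pi.single_eq_of_ne hi]
    · intro hx
      simp only [Finset.HasAntidiagonal.mem_antidiagonal] at hx
      omega
  · refine Finset.sum_eq_zero ?_
    rintro ⟨i, j⟩ hx
    have hi : i ≠ p := by
      rintro rfl
      simp only [Finset.HasAntidiagonal.mem_antidiagonal] at hx
      omega
    simp [Pi.single_eq_of_ne hi]

/-- `α` is concentrated in the degree `c`. -/
def Conc (c : ℤ) (α : Tot R L N) : Prop := ∀ k : ℕ, (k : ℤ) ≠ c → α k = 0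

theorem Conc.sgn {c : ℤ} {α : Tot R L N} (h : Conc c α) : Algd.sgn α = zsign c • α := by
  funext k
  rw [sgn_apply, Pi.smul_apply]
  by_cases hk : (k : ℤ) = c
  · rw [← hk, zsign_natCast]
  · rw [h k hk, smul_zero, smul_zero]

theorem Conc.intr {c : ℤ} {α : Tot R L N} (h : Conc c α) (x : L) :
    Conc (c - 1) (Algd.intr x α) := by
  intro k hk
  ext v
  rw [intr_apply, h (k + 1) (by push_cast; omega)]
  rfl

theorem Conc.eq_single {c : ℕ} {α : Tot R L N} (h : Conc c α) : α = Pi.single c (α c) := by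
  funext k
  by_cases hk : k = c
  · subst hk; simp
  · rw [Pi.single_eq_of_ne hk, h k (by exact_mod_cast hk)]

theorem Conc.eq_zero_of_neg {c : ℤ} (hc : c < 0) {α : Tot R L N} (h : Conc c α) : α = 0 := by
  funext k
  exact h k (by omega)

theorem conc_single (k : ℕ) (a : L [⋀^Fin k]→ₗ[R] N) : Conc (k : ℤ) (Pi.single k a : Tot R L N) :=
  fun j hj => Pi.single_eq_of_ne (M := fun k => L [⋀^Fin k]→ₗ[R] N) (by exact_mod_cast hj) a

variable [Algebra ℝ R]

/-- The two `Nat.rec` return `0` when the factor to be contracted has degree `0`. This is the shape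
in which a sum over the antidiagonal of `s + 1` splits into sums over the antidiagonal of `s`. -/
theorem intr_wedgeTerm (α : Tot R L N₁) (β : Tot R L N₂) (x : L) {s p q : ℕ} (h : p + q = s + 1) :
    (wedgeTerm B (s + 1) p q (α p) (β q)).curryLeft x =
      Nat.rec (motive := fun _ => L [⋀^Fin s]→ₗ[R] N₃) 0
        (fun p _ => wedgeTerm B s p q (intr x α p) (β q)) p +
      Nat.rec (motive := fun _ => L [⋀^Fin s]→ₗ[R] N₃) 0
        (fun q _ => wedgeTerm B s p q (sgn α p) (intr x β q)) q := by
  rw [wedgeTerm_of_eq B h]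
  cases p with
  | zero =>
    cases q with
    | zero => omega
    | succ q =>
      rw [wedge_curryLeft_zero_succ]
      simp only [sgn_apply, pow_zero, one_smul]
      rw [wedgeTerm_of_eq B (by omega)]
      exact (zero_add _).symm
  | succ p =>
    cases q with
    | zero =>
      rw [wedge_curryLeft_succ_zero]
      simp only
      rw [wedgeTerm_of_eq B (by omega)]
      exact (add_zero _).symm
    | succ q =>
      rw [wedge_curryLeft_succ_succ]
      simp only [sgn_apply, map_zsmul, LinearMap.smul_apply]
      rw [wedgeTerm_of_eq B (show p + (q + 1) = s by omega),
        wedgeTerm_of_eq B (show p + 1 + q = s by omega)]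
      rfl

/-- Together with `tw_zero_apply` this characterizes the product completely, so shuffles are not
needed from here on. -/
theorem intr_tw (α : Tot R L N₁) (β : Tot R L N₂) (x : L) :
    intr x (tw B α β) = tw B (intr x α) β + tw B (sgn α) (intr x β) := by
  funext s
  have h1 : intr x (tw B α β) s = ∑ y ∈ Finset.HasAntidiagonal.antidiagonal (s + 1),
      (wedgeTerm B (s + 1) y.1 y.2 (α y.1) (β y.2)).curryLeft x := by
    change AlternatingMap.curryLeftLinearMap (tw B α β (s + 1)) x = _
    rw [tw_apply, map_sum, LinearMap.sum_apply]
    rfl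
  rw [h1, Finset.sum_congr rfl fun y hy =>
    intr_wedgeTerm B α β x (Finset.HasAntidiagonal.mem_antidiagonal.1 hy), Finset.sum_add_distrib,
    Finset.Nat.sum_antidiagonal_succ, Finset.Nat.sum_antidiagonal_succ']
  exact congrArg₂ (· + ·) (zero_add _) (zero_add _)

/-- Naturality of the product in the coefficients. Both sides obey the same contraction recursion
and agree in degree `0` by `h`. -/
theorem postc_tw (g₁ : N₁ →ₗ[R] N₁') (g₂ : N₂ →ₗ[R] N₂') (g₃ : N₃ →ₗ[R] N₃')
    (h : ∀ a b, g₃ (B a b) = B' (g₁ a) (g₂ b)) (α : Tot R L N₁) (β : Tot R L N₂) :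
    postc g₃ (tw B α β) = tw B' (postc g₁ α) (postc g₂ β) := by
  funext k
  induction k generalizing α β with
  | zero =>
    ext v
    simp only [postc_apply, LinearMap.compAlternatingMap_apply, tw_zero_apply, h]
  | succ k ih =>
    refine tot_succ_ext fun x => ?_
    simp only [intr_postc, intr_tw, map_add, sgn_postc, Pi.add_apply, ih]

theorem tw_ofConst_left (a : N₁) (β : Tot R L N₂) :
    tw B (ofConst a) β = postc (B a) β := by
  funext k
  induction k generalizing β with
  | zero =>
    ext v
    simp only [postc_apply, LinearMap.compAlternatingMap_apply, tw_zero_apply, ofConst_zero_apply]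
  | succ k ih =>
    refine tot_succ_ext fun x => ?_
    simp only [intr_postc, intr_tw, intr_ofConst, sgn_ofConst, map_zero, LinearMap.zero_apply,
      zero_add, ih]

theorem tw_ofConst_right (α : Tot R L N₁) (b : N₂) :
    tw B α (ofConst b) = postc (B.flip b) α := by
  funext k
  induction k generalizing α with
  | zero =>
    ext v
    simp only [postc_apply, LinearMap.compAlternatingMap_apply, tw_zero_apply, ofConst_zero_apply,
      LinearMap.flip_apply]
  | succ k ih =>
    refine tot_succ_ext fun x => ?_
    simp only [intr_postc, intr_tw, intr_ofConst, map_zero, add_zero, ih]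

/-- Contraction turns the pair of degrees `(c, c')` into `(c - 1, c')` and `(c, c' - 1)`, and the
antiderivation signs account for the change of `(-1)^(c c')`. Integer degrees let the induction pass
below zero without a case distinction. -/
theorem tw_comm {c c' : ℤ} {α : Tot R L N₁} {β : Tot R L N₂} (hα : Conc c α) (hβ : Conc c' β) :
    tw B α β = zsign (c * c') • tw B.flip β α := by
  funext k
  induction k generalizing c c' α β with
  | zero =>
    ext v
    simp only [Pi.smul_apply, AlternatingMap.smul_apply, tw_zero_apply, LinearMap.flip_apply]
    by_cases hc : c = 0
    · simp [hc]
    · rw [hα 0 (by simpa using Ne.symm hc)]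
      simp
  | succ k ih =>
    refine tot_succ_ext fun x => ?_
    simp only [intr_tw, map_zsmul, hα.sgn, hβ.sgn, LinearMap.smul_apply, Pi.add_apply,
      Pi.smul_apply, smul_add, ih (hα.intr x) hβ, ih hα (hβ.intr x), smul_smul, ← zsign_add]
    rw [add_comm]
    congr 2 <;> refine zsign_congr ?_ <;> ring_nf <;> simp

end TotalForms

/-! ### Cartan calculus for a bracket with anchor. -/

section Cartan

set_option linter.unusedSectionVars false

variable {R L : Type*} [CommRing R] [AddCommGroup L] [Module R L]
  [Algebra ℝ R] [Module ℝ L] [IsScalarTower ℝ R L]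

variable (R L) in
/-- A Lie bracket on the module `L` together with an anchor with values in the derivations of `R`,
subject to the Leibniz rule. -/
structure AnchoredBracket where
  br : L →ₗ[ℝ] L →ₗ[ℝ] L
  an : L →ₗ[R] Derivation ℝ R R
  self : ∀ x, br x x = 0
  jacobi : ∀ x y z, br x (br y z) + br y (br z x) + br z (br x y) = 0
  leib : ∀ (x y : L) (r : R), br x (r • y) = r • br x y + an x r • y

section Koszul

variable (br : L →ₗ[ℝ] L →ₗ[ℝ] L) (an : L →ₗ[R] Derivation ℝ R R)

theorem koszul_vecCons {k : ℕ} (θ : L [⋀^Fin (k + 1)]→ₗ[R] R) (x : L) (v : Fin (k + 1) → L) :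
    koszul br an θ (Matrix.vecCons x v) =
      an x (θ v) + ∑ j : Fin (k + 1), (-1 : ℤ) ^ ((j : ℕ) + 1) •
        an (v j) (θ (Matrix.vecCons x (j.removeNth v))) +
      (∑ j : Fin (k + 1), (-1 : ℤ) ^ ((j : ℕ) + 1) •
        θ (Matrix.vecCons (br x (v j)) (j.removeNth v)) +
      ∑ i : Fin k, ∑ j ≥ i.succ, (-1 : ℤ) ^ ((i.succ : ℕ) + j + 1) •
        θ (Matrix.vecCons (br (v i.castSucc) (v j))
        (j.removeNth (i.succ.castSucc.removeNth (Matrix.vecCons x v : Fin (k+2) → L))))) := by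
  have hI : Finset.Ici (0 : Fin (k + 1)) = Finset.univ := by ext; simp
  have e1 : ∀ (j : Fin (k + 1)), j.succ.removeNth (Fin.cons x v : Fin (k + 2) → L) =
      Matrix.vecCons x (j.removeNth v) := fun j => by
    ext l
    refine Fin.cases ?_ (fun l => ?_) l <;> simp [Fin.removeNth]
  have e0 : (0 : Fin (k + 2)).removeNth (Fin.cons x v : Fin (k + 2) → L) = v := by simp
  simp only [koszul, koszulBracketSum, Matrix.vecCons]
  congr 1
  · rw [Fin.sum_univ_succ]
    simp only [e1, e0, Fin.cons_zero, Fin.cons_succ, Fin.val_zero, pow_zero, one_smul,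
      Fin.val_succ, Matrix.vecCons]
  · rw [Fin.sum_univ_succ]
    simp only [e0, Fin.castSucc_zero, Fin.cons_zero, Fin.cons_succ, Fin.val_zero, zero_add, hI,
      ← Fin.succ_castSucc]

/-- Shifting both indices by one leaves the sign unchanged. The minus comes from interchanging `x`
with the bracket in the first two slots. These are the terms that cancel in Cartan's formula. -/
theorem koszulBracketSum_curryLeft {k : ℕ} (θ : L [⋀^Fin (k + 1)]→ₗ[R] R) (x : L)
    (v : Fin (k + 1) → L) :
    koszulBracketSum br (θ.curryLeft x) v = -∑ i : Fin k, ∑ j ≥ i.succ,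
      (-1 : ℤ) ^ ((i.succ : ℕ) + j + 1) • θ (Matrix.vecCons (br (v i.castSucc) (v j))
        (j.removeNth (i.succ.castSucc.removeNth (Matrix.vecCons x v : Fin (k+2) → L)))) := by
  cases k with
  | zero => simp [koszulBracketSum]
  | succ k =>
    simp only [koszulBracketSum]
    rw [← Finset.sum_neg_distrib]
    refine Finset.sum_congr rfl fun i _ => ?_
    have hIci : ∀ (m : ℕ) (a : Fin m), Finset.Ici a = Finset.univ.filter (a ≤ ·) := fun m a => by
      ext; simp
    simp only [hIci]
    rw [Finset.sum_filter, Finset.sum_filter, Fin.sum_univ_succ (n := k + 1), if_neg (by simp),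
      zero_add, ← Finset.sum_neg_distrib]
    refine Finset.sum_congr rfl fun j _ => ?_
    simp only [Fin.succ_le_succ_iff]
    split_ifs with hij
    · have e : j.succ.removeNth (i.succ.castSucc.removeNth (Matrix.vecCons x v : Fin (k + 3) → L)) =
          Matrix.vecCons x (j.removeNth (i.castSucc.removeNth v)) := by
        ext l
        refine Fin.cases ?_ (fun l => ?_) l <;> simp [Fin.removeNth, Matrix.vecCons]
      rw [e, AlternatingMap.curryLeft_apply_apply, Fin.val_succ, Fin.val_succ,
        show (i : ℕ) + 1 + (j + 1) + 1 = (i + j + 1) + 2 by ring, pow_add (-1 : ℤ) _ 2, ← smul_neg]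
      have hsw : θ (Matrix.vecCons x (Matrix.vecCons (br (v i.castSucc) (v j.succ))
            (j.removeNth (i.castSucc.removeNth v)))) =
          -θ (Matrix.vecCons (br (v i.castSucc) (v j.succ)) (Matrix.vecCons x
            (j.removeNth (i.castSucc.removeNth v)))) := by
        have := congrArg (fun α : Tot R L R => α k (j.removeNth (i.castSucc.removeNth v)))
          (intr_intr (br (v i.castSucc) (v j.succ)) x (Pi.single (k + 2) θ))
        simpa [intr_apply] using this
      rw [hsw]
      simp
    · simp

end Koszul

namespace AnchoredBracket

variable (𝓐 : AnchoredBracket R L)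

theorem antisymm (x y : L) : 𝓐.br y x = -𝓐.br x y := by
  have := 𝓐.self (x + y)
  simp only [map_add, LinearMap.add_apply, 𝓐.self, zero_add, add_zero] at this
  exact eq_neg_of_add_eq_zero_left this

/-- The differential on inhomogeneous forms. -/
def td : Tot R L R →ₗ[ℝ] Tot R L R where
  toFun θ k := match k with
    | 0 => 0
    | k + 1 => ceDifferential 𝓐.br 𝓐.an 𝓐.self 𝓐.leib k (θ k)
  map_add' θ θ' := by
    funext k
    cases k with
    | zero => simp
    | succ k => exact map_add _ _ _
  map_smul' c θ := by
    funext k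
    cases k with
    | zero => simp
    | succ k => exact map_smul (ceDifferential 𝓐.br 𝓐.an 𝓐.self 𝓐.leib k) c (θ k)

@[simp] theorem td_zero_apply (θ : Tot R L R) : 𝓐.td θ 0 = 0 := rfl

theorem td_succ_apply (θ : Tot R L R) (k : ℕ) :
    𝓐.td θ (k + 1) = ceDifferential 𝓐.br 𝓐.an 𝓐.self 𝓐.leib k (θ k) := rfl

theorem td_succ_apply_apply (θ : Tot R L R) (k : ℕ) (v : Fin (k + 1) → L) :
    𝓐.td θ (k + 1) v = koszul 𝓐.br 𝓐.an (θ k) v := rfl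

theorem td_single (k : ℕ) (θ : L [⋀^Fin k]→ₗ[R] R) : 𝓐.td (Pi.single k θ) =
    Pi.single (k + 1) (ceDifferential 𝓐.br 𝓐.an 𝓐.self 𝓐.leib k θ) := by
  funext j
  cases j with
  | zero => rw [Pi.single_eq_of_ne (by omega)]; rfl
  | succ j =>
    rw [td_succ_apply]
    by_cases h : j = k
    · subst h; simp
    · rw [Pi.single_eq_of_ne h, Pi.single_eq_of_ne (by omega), map_zero]

theorem td_sgn (θ : Tot R L R) : 𝓐.td (sgn θ) = -sgn (𝓐.td θ) := by
  funext k
  cases k with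
  | zero => simp [sgn_apply]
  | succ k =>
    rw [td_succ_apply, sgn_apply, Pi.neg_apply, sgn_apply, td_succ_apply, map_zsmul, pow_succ]
    simp

theorem conc_td {c : ℤ} {θ : Tot R L R} (h : Conc c θ) : Conc (c + 1) (𝓐.td θ) := by
  intro k hk
  cases k with
  | zero => rfl
  | succ k => rw [td_succ_apply, h k (by push_cast at hk; omega), map_zero]

/-- The Lie derivative. -/
def lieD (x : L) : Tot R L R →+ Tot R L R :=
  (intr x).toAddMonoidHom.comp 𝓐.td.toAddMonoidHom + 𝓐.td.toAddMonoidHom.comp (intr x).toAddMonoidHom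

theorem lieD_eq (x : L) (θ : Tot R L R) :
    𝓐.lieD x θ = intr x (𝓐.td θ) + 𝓐.td (intr x θ) := rfl

/-- The terms of the Koszul formula for `dθ(x, v)` in which `x` is neither the derivation nor an
entry of the bracket cancel against those of `d(i_x θ)(v)`. -/
theorem lieD_apply (x : L) (θ : Tot R L R) (k : ℕ) (v : Fin k → L) :
    𝓐.lieD x θ k v = 𝓐.an x (θ k v) - ∑ j, θ k (Function.update v j (𝓐.br x (v j))) := by
  rw [lieD_eq, Pi.add_apply, AlternatingMap.add_apply, intr_apply, td_succ_apply_apply]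
  cases k with
  | zero =>
    simp [koszul, koszulBracketSum, Matrix.vecCons]
  | succ k =>
    rw [td_succ_apply_apply, koszul_vecCons]
    have h : koszul 𝓐.br 𝓐.an (intr x θ k) v = ∑ j : Fin (k + 1), (-1 : ℤ) ^ (j : ℕ) •
        𝓐.an (v j) (θ (k + 1) (Matrix.vecCons x (j.removeNth v))) +
        koszulBracketSum 𝓐.br ((θ (k + 1)).curryLeft x) v := rfl
    rw [h, koszulBracketSum_curryLeft]
    have h2 : ∀ j : Fin (k + 1), θ (k + 1) (Function.update v j (𝓐.br x (v j))) =
        (-1 : ℤ) ^ (j : ℕ) • θ (k + 1) (Matrix.vecCons (𝓐.br x (v j)) (j.removeNth v)) := fun j => by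
      rw [← AlternatingMap.map_insertNth, Fin.insertNth_removeNth]
    simp only [h2, pow_succ, mul_neg, mul_one, neg_smul, Finset.sum_neg_distrib]
    abel

theorem lieD_zero_apply (x : L) (θ : Tot R L R) (v : Fin 0 → L) :
    𝓐.lieD x θ 0 v = 𝓐.an x (θ 0 v) := by
  simp [lieD_apply]

/-- The relation `[L_x, i_y] = i_[x,y]`, which drives the induction for every identity about Lie
derivatives. -/
theorem intr_lieD (x y : L) (θ : Tot R L R) :
    intr y (𝓐.lieD x θ) = 𝓐.lieD x (intr y θ) - intr (𝓐.br x y) θ := by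
  ext k v
  rw [intr_apply, lieD_apply, Pi.sub_apply, AlternatingMap.sub_apply, lieD_apply, Fin.sum_univ_succ,
    intr_apply, intr_apply]
  simp only [Matrix.vecCons, Fin.cons_zero, Fin.cons_succ, Fin.update_cons_zero, ← Fin.cons_update,
    intr_apply]
  abel

theorem lieD_sgn (x : L) (θ : Tot R L R) : 𝓐.lieD x (sgn θ) = sgn (𝓐.lieD x θ) := by
  simp [lieD_eq, td_sgn, intr_sgn, map_add]

/-- The product of two scalar forms. -/
abbrev tmul (θ θ' : Tot R L R) : Tot R L R := tw (LinearMap.lsmul R R) θ θ'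

theorem lieD_tmul (x : L) (θ θ' : Tot R L R) :
    𝓐.lieD x (tmul θ θ') = tmul (𝓐.lieD x θ) θ' + tmul θ (𝓐.lieD x θ') := by
  funext k
  induction k generalizing θ θ' with
  | zero =>
    ext v
    simp only [Pi.add_apply, AlternatingMap.add_apply, lieD_zero_apply, tmul, tw_zero_apply,
      LinearMap.lsmul_apply, smul_eq_mul, Derivation.leibniz]
    ring
  | succ k ih =>
    refine tot_succ_ext fun y => ?_
    simp only [tmul] at ih ⊢
    simp only [intr_lieD, intr_tw, map_add, map_sub, Pi.add_apply, Pi.sub_apply, LinearMap.sub_apply,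
      ih, ← lieD_sgn]
    abel

/-- Cartan's formula gives `i_x d = L_x - d i_x`. Since `L_x` is a derivation and `i_x` an
antiderivation, the contracted identity reduces to the Leibniz rule one degree lower. -/
theorem td_tmul (θ θ' : Tot R L R) :
    𝓐.td (tmul θ θ') = tmul (𝓐.td θ) θ' + tmul (sgn θ) (𝓐.td θ') := by
  have h : ∀ (x : L) (α : Tot R L R), intr x (𝓐.td α) = 𝓐.lieD x α - 𝓐.td (intr x α) :=
    fun x α => by rw [lieD_eq]; abel
  funext k
  induction k generalizing θ θ' with
  | zero =>
    ext v
    simp [tmul, tw_zero_apply]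
  | succ k ih =>
    refine tot_succ_ext fun x => ?_
    rw [h, lieD_tmul]
    simp only [tmul] at ih ⊢
    simp only [intr_tw, map_add, Pi.add_apply, Pi.sub_apply, ih, h, map_sub, LinearMap.sub_apply,
      intr_sgn, td_sgn, sgn_sgn, map_neg, LinearMap.neg_apply, Pi.neg_apply]
    abel

theorem tmul_ofConst (r : R) (θ : Tot R L R) : tmul θ (ofConst r) = r • θ := by
  rw [tmul, tw_ofConst_right]
  ext k v
  simp [postc_apply, mul_comm]

theorem ofConst_tmul (r : R) (θ : Tot R L R) : tmul (ofConst r) θ = r • θ := by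
  rw [tmul, tw_ofConst_left]
  ext k v
  simp [postc_apply]

theorem td_smul (r : R) (θ : Tot R L R) :
    𝓐.td (r • θ) = tmul (𝓐.td (ofConst r)) θ + r • 𝓐.td θ := by
  rw [← ofConst_tmul, td_tmul, sgn_ofConst, ofConst_tmul]

/-- In degree `0` the claim is that the anchor respects brackets. Applied to `r z`, Jacobi and
Leibniz show only that the defect kills the module `L`, which need not be faithful. A further
argument gives that the square of the defect is zero, and reducedness of `R` concludes. In higher
degrees the claim follows by contraction and the Jacobi identity. -/
theorem lieD_lieD_sub [IsReduced R] (x y : L) (θ : Tot R L R) :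
    𝓐.lieD x (𝓐.lieD y θ) - 𝓐.lieD y (𝓐.lieD x θ) = 𝓐.lieD (𝓐.br x y) θ := by
  have han : ∀ x y : L, ∀ r : R,
      𝓐.an x (𝓐.an y r) - 𝓐.an y (𝓐.an x r) - 𝓐.an (𝓐.br x y) r = 0 := by
    intro x y r
    have key : ∀ (x y z : L), (𝓐.an x (𝓐.an y r) - 𝓐.an y (𝓐.an x r) - 𝓐.an (𝓐.br x y) r) • z = 0 := by
      intro x y z
      have j1 := 𝓐.jacobi x y (r • z)
      have j2 := congrArg (r • ·) (𝓐.jacobi x y z)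
      simp only [𝓐.antisymm x (r • z), 𝓐.antisymm (𝓐.br x y) (r • z), 𝓐.antisymm x z,
        𝓐.antisymm (𝓐.br x y) z, map_neg, 𝓐.leib, map_add, smul_add, smul_neg, smul_zero] at j1 j2
      rw [sub_smul, sub_smul]
      have := sub_eq_zero.2 (j1.trans j2.symm)
      rw [← this]
      abel
    set C := 𝓐.an x (𝓐.an y r) - 𝓐.an y (𝓐.an x r) - 𝓐.an (𝓐.br x y) r with hC
    have h1 : 𝓐.an (C • x) = 0 := by rw [key x y x, map_zero]
    -- As `C • x = 0`, the anchors of `C • x` and of `[C • x, y]` vanish. Expanding the latter by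
    -- Leibniz, and applying `ρ(y)` to `C ρ(x)(r) = 0`, expresses every term of `C • C` through
    -- `ρ(y)(C) ρ(x)(r)`, with cancelling signs.
    have h2 : C • C = (0 : R) := by
      have e : 𝓐.br (C • x) y = C • 𝓐.br x y - 𝓐.an y C • x := by
        rw [𝓐.antisymm y, 𝓐.leib, 𝓐.antisymm x y]; simp [sub_eq_add_neg, add_comm]
      have e3 : 𝓐.an (𝓐.br (C • x) y) r = 0 := by rw [key x y x]; simp
      rw [e, map_sub, map_smul, map_smul, Derivation.sub_apply, Derivation.smul_apply,
        Derivation.smul_apply] at e3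
      have e4 : 𝓐.an y (C • 𝓐.an x r) = 0 := by
        have : C • 𝓐.an x r = 0 := by rw [← Derivation.smul_apply, ← map_smul, h1]; rfl
        rw [this, map_zero]
      have e5 : C • 𝓐.an x (𝓐.an y r) = 0 := by
        rw [← Derivation.smul_apply, ← map_smul, h1]; rfl
      rw [smul_eq_mul, Derivation.leibniz] at e4
      nth_rewrite 2 [hC]
      rw [smul_sub, smul_sub, e5]
      simp only [smul_eq_mul] at e3 e4 ⊢
      linear_combination -e4 - e3
    exact pow_eq_zero_iff (two_ne_zero) |>.1 (by rw [pow_two]; exact h2)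
  funext k
  induction k generalizing θ with
  | zero =>
    ext v
    simp only [Pi.sub_apply, AlternatingMap.sub_apply, lieD_zero_apply]
    exact sub_eq_zero.1 (han x y _)
  | succ k ih =>
    refine tot_succ_ext fun z => ?_
    have hj : 𝓐.br (𝓐.br x y) z = 𝓐.br x (𝓐.br y z) - 𝓐.br y (𝓐.br x z) := by
      have := 𝓐.jacobi x y z
      rw [𝓐.antisymm x z, map_neg, 𝓐.antisymm (𝓐.br x y) z, ] at this
      rw [← sub_eq_zero, ← neg_eq_zero, ← this]
      abel
    have hs : ∀ a b : L, intr (a - b) θ = intr a θ - intr b θ := fun a b => by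
      rw [sub_eq_add_neg, intr_add_left, intr_neg_left, sub_eq_add_neg]
    simp only [map_sub, intr_lieD, hj, hs, Pi.sub_apply, ← ih (intr z θ)]
    abel

/-- By Cartan's formula `i_x d d θ = (L_x d - d L_x) θ + d d i_x θ`, so the claim reduces to `[L_x,
d] = 0` and the claim one degree lower. -/
theorem td_td [IsReduced R] (θ : Tot R L R) : 𝓐.td (𝓐.td θ) = 0 := by
  have h : ∀ (x : L) (α : Tot R L R), intr x (𝓐.td α) = 𝓐.lieD x α - 𝓐.td (intr x α) :=
    fun x α => by rw [lieD_eq]; abel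
  -- This is proved before `d² = 0` and without it, from the commutator relation of the Lie
  -- derivatives.
  have hcomm : ∀ (x : L) (k : ℕ) (α : Tot R L R), 𝓐.lieD x (𝓐.td α) k = 𝓐.td (𝓐.lieD x α) k := by
    intro x k
    induction k with
    | zero =>
      intro α
      ext v
      simp [lieD_zero_apply]
    | succ k ih =>
      intro α
      refine tot_succ_ext fun y => ?_
      have hl := congrFun (𝓐.lieD_lieD_sub x y α) k
      rw [Pi.sub_apply, sub_eq_iff_eq_add] at hl
      rw [intr_lieD, h, h, h y, intr_lieD]
      simp only [map_sub, Pi.sub_apply, ih (intr y α), hl]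
      abel
  funext k
  induction k generalizing θ with
  | zero => rfl
  | succ k ih =>
    refine tot_succ_ext fun x => ?_
    rw [h, Pi.sub_apply, hcomm, h, map_sub, Pi.sub_apply, ih]
    simp

end AnchoredBracket

end Cartan

/-! ### Forms with values in a graded module, and frames up to a factor. -/

section GradedForms

set_option linter.unusedSectionVars false

variable {R L : Type*} [CommRing R] [AddCommGroup L] [Module R L]
  {S : Finset ℤ} {V : S → Type*} [∀ z, AddCommGroup (V z)] [∀ z, Module R (V z)]

variable (R L V) in
/-- Forms with values in a graded module. -/
abbrev GForm := ∀ (p : ℕ) (z : S), L [⋀^Fin p]→ₗ[R] V z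

/-- The component of a form with values in the summand of degree `z`. -/
def gproj (z : S) : GForm R L V →ₗ[R] Tot R L (V z) where
  toFun η p := η p z
  map_add' _ _ := rfl
  map_smul' _ _ := rfl

theorem gproj_apply (z : S) (η : GForm R L V) (p : ℕ) : gproj z η p = η p z := rfl

theorem gform_ext {η η' : GForm R L V} (h : ∀ z, gproj z η = gproj z η') : η = η' := by
  funext p z
  exact congrFun (h z) p

/-- The action of the scalar forms. -/
def act : Tot R L R →ₗ[R] GForm R L V →ₗ[R] GForm R L V :=
  LinearMap.mk₂ R (fun θ η p z => tw (LinearMap.lsmul R (V z)) θ (gproj z η) p)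
    (fun _ _ _ => by funext p z; simp) (fun _ _ _ => by funext p z; simp)
    (fun _ _ _ => by funext p z; simp) (fun _ _ _ => by funext p z; simp)

theorem gproj_act (z : S) (θ : Tot R L R) (η : GForm R L V) :
    gproj z (act θ η) = tw (LinearMap.lsmul R (V z)) θ (gproj z η) := rfl

/-- An element of a summand, as a form of degree `0`. -/
def emb (z : S) : V z →ₗ[R] GForm R L V :=
  LinearMap.pi fun p => LinearMap.pi fun z' =>
    LinearMap.proj p ∘ₗ ofConst ∘ₗ LinearMap.proj z' ∘ₗ LinearMap.single R V z

theorem gproj_emb (z z' : S) (v : V z) :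
    gproj z' (emb z v : GForm R L V) = ofConst (Pi.single z v z' : V z') := rfl

/-- The form `η` is homogeneous of total degree `c`. -/
def GHom (c : ℤ) (η : GForm R L V) : Prop := ∀ (p : ℕ) (z : S), (p : ℤ) + z ≠ c → η p z = 0

theorem ghom_emb (z : S) (v : V z) : GHom (z : ℤ) (emb z v : GForm R L V) := by
  intro p z' h
  change gproj z' (emb z v : GForm R L V) p = 0
  rw [gproj_emb]
  cases p with
  | zero =>
    have hz : z' ≠ z := by rintro rfl; simp at h
    rw [Pi.single_eq_of_ne hz, map_zero]
    rfl
  | succ p => rw [ofConst_succ]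

theorem act_ofConst [Algebra ℝ R] (r : R) (η : GForm R L V) : act (ofConst r) η = r • η := by
  refine gform_ext fun z => ?_
  rw [gproj_act, tw_ofConst_left]
  rfl

theorem conc_ofConst (r : R) : Conc 0 (ofConst r : Tot R L R) := by
  intro k hk
  cases k with
  | zero => simp at hk
  | succ k => rw [ofConst_succ]

variable {H : S → S → Type*} [∀ l j, AddCommGroup (H l j)] [∀ l j, Module R (H l j)]

/-- A local frame of a graded module, up to the factor `f`: elements `e` and functionals `ε` with
`ε a (e b) = f δ_ab` and `∑ ε a (v) e a = f v`; it is required to compute the given trace. -/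
structure GFrame (ev : ∀ l j, H l j →ₗ[R] V l →ₗ[R] V j) (tr : ∀ z, H z z →ₗ[R] R) where
  f : R
  rank : S → ℕ
  e : ∀ z, Fin (rank z) → V z
  ε : ∀ z, Fin (rank z) → V z →ₗ[R] R
  dual : ∀ z a b, ε z a (e z b) = if a = b then f else 0
  span : ∀ z v, ∑ a, ε z a v • e z a = f • v
  trace : ∀ z (φ : H z z), f • tr z φ = ∑ a, ε z a (ev z z φ (e z a))

variable {ev : ∀ l j, H l j →ₗ[R] V l →ₗ[R] V j} {tr : ∀ z, H z z →ₗ[R] R}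

variable (ev tr) in
/-- The factors of the local frames separate the elements of `N`. -/
def Separating (N : Type*) [AddCommGroup N] [Module R N] : Prop :=
  ∀ v : N, (∀ fr : GFrame ev tr, fr.f • fr.f • v = 0) → v = 0

theorem Separating.tot {N : Type*} [AddCommGroup N] [Module R N] (h : Separating ev tr N) :
    Separating ev tr (Tot R L N) := by
  intro α hα
  ext k v
  refine h _ fun fr => ?_
  exact congrArg (fun β : Tot R L N => β k v) (hα fr)

theorem Separating.eq_of_smul {N : Type*} [AddCommGroup N] [Module R N] (h : Separating ev tr N)
    {a b : N} (hab : ∀ fr : GFrame ev tr, fr.f • a = fr.f • b) : a = b := by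
  rw [← sub_eq_zero]
  refine h _ fun fr => ?_
  rw [smul_sub fr.f a b, hab, sub_self, smul_zero]

theorem alt_sum_apply {N ι : Type*} [AddCommGroup N] [Module R N] {k : ℕ} (s : Finset ι)
    (f : ι → L [⋀^Fin k]→ₗ[R] N) (v : Fin k → L) : (∑ i ∈ s, f i) v = ∑ i ∈ s, f i v := by
  classical
  induction s using Finset.induction_on with
  | empty => simp
  | insert a s ha ih => rw [Finset.sum_insert ha, Finset.sum_insert ha, AlternatingMap.add_apply, ih]

namespace GFrame

variable (fr : GFrame ev tr)

/-- The index set of a local frame. -/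
abbrev Idx := Σ z : S, Fin (fr.rank z)

/-- The elements of the frame, as forms. -/
def E (i : fr.Idx) : GForm R L V := emb i.1 (fr.e i.1 i.2)

/-- The coefficients of a form in the frame. -/
def co (i : fr.Idx) : GForm R L V →ₗ[R] Tot R L R := postc (fr.ε i.1 i.2) ∘ₗ gproj i.1

theorem co_apply (i : fr.Idx) (η : GForm R L V) :
    fr.co i η = postc (fr.ε i.1 i.2) (gproj i.1 η) := rfl

theorem co_conc {c : ℤ} {η : GForm R L V} (h : GHom c η) (i : fr.Idx) :
    Conc (c - i.1) (fr.co i η) := by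
  intro k hk
  rw [co_apply, postc_apply, gproj_apply, h k i.1 (by omega)]
  ext; simp

theorem co_E (i j : fr.Idx) :
    fr.co i (fr.E j : GForm R L V) = if i = j then ofConst fr.f else 0 := by
  obtain ⟨z, a⟩ := i
  obtain ⟨z', b⟩ := j
  rw [co_apply, E, gproj_emb]
  have hp : ∀ v : V z, postc (fr.ε z a) (ofConst v : Tot R L (V z)) = ofConst (fr.ε z a v) := by
    intro v
    funext k
    cases k with
    | zero => ext v; simp [postc_apply, ofConst_zero_apply]
    | succ k => simp [postc_apply, ofConst_succ]
  rw [hp]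
  by_cases hz : z = z'
  · subst hz
    rw [Pi.single_eq_same, fr.dual]
    by_cases hab : a = b
    · subst hab; simp
    · rw [if_neg hab, if_neg (by simpa using hab), map_zero]
  · rw [Pi.single_eq_of_ne hz, map_zero, map_zero, if_neg (by rintro ⟨⟩; exact hz rfl)]

variable [Algebra ℝ R]

theorem co_act (i : fr.Idx) (θ : Tot R L R) (η : GForm R L V) :
    fr.co i (act θ η) = AnchoredBracket.tmul θ (fr.co i η) := by
  rw [co_apply, gproj_act]
  exact postc_tw _ _ LinearMap.id (fr.ε i.1 i.2) (fr.ε i.1 i.2) (by simp) θ _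

theorem sum_act (η : GForm R L V) : ∑ i, act (fr.co i η) (fr.E i) = fr.f • η := by
  refine gform_ext fun z => ?_
  simp only [map_sum, gproj_act, E, gproj_emb, tw_ofConst_right]
  rw [Fintype.sum_sigma, Finset.sum_eq_single z]
  · ext k v
    simp only [Pi.single_eq_same, Finset.sum_apply, alt_sum_apply, postc_apply, co_apply,
      LinearMap.compAlternatingMap_apply, LinearMap.flip_apply, LinearMap.lsmul_apply, map_smul,
      Pi.smul_apply, AlternatingMap.smul_apply]
    exact fr.span z (gproj z η k v)
  · intro z' _ hz
    refine Finset.sum_eq_zero fun a _ => ?_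
    rw [Pi.single_eq_of_ne hz.symm]
    ext k v
    simp [postc_apply]
  · simp

end GFrame

/-! ### Graded linear operators, connections up to homotopy and traces of operators. -/

section Operators

variable [Algebra ℝ R] [∀ z, Module ℝ (V z)] [∀ z, SMulCommClass R ℝ (V z)]
  [∀ z, IsScalarTower ℝ R (V z)]

theorem algebraMap_smul_gform (c : ℝ) (η : GForm R L V) : algebraMap ℝ R c • η = c • η := by
  funext p z
  ext v
  simp

theorem act_real_smul (c : ℝ) (θ : Tot R L R) (η : GForm R L V) :
    act θ (c • η) = c • act θ η := by
  rw [← algebraMap_smul_gform, map_smul, algebraMap_smul_gform]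

/-- The graded linear operators of degree `m`. -/
def gradedLinear (m : ℕ) : Submodule ℝ (Module.End ℝ (GForm R L V)) where
  carrier := {T | (∀ (c : ℤ) (η : GForm R L V), GHom c η → GHom (c + m) (T η)) ∧
    ∀ (l : ℕ) (θ : L [⋀^Fin l]→ₗ[R] R) (η : GForm R L V),
      T (act (Pi.single l θ) η) = zsign (m * l) • act (Pi.single l θ) (T η)}
  add_mem' := by
    rintro T T' ⟨h1, h2⟩ ⟨h1', h2'⟩
    refine ⟨fun c η hη p z hp => ?_, fun l θ η => ?_⟩
    · rw [LinearMap.add_apply, Pi.add_apply, Pi.add_apply, h1 c η hη p z hp, h1' c η hη p z hp,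
        add_zero]
    · rw [LinearMap.add_apply, h2, h2', LinearMap.add_apply, map_add, smul_add]
  zero_mem' := ⟨fun c η _ p z _ => rfl, fun l θ η => by simp⟩
  smul_mem' := by
    rintro c T ⟨h1, h2⟩
    refine ⟨fun d η hη p z hp => ?_, fun l θ η => ?_⟩
    · rw [LinearMap.smul_apply, Pi.smul_apply, Pi.smul_apply, h1 d η hη p z hp, smul_zero]
    · rw [LinearMap.smul_apply, h2, LinearMap.smul_apply, act_real_smul, smul_comm]

theorem gradedLinear_mul {m m' : ℕ} {T T' : Module.End ℝ (GForm R L V)} (h : T ∈ gradedLinear m)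
    (h' : T' ∈ gradedLinear m') : T * T' ∈ gradedLinear (m + m') := by
  refine ⟨fun c η hη => ?_, fun l θ η => ?_⟩
  · have := h.1 _ _ (h'.1 _ _ hη)
    rwa [show c + m' + m = c + (m + m' : ℕ) by push_cast; ring] at this
  · rw [Module.End.mul_apply, h'.2, map_zsmul, h.2, smul_smul, ← zsign_add]
    congr 2
    push_cast
    ring

theorem gradedLinear_one : (1 : Module.End ℝ (GForm R L V)) ∈ gradedLinear 0 := by
  refine ⟨fun c η hη => by simpa using hη, fun l θ η => by simp⟩

theorem gradedLinear_pow {m : ℕ} {T : Module.End ℝ (GForm R L V)} (h : T ∈ gradedLinear m)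
    (i : ℕ) : T ^ i ∈ gradedLinear (m * i) := by
  induction i with
  | zero => simpa using gradedLinear_one
  | succ i ih => rw [pow_succ]; exact gradedLinear_mul ih h

/-- The degree is an integer because coefficients in a frame have degree `c - z`, which may be
negative; such coefficients vanish. -/
theorem gradedLinear_act {m : ℕ} {T : Module.End ℝ (GForm R L V)} (h : T ∈ gradedLinear m)
    {c : ℤ} {θ : Tot R L R} (hθ : Conc c θ) (η : GForm R L V) :
    T (act θ η) = zsign (m * c) • act θ (T η) := by
  rcases lt_or_ge c 0 with hc | hc
  · simp [hθ.eq_zero_of_neg hc]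
  · lift c to ℕ using hc
    rw [hθ.eq_single, h.2]

theorem gradedLinear_smul {m : ℕ} {T : Module.End ℝ (GForm R L V)} (h : T ∈ gradedLinear m)
    (r : R) (η : GForm R L V) : T (r • η) = r • T η := by
  rw [← act_ofConst, gradedLinear_act h (conc_ofConst r), act_ofConst]
  simp

variable [Module ℝ L] [IsScalarTower ℝ R L] (𝓐 : AnchoredBracket R L)

/-- `D` is a connection up to homotopy. -/
structure IsConn (D : Module.End ℝ (GForm R L V)) : Prop where
  degree : ∀ (c : ℤ) (η : GForm R L V), GHom c η → GHom (c + 1) (D η)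
  leibniz : ∀ (l : ℕ) (θ : L [⋀^Fin l]→ₗ[R] R) (η : GForm R L V),
    D (act (Pi.single l θ) η) =
      act (𝓐.td (Pi.single l θ)) η + zsign l • act (Pi.single l θ) (D η)

variable {𝓐} {D D' T : Module.End ℝ (GForm R L V)}

theorem IsConn.act (hD : IsConn 𝓐 D) {c : ℤ} {θ : Tot R L R} (hθ : Conc c θ) (η : GForm R L V) :
    D (act θ η) = Algd.act (𝓐.td θ) η + zsign c • Algd.act θ (D η) := by
  rcases lt_or_ge c 0 with hc | hc
  · simp [hθ.eq_zero_of_neg hc]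
  · lift c to ℕ using hc
    rw [hθ.eq_single, hD.leibniz]

theorem IsConn.smul (hD : IsConn 𝓐 D) (r : R) (η : GForm R L V) :
    D (r • η) = Algd.act (𝓐.td (ofConst r)) η + r • D η := by
  rw [← act_ofConst, hD.act (conc_ofConst r), zsign_zero, one_smul, act_ofConst]

/-- The terms `dθ ∧ η` of the two Leibniz rules cancel. -/
theorem IsConn.sub_mem (hD : IsConn 𝓐 D) (hD' : IsConn 𝓐 D') : D' - D ∈ gradedLinear 1 := by
  refine ⟨fun c η hη p z hp => ?_, fun l θ η => ?_⟩
  · rw [LinearMap.sub_apply, Pi.sub_apply, Pi.sub_apply, hD.degree c η hη p z hp,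
      hD'.degree c η hη p z hp, sub_zero]
  · rw [LinearMap.sub_apply, hD.leibniz, hD'.leibniz, LinearMap.sub_apply, map_sub, smul_sub]
    simp

/-- The graded commutator of a connection up to homotopy and a graded linear operator is graded
linear. -/
theorem IsConn.commutator_mem (hD : IsConn 𝓐 D) {m : ℕ} (hT : T ∈ gradedLinear m) :
    D * T - zsign m • (T * D) ∈ gradedLinear (m + 1) := by
  refine ⟨fun c η hη p z hp => ?_, fun l θ η => ?_⟩
  · have h1 := hD.degree _ _ (hT.1 _ _ hη) p z (by push_cast at hp; omega)
    have h2 := hT.1 _ _ (hD.degree _ _ hη) p z (by push_cast at hp; omega)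
    simp [h1, h2]
  · simp only [LinearMap.sub_apply, Module.End.mul_apply, LinearMap.smul_apply]
    rw [hT.2, hD.leibniz, map_zsmul, hD.leibniz, map_add, map_zsmul, hT.2,
      gradedLinear_act hT (𝓐.conc_td (conc_single l θ))]
    simp only [map_sub, map_zsmul, smul_sub, smul_add, smul_smul, ← zsign_add, add_sub_add_comm]
    -- The two terms containing `dθ` cancel, since their sign exponents differ by `2m`.
    rw [zsign_congr (a := m + m * (l + 1)) (b := m * l), sub_self, zero_add]
    · congr 3 <;> (push_cast; ring)
    · ring_nf
      simp

/-- In `D D (θ ∧ η)` the term `d d θ ∧ η` vanishes, and the two terms `dθ ∧ D η` carry the opposite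
signs `(-1)^(l+1)` and `(-1)^l`. -/
theorem IsConn.sq_mem [IsReduced R] (hD : IsConn 𝓐 D) : D * D ∈ gradedLinear 2 := by
  refine ⟨fun c η hη => ?_, fun l θ η => ?_⟩
  · have := hD.degree _ _ (hD.degree _ _ hη)
    rwa [add_assoc] at this
  · simp only [Module.End.mul_apply]
    rw [hD.leibniz, map_add, hD.act (𝓐.conc_td (conc_single l θ)), map_zsmul, hD.leibniz, 𝓐.td_td]
    simp only [map_zero, LinearMap.zero_apply, zero_add, smul_add, smul_smul, ← zsign_add]
    rw [← add_assoc, ← add_smul, zsign_add, zsign_congr (a := l + l) (b := ((2 : ℕ) : ℤ) * l)]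
    · simp [zsign, Int.negOnePow_one]
    · push_cast
      ring_nf
      simp

variable (ev tr) in
/-- `τ` is the graded trace of `T`. -/
def IsTr (T : Module.End ℝ (GForm R L V)) (τ : Tot R L R) : Prop :=
  ∀ fr : GFrame ev tr, fr.f • τ = ∑ i, zsign (i.1 : ℤ) • fr.co i (T (fr.E i))

theorem IsTr.add {T' : Module.End ℝ (GForm R L V)} {τ τ' : Tot R L R} (h : IsTr ev tr T τ)
    (h' : IsTr ev tr T' τ') : IsTr ev tr (T + T') (τ + τ') := by
  intro fr
  rw [smul_add fr.f τ τ', h, h', ← Finset.sum_add_distrib]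
  simp

theorem IsTr.sub {T' : Module.End ℝ (GForm R L V)} {τ τ' : Tot R L R} (h : IsTr ev tr T τ)
    (h' : IsTr ev tr T' τ') : IsTr ev tr (T - T') (τ - τ') := by
  intro fr
  rw [smul_sub fr.f τ τ', h, h', ← Finset.sum_sub_distrib]
  simp [smul_sub]

theorem isTr_zero : IsTr ev tr (0 : Module.End ℝ (GForm R L V)) 0 := fun fr => by simp

theorem IsTr.of_nsmul {n : ℕ} (hn : n ≠ 0) {τ : Tot R L R} (h : IsTr ev tr (n • T) (n • τ)) :
    IsTr ev tr T τ := by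
  intro fr
  refine nsmul_cancel R hn ?_
  rw [smul_comm n fr.f τ, h fr, Finset.smul_sum]
  refine Finset.sum_congr rfl fun i _ => ?_
  rw [LinearMap.smul_apply, map_nsmul, smul_comm]

theorem IsTr.unique (hsep : Separating ev tr R) {τ τ' : Tot R L R} (h : IsTr ev tr T τ)
    (h' : IsTr ev tr T τ') : τ = τ' :=
  hsep.tot.eq_of_smul fun fr => (h fr).trans (h' fr).symm

end Operators
end GradedForms

/-! ### The graded trace of a graded commutator. -/

section Supertrace

/-- The parity that makes the graded trace of a graded commutator of matrices vanish: the Koszul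
sign of exchanging two entries compensates the signs of trace and commutator. -/
theorem even_commutator_sign (x y m : ℤ) : Even ((x + (x + m - y)) -
    (y + (m + m * (y + 1 - x)) + (y + 1 - x) * (x + m - y))) := by
  by_cases hx : Even x <;> by_cases hy : Even y <;> by_cases hm : Even m <;>
    simp [Int.even_sub, Int.even_add, Int.even_mul, hx, hy, hm]

set_option linter.unusedSectionVars false

variable {R L : Type*} [CommRing R] [AddCommGroup L] [Module R L]
  {S : Finset ℤ} {V : S → Type*} [∀ z, AddCommGroup (V z)] [∀ z, Module R (V z)]
  {H : S → S → Type*} [∀ l j, AddCommGroup (H l j)] [∀ l j, Module R (H l j)]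
  {ev : ∀ l j, H l j →ₗ[R] V l →ₗ[R] V j} {tr : ∀ z, H z z →ₗ[R] R}
  [Algebra ℝ R] [∀ z, Module ℝ (V z)] [∀ z, SMulCommClass R ℝ (V z)]
  [∀ z, IsScalarTower ℝ R (V z)] [Module ℝ L] [IsScalarTower ℝ R L] {𝓐 : AnchoredBracket R L}
  {D T : Module.End ℝ (GForm R L V)}

-- The matrix of the graded commutator: the differential of the entries of `T`, plus a graded
-- commutator of matrices. The frame expansion is available only for `f T(E_a)`, and `f D(η) = D(f
-- η) - df ∧ η` accounts for the term with `df`.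
open AnchoredBracket in
theorem IsConn.smul_co_commutator (hD : IsConn 𝓐 D) {m : ℕ} (hT : T ∈ gradedLinear m)
    (fr : GFrame ev tr) (c a : fr.Idx) :
    fr.f • fr.co c ((D * T - zsign m • (T * D)) (fr.E a)) =
      fr.f • 𝓐.td (fr.co c (T (fr.E a))) - tmul (𝓐.td (ofConst fr.f)) (fr.co c (T (fr.E a))) +
      ∑ b, (zsign (a.1 + m - b.1) • tmul (fr.co b (T (fr.E a))) (fr.co c (D (fr.E b))) -
        zsign (m + m * (a.1 + 1 - b.1)) •
          tmul (fr.co b (D (fr.E a))) (fr.co c (T (fr.E b)))) := by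
  have hE : GHom (a.1 : ℤ) (fr.E a : GForm R L V) := ghom_emb _ _
  have h1 : fr.f • fr.co c (D (T (fr.E a))) =
      fr.f • 𝓐.td (fr.co c (T (fr.E a))) - tmul (𝓐.td (ofConst fr.f)) (fr.co c (T (fr.E a))) +
      ∑ b, zsign (a.1 + m - b.1) • tmul (fr.co b (T (fr.E a))) (fr.co c (D (fr.E b))) := by
    have e1 := congrArg (fr.co c) (hD.smul fr.f (T (fr.E a)))
    rw [← fr.sum_act (T (fr.E a)), map_sum, map_sum] at e1
    simp only [hD.act (fr.co_conc (hT.1 _ _ hE) _), map_add, map_zsmul, fr.co_act, fr.co_E,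
      Finset.sum_add_distrib, map_smul] at e1
    rw [Finset.sum_eq_single c] at e1
    · rw [if_pos rfl, tmul_ofConst] at e1
      rw [← sub_eq_iff_eq_add'] at e1
      rw [← e1]
      abel
    · intro b _ hb
      rw [if_neg hb.symm, tmul, map_zero]
    · simp
  have h2 : fr.f • fr.co c (T (D (fr.E a))) =
      ∑ b, zsign (m * (a.1 + 1 - b.1)) • tmul (fr.co b (D (fr.E a))) (fr.co c (T (fr.E b))) := by
    rw [← map_smul, ← gradedLinear_smul hT, ← fr.sum_act (D (fr.E a)), map_sum, map_sum]
    simp only [gradedLinear_act hT (fr.co_conc (hD.degree _ _ hE) _), map_zsmul, fr.co_act]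
  rw [LinearMap.sub_apply, map_sub, LinearMap.smul_apply, map_zsmul, Module.End.mul_apply,
    Module.End.mul_apply, smul_sub fr.f (fr.co c (D (T (fr.E a)))), h1,
    smul_comm fr.f (zsign m) (fr.co c (T (D (fr.E a)))), h2, Finset.sum_sub_distrib,
    Finset.smul_sum]
  simp only [smul_smul, ← zsign_add]
  abel

open AnchoredBracket in
/-- The graded trace of the graded commutator of a connection up to homotopy with `T` is the
differential of the graded trace of `T`. -/
theorem IsConn.trace_commutator (hsep : Separating ev tr R) (hD : IsConn 𝓐 D) {m : ℕ}
    (hT : T ∈ gradedLinear m) {τ τ' : Tot R L R} (hτ : IsTr ev tr T τ)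
    (hτ' : IsTr ev tr (D * T - zsign m • (T * D)) τ') : τ' = 𝓐.td τ := by
  rw [← sub_eq_zero]
  -- Two factors `f` are needed: one for writing `τ'` as a sum over the frame, one for expanding the
  -- operators in `smul_co_commutator`.
  refine hsep.tot _ fun fr => ?_
  have hE : ∀ a : fr.Idx, GHom (a.1 : ℤ) (fr.E a : GForm R L V) := fun a => ghom_emb _ _
  rw [smul_sub fr.f τ' (𝓐.td τ), hτ' fr, smul_sub fr.f _ (fr.f • 𝓐.td τ), sub_eq_zero,
    Finset.smul_sum]
  simp only [smul_comm fr.f (zsign _), hD.smul_co_commutator hT, smul_add, smul_sub,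
    Finset.sum_add_distrib, Finset.sum_sub_distrib, Finset.smul_sum, smul_smul, ← zsign_add]
  -- The commutator of matrices has graded trace zero: interchange the summation indices and commute
  -- the entries.
  have hcancel : (∑ a : fr.Idx, ∑ b : fr.Idx, zsign (a.1 + (a.1 + m - b.1)) •
        tmul (fr.co b (T (fr.E a))) (fr.co a (D (fr.E b)))) -
      ∑ a : fr.Idx, ∑ b : fr.Idx, zsign (a.1 + (m + m * (a.1 + 1 - b.1))) •
        tmul (fr.co b (D (fr.E a))) (fr.co a (T (fr.E b))) = 0 := by
    rw [sub_eq_zero]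
    conv_rhs => rw [Finset.sum_comm]
    refine Finset.sum_congr rfl fun a _ => Finset.sum_congr rfl fun b _ => ?_
    have hc := tw_comm (LinearMap.lsmul R R) (fr.co_conc (hD.degree _ _ (hE b)) a)
      (fr.co_conc (hT.1 _ _ (hE a)) b)
    have hflip : (LinearMap.lsmul R R).flip = LinearMap.lsmul R R := by
      ext; simp
    rw [hflip] at hc
    rw [tmul, tmul, hc, smul_smul, ← zsign_add]
    congr 1
    refine zsign_congr ?_
    exact even_commutator_sign _ _ _
  rw [hcancel, add_zero]
  -- What remains is `f d(f τ) - df ∧ (f τ)`, which equals `f² dτ` by the Leibniz rule.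
  have hκ := hτ fr
  have e1 : 𝓐.td (fr.f • τ) = _ := congrArg 𝓐.td hκ
  have e2 : tmul (𝓐.td (ofConst fr.f)) (fr.f • τ) = _ := congrArg (tmul (𝓐.td (ofConst fr.f))) hκ
  rw [td_smul, map_sum] at e1
  simp only [tmul] at e1 e2 ⊢
  rw [map_sum] at e2
  simp only [map_zsmul] at e1 e2
  simp only [smul_comm (zsign _) fr.f, ← Finset.smul_sum]
  rw [← e2, ← e1, map_smul, smul_add fr.f (tw _ _ _), mul_smul]
  abel

end Supertrace

/-! ### Graded linear operators as forms with values in homomorphisms. -/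

section Hat

set_option linter.unusedSectionVars false

variable {R L : Type*} [CommRing R] [AddCommGroup L] [Module R L]
  {S : Finset ℤ} {V : S → Type*} [∀ z, AddCommGroup (V z)] [∀ z, Module R (V z)]
  {H : S → S → Type*} [∀ l j, AddCommGroup (H l j)] [∀ l j, Module R (H l j)]

variable (R L H) in
/-- Forms with values in the homomorphisms of a graded module. -/
abbrev KForm := ∀ (p : ℕ) (l j : S), L [⋀^Fin p]→ₗ[R] H l j

/-- The components of a form with values in the homomorphisms. -/
def kproj (K : KForm R L H) (l j : S) : Tot R L (H l j) := fun p => K p l j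

/-- Multiplication by `(-1)^(c q)` in degree `q`. -/
def twist {N : Type*} [AddCommGroup N] [Module R N] (c : ℤ) : Tot R L N →ₗ[R] Tot R L N where
  toFun α q := zsign (q * c) • α q
  map_add' _ _ := by funext k; simp
  map_smul' r α := by funext k; exact smul_comm (zsign (k * c)) r (α k)

theorem twist_apply {N : Type*} [AddCommGroup N] [Module R N] (c : ℤ) (α : Tot R L N) (q : ℕ) :
    twist c α q = zsign (q * c) • α q := rfl

theorem Conc.twist {N : Type*} [AddCommGroup N] [Module R N] {q : ℤ} {α : Tot R L N}
    (h : Conc q α) (c : ℤ) : Algd.twist c α = zsign (q * c) • α := by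
  funext k
  rw [twist_apply, Pi.smul_apply]
  by_cases hk : (k : ℤ) = q
  · rw [hk]
  · rw [h k hk, smul_zero, smul_zero]

variable (ev : ∀ l j, H l j →ₗ[R] V l →ₗ[R] V j) (tr : ∀ z, H z z →ₗ[R] R)

/-- The operator given by a form with values in the homomorphisms, with the Koszul sign. -/
def hatOp (K : KForm R L H) : GForm R L V →ₗ[R] GForm R L V where
  toFun η s j := ∑ l, tw (ev l j) (kproj K l j) (twist ((j : ℤ) - l) (gproj l η)) s
  map_add' _ _ := by funext s j; simp [Finset.sum_add_distrib]
  map_smul' _ _ := by funext s j; simp [Finset.smul_sum]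

theorem gproj_hatOp (K : KForm R L H) (η : GForm R L V) (j : S) :
    gproj j (hatOp ev K η) = ∑ l, tw (ev l j) (kproj K l j) (twist ((j : ℤ) - l) (gproj l η)) := by
  funext s
  rw [Finset.sum_apply]
  rfl

theorem tw_eq_sum_fin {N₁ N₂ N₃ : Type*} [AddCommGroup N₁] [Module R N₁] [AddCommGroup N₂]
    [Module R N₂] [AddCommGroup N₃] [Module R N₃] (B : N₁ →ₗ[R] N₂ →ₗ[R] N₃)
    (α : Tot R L N₁) (β : Tot R L N₂) (s : ℕ) :
    tw B α β s = ∑ p : Fin (s + 1),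
      wedge B (Nat.add_sub_cancel' (Nat.lt_succ_iff.mp p.isLt)) (α p) (β (s - p)) := by
  rw [tw_apply, Finset.Nat.sum_antidiagonal_eq_sum_range_succ
    (fun i j => wedgeTerm B s i j (α i) (β j)), ← Fin.sum_univ_eq_sum_range]
  exact Finset.sum_congr rfl fun p _ => wedgeTerm_of_eq B _ _ _

theorem hatOp_apply (K : KForm R L H) (η : GForm R L V) (s : ℕ) (j : S) :
    hatOp ev K η s j = ∑ l : S, ∑ p : Fin (s + 1),
      ((((s - p : ℕ) : ℤ) * ((j : ℤ) - l)).negOnePow : ℤ) •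
      wedge (ev l j) (Nat.add_sub_cancel' (Nat.lt_succ_iff.mp p.isLt)) (K p l j) (η (s - p) l) := by
  change ∑ l, tw (ev l j) (kproj K l j) (twist ((j : ℤ) - l) (gproj l η)) s = _
  refine Finset.sum_congr rfl fun l _ => ?_
  rw [tw_eq_sum_fin]
  refine Finset.sum_congr rfl fun p _ => ?_
  exact map_zsmul (wedgeLin (ev l j) (Nat.add_sub_cancel' (Nat.lt_succ_iff.mp p.isLt)) (K p l j))
    _ _

/-- The form `K` is homogeneous of total degree `m`. -/
def KHom (m : ℤ) (K : KForm R L H) : Prop :=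
  ∀ (p : ℕ) (l j : S), (p : ℤ) + ((j : ℤ) - l) ≠ m → K p l j = 0

/-- The graded trace. -/
def gtrTot (K : KForm R L H) : Tot R L R := fun p =>
  ∑ z : S, zsign (z : ℤ) • (tr z).compAlternatingMap (K p z z)

theorem twist_ofConst {N : Type*} [AddCommGroup N] [Module R N] (c : ℤ) (a : N) :
    twist c (ofConst a : Tot R L N) = ofConst a := by
  funext k
  cases k with
  | zero => simp [twist_apply]
  | succ k => simp [twist_apply, ofConst_succ]

variable [Algebra ℝ R]

theorem gproj_hatOp_emb (K : KForm R L H) (l j : S) (e : V l) :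
    gproj j (hatOp ev K (emb l e)) = postc ((ev l j).flip e) (kproj K l j) := by
  rw [gproj_hatOp, Finset.sum_eq_single l]
  · rw [gproj_emb, Pi.single_eq_same, twist_ofConst, tw_ofConst_right]
  · intro l' _ hl
    rw [gproj_emb, Pi.single_eq_of_ne hl, map_zero, map_zero, map_zero]
  · simp

/-- On sections of the summands, as forms of degree `0`, there is neither sign nor shuffle: the
operator evaluates the components of `K`. -/
theorem hatOp_injective (hev : ∀ l j, Function.Injective (ev l j)) :
    Function.Injective (hatOp ev : KForm R L H → (GForm R L V →ₗ[R] GForm R L V)) := by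
  intro K K' h
  funext p l j
  ext v
  apply hev l j
  ext e
  have := congrArg (fun T => (gproj j (T (emb l e : GForm R L V)) : Tot R L (V j)) p v) h
  simp only [gproj_hatOp_emb] at this
  exact this

/-- Graded linearity on products `θ ∧ e` with `e` of form degree `0`. For these, graded
commutativity and naturality in the coefficients suffice, and associativity of the wedge product is
not needed. -/
theorem hatOp_act_emb {m : ℤ} {K : KForm R L H} (hK : KHom m K) {q : ℤ} {θ : Tot R L R}
    (hθ : Conc q θ) (l : S) (e : V l) :
    hatOp ev K (act θ (emb l e)) = zsign (m * q) • act θ (hatOp ev K (emb l e)) := by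
  refine gform_ext fun j => ?_
  have hKc : Conc (m - (j - l)) (kproj K l j) := fun k hk => hK k l j (by omega)
  rw [map_zsmul, gproj_act, gproj_hatOp_emb, gproj_hatOp, Finset.sum_eq_single l]
  · rw [gproj_act, gproj_emb, Pi.single_eq_same, tw_ofConst_right]
    have hc : Conc q (postc ((LinearMap.lsmul R (V l)).flip e) θ) := fun k hk => by
      rw [postc_apply, hθ k hk]; ext; simp
    rw [hc.twist, map_zsmul]
    -- Both sides are products of `K` and `θ`, in opposite orders, for the single pairing `(φ, r) ↦
    -- φ(r e)`.
    have e1 := postc_tw ((ev l j).compl₂ ((LinearMap.lsmul R (V l)).flip e)) (ev l j)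
      LinearMap.id ((LinearMap.lsmul R (V l)).flip e) LinearMap.id (by simp) (kproj K l j) θ
    have e2 := postc_tw ((ev l j).compl₂ ((LinearMap.lsmul R (V l)).flip e)).flip
      (LinearMap.lsmul R (V j)) LinearMap.id ((ev l j).flip e) LinearMap.id (by simp) θ
      (kproj K l j)
    have h1 : tw (ev l j) (kproj K l j) (postc ((LinearMap.lsmul R (V l)).flip e) θ) =
        tw ((ev l j).compl₂ ((LinearMap.lsmul R (V l)).flip e)) (kproj K l j) θ := e1.symm
    have h2 : tw (LinearMap.lsmul R (V j)) θ (postc ((ev l j).flip e) (kproj K l j)) =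
        tw ((ev l j).compl₂ ((LinearMap.lsmul R (V l)).flip e)).flip θ (kproj K l j) := e2.symm
    rw [h1, h2, tw_comm _ hKc hθ, smul_smul, ← zsign_add]
    congr 2
    ring
  · intro l' _ hl
    rw [gproj_act, gproj_emb, Pi.single_eq_of_ne hl, map_zero, map_zero, map_zero, map_zero]
  · simp

variable {ev tr} [∀ z, Module ℝ (V z)] [∀ z, SMulCommClass R ℝ (V z)]
  [∀ z, IsScalarTower ℝ R (V z)] {T : Module.End ℝ (GForm R L V)}

/-- Up to the factor `f`, every form is a sum of products `θ ∧ e` with `e` in a frame, and on these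
both operators are determined by their value at `e`. -/
theorem hatOp_eq_of_emb (hsepV : ∀ z, Separating ev tr (V z))
    (hbound : ∃ N, ∀ q ≥ N, ∀ t : L [⋀^Fin q]→ₗ[R] R, t = 0)
    {m : ℕ} (hT : T ∈ gradedLinear m) {K : KForm R L H} (hK : KHom m K)
    (h : ∀ l (e : V l), hatOp ev K (emb l e) = T (emb l e)) (η : GForm R L V) :
    hatOp ev K η = T η := by
  obtain ⟨N, hN⟩ := hbound
  refine gform_ext fun z => (hsepV z).tot.eq_of_smul fun fr => ?_
  have e1 : fr.f • gproj z (hatOp ev K η) = gproj z (hatOp ev K (fr.f • η)) := by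
    rw [map_smul, map_smul]
  have e2 : fr.f • gproj z (T η) = gproj z (T (fr.f • η)) := by
    rw [gradedLinear_smul hT, map_smul]
  rw [e1, e2, ← fr.sum_act η, map_sum (hatOp ev K), map_sum T]
  refine congrArg (gproj (R := R) (L := L) (V := V) z) ?_
  refine Finset.sum_congr rfl fun i _ => ?_
  -- Graded linearity is stated for homogeneous `θ`, and `T` is only additive, so the coefficient
  -- must be a finite sum of homogeneous ones. The degree bound guarantees this.
  have hdec : fr.co i η = ∑ q ∈ Finset.range N, Pi.single q (fr.co i η q) := by
    funext k
    rw [Finset.sum_apply]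
    by_cases hk : k < N
    · rw [Finset.sum_eq_single k]
      · simp
      · intro q _ hq
        rw [Pi.single_eq_of_ne hq.symm]
      · intro hk'
        simp [hk] at hk'
    · rw [hN k (by omega) (fr.co i η k)]
      refine (Finset.sum_eq_zero fun q hq => ?_).symm
      rw [Pi.single_eq_of_ne]
      simp only [Finset.mem_range] at hq
      omega
  rw [hdec]
  simp only [map_sum, LinearMap.sum_apply]
  refine Finset.sum_congr rfl fun q _ => ?_
  rw [GFrame.E, hatOp_act_emb ev hK (conc_single q _), h, hT.2]

/-- Exchange of the arguments of a linear map with values in alternating maps. -/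
def altFlip {N N' : Type*} [AddCommGroup N] [Module R N] [AddCommGroup N'] [Module R N'] {p : ℕ}
    (Φ : N →ₗ[R] L [⋀^Fin p]→ₗ[R] N') : L [⋀^Fin p]→ₗ[R] (N →ₗ[R] N') where
  toFun v := { toFun := fun e => Φ e v, map_add' := by simp, map_smul' := by simp }
  map_update_add' v i x y := by ext; simp
  map_update_smul' v i r x := by ext; simp
  map_eq_zero_of_eq' v i j h hij := by ext e; exact (Φ e).map_eq_zero_of_eq v h hij

/-- Every graded linear operator is given by a homogeneous form with values in the homomorphisms. -/
theorem exists_hatOp_eq (hev : ∀ l j, Function.Bijective (ev l j))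
    (hsepV : ∀ z, Separating ev tr (V z))
    (hbound : ∃ N, ∀ q ≥ N, ∀ t : L [⋀^Fin q]→ₗ[R] R, t = 0)
    {m : ℕ} (hT : T ∈ gradedLinear m) :
    ∃ K : KForm R L H, KHom m K ∧ ∀ η, hatOp ev K η = T η := by
  -- The component of `K` must send `e` to the `(p, j)` component of `T e`. This is linear over `R`,
  -- so inverting the evaluation gives `K`.
  let Φ : ∀ (p : ℕ) (l j : S), V l →ₗ[R] L [⋀^Fin p]→ₗ[R] V j := fun p l j =>
    { toFun := fun e => T (emb l e) p j
      map_add' := fun e e' => by rw [map_add, map_add]; rfl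
      map_smul' := fun r e => by rw [map_smul, gradedLinear_smul hT]; rfl }
  let K : KForm R L H := fun p l j =>
    ((LinearEquiv.ofBijective (ev l j) (hev l j)).symm : (V l →ₗ[R] V j) →ₗ[R] H l j)
      |>.compAlternatingMap (altFlip (Φ p l j))
  have hKev : ∀ p l j v, ev l j (K p l j v) = altFlip (Φ p l j) v := fun p l j v =>
    (LinearEquiv.ofBijective (ev l j) (hev l j)).apply_symm_apply _
  have hK : KHom m K := by
    intro p l j hp
    ext v
    apply (hev l j).1
    ext e
    rw [hKev]
    change T (emb l e) p j v = _
    rw [hT.1 _ _ (ghom_emb l e) p j (by omega)]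
    simp
  refine ⟨K, hK, hatOp_eq_of_emb hsepV hbound hT hK fun l e => gform_ext fun j => ?_⟩
  rw [gproj_hatOp_emb]
  ext p v
  change ev l j (K p l j v) e = _
  rw [hKev]
  rfl

/-- Links the trace of forms with the trace of operators: on frame elements the operator is
evaluation of `K`, so the frame formula for `tr` applies to each diagonal component. -/
theorem isTr_gtrTot {K : KForm R L H} (hKT : ∀ η, hatOp ev K η = T η) :
    IsTr ev tr T (gtrTot tr K) := by
  intro fr
  rw [Fintype.sum_sigma]
  funext p
  ext v
  simp only [Finset.sum_apply, alt_sum_apply, Pi.smul_apply, AlternatingMap.smul_apply, gtrTot,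
    Finset.smul_sum, ← hKT, GFrame.co_apply, GFrame.E, gproj_hatOp_emb]
  refine Finset.sum_congr rfl fun z _ => ?_
  rw [← Finset.smul_sum, smul_comm]
  congr 1
  exact fr.trace z _

theorem exists_isTr (hev : ∀ l j, Function.Bijective (ev l j))
    (hsepV : ∀ z, Separating ev tr (V z))
    (hbound : ∃ N, ∀ q ≥ N, ∀ t : L [⋀^Fin q]→ₗ[R] R, t = 0)
    {m : ℕ} (hT : T ∈ gradedLinear m) : ∃ τ, IsTr ev tr T τ := by
  obtain ⟨K, -, hKT⟩ := exists_hatOp_eq hev hsepV hbound hT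
  exact ⟨_, isTr_gtrTot hKT⟩

end Hat

/-! ### Transgression along an affine path, with polynomials in `t` over the operators. -/

section Transgression

set_option linter.unusedSectionVars false

open Polynomial

section PolyCoeff

variable {𝕜 𝓔 : Type*} [Field 𝕜] [Ring 𝓔] [Algebra 𝕜 𝓔]

theorem coeff_mul_mem {W₁ W₂ W : Submodule 𝕜 𝓔} (h : ∀ a ∈ W₁, ∀ b ∈ W₂, a * b ∈ W) {P Q : 𝓔[X]}
    (hP : ∀ k, P.coeff k ∈ W₁) (hQ : ∀ k, Q.coeff k ∈ W₂) (k : ℕ) : (P * Q).coeff k ∈ W := by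
  rw [coeff_mul]
  exact Submodule.sum_mem _ fun x _ => h _ (hP _) _ (hQ _)

theorem coeff_C_mem {W : Submodule 𝕜 𝓔} {a : 𝓔} (ha : a ∈ W) (k : ℕ) : (C a).coeff k ∈ W := by
  rw [coeff_C]
  split_ifs
  · exact ha
  · exact zero_mem _

theorem coeff_X_mul_mem {W : Submodule 𝕜 𝓔} {P : 𝓔[X]} (hP : ∀ k, P.coeff k ∈ W) (k : ℕ) :
    (X * P).coeff k ∈ W := by
  cases k with
  | zero => simp
  | succ k => rw [coeff_X_mul]; exact hP k

end PolyCoeff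

section Path

variable {𝓔 : Type*} [Ring 𝓔] (D w : 𝓔)

/-- The affine path `D + t w`. -/
def path : 𝓔[X] := C D + X * C w

/-- The transgression operators: the derivative of `(D + t w)^(2i)` is the anticommutator of
`D + t w` with the `i`-th one. -/
def transgr : ℕ → 𝓔[X]
  | 0 => 0
  | i + 1 => transgr i * (path D w * path D w) + (path D w * path D w) ^ i * C w

theorem derivative_path : derivative (path D w) = C w := by
  simp [path]

/-- The derivative of `D_t²` is `D_t w + w D_t`, and `D_t` commutes with `D_t²`. Thus each term of
the product rule is an anticommutator with `D_t`. -/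
theorem derivative_path_pow (i : ℕ) : derivative ((path D w * path D w) ^ i) =
    path D w * transgr D w i + transgr D w i * path D w := by
  induction i with
  | zero => simp [transgr]
  | succ i ih =>
    have hc : path D w * (path D w * path D w) ^ i = (path D w * path D w) ^ i * path D w := by
      have : Commute (path D w) ((path D w * path D w) ^ i) :=
        ((Commute.refl _).mul_right (Commute.refl _)).pow_right i
      exact this.eq
    rw [pow_succ, derivative_mul, ih, derivative_mul, derivative_path, transgr]
    simp only [mul_add, add_mul, mul_assoc]
    rw [← mul_assoc (path D w) ((path D w * path D w) ^ i), hc]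
    simp only [mul_assoc]
    abel

theorem eval_one_path_pow (i : ℕ) :
    ((path D w * path D w) ^ i).eval 1 = (D + w) ^ (2 * i) := by
  let φ : 𝓔[X] →+* 𝓔 := eval₂RingHom' (RingHom.id 𝓔) 1 fun a => Commute.one_right a
  change φ ((path D w * path D w) ^ i) = _
  have hφ : φ (path D w) = D + w := by
    rw [path, map_add, map_mul]
    simp [φ, eval₂RingHom']
  rw [map_pow, map_mul, hφ, ← pow_two, ← pow_mul]

theorem coeff_zero_path_pow (i : ℕ) : ((path D w * path D w) ^ i).coeff 0 = D ^ (2 * i) := by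
  change constantCoeff ((path D w * path D w) ^ i) = _
  rw [map_pow, map_mul, ← pow_two, ← pow_mul]
  congr 1
  simp [path]

section Filtered

variable [Algebra ℝ 𝓔] (G : ℕ → Submodule ℝ 𝓔)

theorem path_sq : path D w * path D w =
    C (D * D) + (X * C (D * w + w * D) + X * (X * C (w * w))) := by
  have h1 : C D * (X * C w) = X * (C D * C w) := by
    rw [← mul_assoc, ← X_mul_C, mul_assoc]
  have h2 : X * C w * (X * C w) = X * (X * (C w * C w)) := by
    rw [mul_assoc, ← mul_assoc (C w) X, ← X_mul_C, mul_assoc]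
  simp only [path, mul_add, add_mul, C_mul, C_add]
  rw [h1, h2, mul_assoc]
  abel

/-- `D` itself is not graded linear and lies in no `G m`. The coefficients of `D_t²` involve only
`D²`, the anticommutator of `D` with `w`, and `w²`. -/
theorem coeff_path_sq_mem (hmul : ∀ m n, ∀ a ∈ G m, ∀ b ∈ G n, a * b ∈ G (m + n))
    (hDD : D * D ∈ G 2) (hDw : D * w + w * D ∈ G 2) (hw : w ∈ G 1) (k : ℕ) :
    (path D w * path D w).coeff k ∈ G 2 := by
  rw [path_sq, coeff_add, coeff_add]
  exact add_mem (coeff_C_mem hDD k) (add_mem (coeff_X_mul_mem (coeff_C_mem hDw) k)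
    (coeff_X_mul_mem (coeff_X_mul_mem (coeff_C_mem (hmul 1 1 _ hw _ hw))) k))

theorem coeff_path_pow_mem (h1 : 1 ∈ G 0)
    (hmul : ∀ m n, ∀ a ∈ G m, ∀ b ∈ G n, a * b ∈ G (m + n))
    (hDD : D * D ∈ G 2) (hDw : D * w + w * D ∈ G 2) (hw : w ∈ G 1) (i k : ℕ) :
    ((path D w * path D w) ^ i).coeff k ∈ G (2 * i) := by
  induction i generalizing k with
  | zero =>
    rw [pow_zero, ← C_1]
    exact coeff_C_mem h1 k
  | succ i ih =>
    rw [pow_succ]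
    exact coeff_mul_mem (hmul _ _) ih (coeff_path_sq_mem D w G hmul hDD hDw hw) k

theorem coeff_transgr_mem (h1 : 1 ∈ G 0)
    (hmul : ∀ m n, ∀ a ∈ G m, ∀ b ∈ G n, a * b ∈ G (m + n))
    (hDD : D * D ∈ G 2) (hDw : D * w + w * D ∈ G 2) (hw : w ∈ G 1) (i k : ℕ) :
    (transgr D w (i + 1)).coeff k ∈ G (2 * i + 1) := by
  have h2 : ∀ i k, ((path D w * path D w) ^ i * C w).coeff k ∈ G (2 * i + 1) := fun i =>
    coeff_mul_mem (hmul _ _) (coeff_path_pow_mem D w G h1 hmul hDD hDw hw i) (coeff_C_mem hw)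
  induction i generalizing k with
  | zero =>
    rw [transgr, transgr, zero_mul, zero_add]
    exact h2 0 k
  | succ i ih =>
    rw [transgr, coeff_add]
    exact add_mem (coeff_mul_mem (hmul _ _) ih (coeff_path_sq_mem D w G hmul hDD hDw hw) k)
      (h2 (i + 1) k)

/-- If `I` contains the anticommutators of the elements of `G (2 * i + 1)` with `D` and `w`, then it
contains the difference of the even powers of `D + w` and `D`. -/
theorem pow_sub_pow_mem (h1 : 1 ∈ G 0)
    (hmul : ∀ m n, ∀ a ∈ G m, ∀ b ∈ G n, a * b ∈ G (m + n))
    (hDD : D * D ∈ G 2) (hDw : D * w + w * D ∈ G 2) (hw : w ∈ G 1) (i : ℕ)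
    (I : AddSubmonoid 𝓔) (hI : ∀ (k : ℕ) (a : 𝓔), (k + 1) • a ∈ I → a ∈ I)
    (hD : ∀ T ∈ G (2 * i + 1), D * T + T * D ∈ I) (hw' : ∀ T ∈ G (2 * i + 1), w * T + T * w ∈ I) :
    (D + w) ^ (2 * (i + 1)) - D ^ (2 * (i + 1)) ∈ I := by
  -- Formal integration: `k + 1` times this coefficient is coefficient `k` of the derivative, a sum
  -- of anticommutators with `D` and with `w`.
  have hcoeff : ∀ k, ((path D w * path D w) ^ (i + 1)).coeff (k + 1) ∈ I := by
    intro k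
    have hY : (path D w * transgr D w (i + 1) + transgr D w (i + 1) * path D w).coeff k ∈ I := by
      have hT := coeff_transgr_mem D w G h1 hmul hDD hDw hw i
      generalize transgr D w (i + 1) = Q at hT ⊢
      have hX : Q * (X * C w) = X * (Q * C w) := by
        rw [← mul_assoc, ← X_mul, mul_assoc]
      rw [path, add_mul, mul_add, mul_assoc, hX, coeff_add, coeff_add, coeff_add, coeff_C_mul,
        coeff_mul_C, add_add_add_comm]
      refine add_mem (hD _ (hT k)) ?_
      cases k with
      | zero => simp
      | succ k =>
        rw [coeff_X_mul, coeff_X_mul, coeff_C_mul, coeff_mul_C]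
        exact hw' _ (hT k)
    rw [← derivative_path_pow, coeff_derivative] at hY
    refine hI k _ ?_
    rw [nsmul_eq_mul', Nat.cast_add, Nat.cast_one]
    exact hY
  -- The value at `t = 1` is the sum of all coefficients. Coefficient `0` is the power of `D`, and
  -- the others lie in `I`.
  have e := eval_one_path_pow D w (i + 1)
  rw [eval_eq_sum_range, Finset.sum_range_succ'] at e
  simp only [one_pow, mul_one] at e
  rw [coeff_zero_path_pow, ← eq_sub_iff_add_eq] at e
  rw [← e]
  exact sum_mem fun k _ => hcoeff k

end Filtered

end Path

variable {R L : Type*} [CommRing R] [AddCommGroup L] [Module R L]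
  {S : Finset ℤ} {V : S → Type*} [∀ z, AddCommGroup (V z)] [∀ z, Module R (V z)]
  {H : S → S → Type*} [∀ l j, AddCommGroup (H l j)] [∀ l j, Module R (H l j)]
  {ev : ∀ l j, H l j →ₗ[R] V l →ₗ[R] V j} {tr : ∀ z, H z z →ₗ[R] R}
  [Algebra ℝ R] [∀ z, Module ℝ (V z)] [∀ z, SMulCommClass R ℝ (V z)]
  [∀ z, IsScalarTower ℝ R (V z)] [Module ℝ L] [IsScalarTower ℝ R L] {𝓐 : AnchoredBracket R L}
  {D D' T : Module.End ℝ (GForm R L V)}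

theorem IsConn.pow_mem [IsReduced R] (hD : IsConn 𝓐 D) (i : ℕ) :
    D ^ (2 * i) ∈ gradedLinear (2 * i) := by
  rw [pow_mul, pow_two]
  exact gradedLinear_pow hD.sq_mem i

/-- The graded trace of an even power of a connection up to homotopy is closed. -/
theorem IsConn.td_trace_pow [IsReduced R] (hsep : Separating ev tr R) (hD : IsConn 𝓐 D) (i : ℕ)
    {τ : Tot R L R} (hτ : IsTr ev tr (D ^ (2 * i)) τ) : 𝓐.td τ = 0 := by
  refine (hD.trace_commutator hsep (hD.pow_mem i) hτ ?_).symm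
  have : D * D ^ (2 * i) - zsign ((2 * i : ℕ) : ℤ) • (D ^ (2 * i) * D) = 0 := by
    rw [zsign_congr (b := 0) (by simp), zsign_zero, one_smul, ← pow_succ', ← pow_succ, sub_self]
  rw [this]
  exact isTr_zero

/-- The graded traces of the even powers of two connections up to homotopy differ by an exact
form. -/
theorem IsConn.exists_trace_pow_sub [IsReduced R] (hsep : Separating ev tr R)
    (htr : ∀ (m : ℕ) (T : Module.End ℝ (GForm R L V)), T ∈ gradedLinear m → ∃ τ, IsTr ev tr T τ)
    (hD : IsConn 𝓐 D) (hD' : IsConn 𝓐 D') (i : ℕ) :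
    ∃ y, IsTr ev tr (D' ^ (2 * (i + 1)) - D ^ (2 * (i + 1))) (𝓐.td y) := by
  -- The operators that have an exact graded trace.
  let I : AddSubmonoid (Module.End ℝ (GForm R L V)) :=
    { carrier := {T | ∃ y, IsTr ev tr T (𝓐.td y)}
      zero_mem' := ⟨0, by rw [map_zero]; exact isTr_zero⟩
      add_mem' := fun {a b} ⟨y, hy⟩ ⟨y', hy'⟩ => ⟨y + y', by rw [map_add]; exact hy.add hy'⟩ }
  have hI : ∀ (k : ℕ) (T : Module.End ℝ (GForm R L V)), (k + 1) • T ∈ I → T ∈ I := by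
    rintro k T ⟨y, hy⟩
    refine ⟨((k + 1 : ℕ) : ℝ)⁻¹ • y, IsTr.of_nsmul (n := k + 1) (by omega) ?_⟩
    have e1 : (k + 1) • 𝓐.td (((k + 1 : ℕ) : ℝ)⁻¹ • y) = 𝓐.td y := by
      rw [map_smul, ← Nat.cast_smul_eq_nsmul ℝ, smul_smul, mul_inv_cancel₀ (by positivity), one_smul]
    rw [e1]
    exact hy
  -- The order of the quantifiers matters: the primitive `y` is a trace of `T` and serves all
  -- connections at once. In odd degree the graded commutator is the anticommutator.
  have hodd : ∀ T ∈ gradedLinear (R := R) (L := L) (V := V) (2 * i + 1),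
      ∃ y, ∀ D₁, IsConn 𝓐 D₁ → IsTr ev tr (D₁ * T + T * D₁) (𝓐.td y) := by
    intro T hT
    obtain ⟨y, hy⟩ := htr _ _ hT
    refine ⟨y, fun D₁ hD₁ => ?_⟩
    have hs : D₁ * T - zsign ((2 * i + 1 : ℕ) : ℤ) • (T * D₁) = D₁ * T + T * D₁ := by
      rw [zsign_natCast, pow_succ, pow_mul]
      simp
    obtain ⟨τ, hτ⟩ := htr _ _ (hD₁.commutator_mem hT)
    rw [hD₁.trace_commutator hsep hT hy hτ, hs] at hτ
    exact hτ
  have hcomm : D * (D' - D) + (D' - D) * D ∈ gradedLinear (R := R) (L := L) (V := V) 2 := by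
    have := hD.commutator_mem (hD.sub_mem hD')
    rw [zsign_natCast, pow_one, neg_smul, one_smul, sub_neg_eq_add] at this
    exact this
  have := pow_sub_pow_mem D (D' - D) gradedLinear gradedLinear_one
    (fun _ _ a ha b hb => gradedLinear_mul ha hb) hD.sq_mem hcomm (hD.sub_mem hD') i I hI
    (fun T hT => by
      obtain ⟨y, hy⟩ := hodd T hT
      exact ⟨y, hy D hD⟩)
    (fun T hT => by
      obtain ⟨y, hy⟩ := hodd T hT
      -- The anticommutators of `T` with `D'` and with `D` have the same trace `dy`, so the
      -- anticommutator with `w = D' - D` has trace `0`.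
      refine ⟨0, ?_⟩
      have h := (hy D' hD').sub (hy D hD)
      rw [sub_self] at h
      rw [map_zero]
      have e : (D' - D) * T + T * (D' - D) = D' * T + T * D' - (D * T + T * D) := by
        rw [sub_mul, mul_sub]
        abel
      rw [e]
      exact h)
  rw [add_sub_cancel] at this
  exact this

end Transgression

/-! ### A connection from a retraction of a product of copies of the ring. -/

section Existence

set_option linter.unusedSectionVars false

variable {R L : Type*} [CommRing R] [AddCommGroup L] [Module R L]
  {S : Finset ℤ} {V : S → Type*} [∀ z, AddCommGroup (V z)] [∀ z, Module R (V z)]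
  [Algebra ℝ R] [∀ z, Module ℝ (V z)] [∀ z, SMulCommClass R ℝ (V z)]
  [∀ z, IsScalarTower ℝ R (V z)] [Module ℝ L] [IsScalarTower ℝ R L] (𝓐 : AnchoredBracket R L)

/-- The componentwise differential of forms with values in a product of copies of `R`. -/
def piTd {ι : Type*} : Tot R L (ι → R) →+ Tot R L (ι → R) where
  toFun α k := AlternatingMap.pi fun i => 𝓐.td (postc (LinearMap.proj i) α) k
  map_zero' := by ext; simp
  map_add' _ _ := by ext; simp

theorem postc_proj_piTd {ι : Type*} (i : ι) (α : Tot R L (ι → R)) :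
    postc (LinearMap.proj i) (piTd 𝓐 α) = 𝓐.td (postc (LinearMap.proj i) α) := rfl

theorem piTd_tw {ι : Type*} (θ : Tot R L R) (α : Tot R L (ι → R)) :
    piTd 𝓐 (tw (LinearMap.lsmul R (ι → R)) θ α) =
      tw (LinearMap.lsmul R (ι → R)) (𝓐.td θ) α +
        tw (LinearMap.lsmul R (ι → R)) (sgn θ) (piTd 𝓐 α) := by
  have hproj : ∀ (i : ι) (θ : Tot R L R) (α : Tot R L (ι → R)),
      postc (LinearMap.proj i) (tw (LinearMap.lsmul R (ι → R)) θ α) =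
        AnchoredBracket.tmul θ (postc (LinearMap.proj i) α) := fun i θ α =>
    postc_tw (LinearMap.lsmul R (ι → R)) (LinearMap.mul R R) LinearMap.id (LinearMap.proj i) (LinearMap.proj i)
      (by simp) θ α
  have hext : ∀ α β : Tot R L (ι → R),
      (∀ i, postc (LinearMap.proj i : (ι → R) →ₗ[R] R) α = postc (LinearMap.proj i) β) → α = β := by
    intro α β h
    ext k v i
    exact congrArg (fun γ : Tot R L R => γ k v) (h i)
  refine hext _ _ fun i => ?_
  rw [postc_proj_piTd, hproj, map_add, hproj, hproj, postc_proj_piTd, 𝓐.td_tmul]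

/-- A graded module whose summands are retracts of products of copies of `R` has a connection up to
homotopy. -/
theorem exists_isConn {ι : S → Type*} (ε : ∀ z, V z →ₗ[R] (ι z → R)) (Φ : ∀ z, (ι z → R) →ₗ[R] V z)
    (h : ∀ z v, Φ z (ε z v) = v) : ∃ D : Module.End ℝ (GForm R L V), IsConn 𝓐 D := by
  -- The compressed operator `Φ ∘ d ∘ ε`. It keeps the summand `z` and raises the form degree by
  -- one. In its Leibniz rule the identity `Φ ∘ ε = 1` is what produces `dθ ∧ η`.
  let D₀ : GForm R L V →+ GForm R L V :=
    { toFun := fun η p z => postc (Φ z) (piTd 𝓐 (postc (ε z) (gproj z η))) p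
      map_zero' := by funext p z; simp
      map_add' := fun η η' => by funext p z; simp }
  have hpr : ∀ η z, gproj z (D₀ η) = postc (Φ z) (piTd 𝓐 (postc (ε z) (gproj z η))) :=
    fun _ _ => rfl
  have hret : ∀ z (α : Tot R L (V z)), postc (Φ z) (postc (ε z) α) = α := by
    intro z α
    ext k v
    exact h z _
  have hleib : ∀ (θ : Tot R L R) η, D₀ (act θ η) = act (𝓐.td θ) η + act (sgn θ) (D₀ η) := by
    intro θ η
    refine gform_ext fun z => ?_
    have hε : ∀ θ (α : Tot R L (V z)), postc (ε z) (tw (LinearMap.lsmul R (V z)) θ α) =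
        tw (LinearMap.lsmul R (ι z → R)) θ (postc (ε z) α) := fun θ α =>
      postc_tw _ _ LinearMap.id (ε z) (ε z) (by simp) θ α
    have hΦ : ∀ θ (α : Tot R L (ι z → R)), postc (Φ z) (tw (LinearMap.lsmul R (ι z → R)) θ α) =
        tw (LinearMap.lsmul R (V z)) θ (postc (Φ z) α) := fun θ α =>
      postc_tw _ _ LinearMap.id (Φ z) (Φ z) (by simp) θ α
    rw [map_add, hpr, gproj_act, gproj_act, gproj_act, hpr, hε, piTd_tw, map_add, hΦ, hΦ, hret]
  -- Real linearity follows from the Leibniz rule once `d c = 0`, which reduces to `d 1 = d(1 · 1) =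
  -- d 1 + d 1`.
  have hreal : ∀ (c : ℝ) η, D₀ (c • η) = c • D₀ η := by
    intro c η
    have h1 := hleib (ofConst (algebraMap ℝ R c)) η
    have h2 : 𝓐.td (ofConst (algebraMap ℝ R c) : Tot R L R) = 0 := by
      have : (ofConst (algebraMap ℝ R c) : Tot R L R) = c • ofConst 1 := by
        funext k
        cases k with
        | zero => ext v; simp [ofConst_zero_apply, Algebra.algebraMap_eq_smul_one]
        | succ k => simp [ofConst_succ]
      rw [this, map_smul]
      have h3 : 𝓐.td (ofConst 1 : Tot R L R) = 0 := by
        have := 𝓐.td_tmul (ofConst 1) (ofConst 1)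
        rw [sgn_ofConst, AnchoredBracket.ofConst_tmul, AnchoredBracket.ofConst_tmul,
          AnchoredBracket.tmul_ofConst, one_smul, one_smul] at this
        exact left_eq_add.1 this
      rw [h3, smul_zero]
    rw [h2, sgn_ofConst, act_ofConst, act_ofConst, algebraMap_smul_gform, algebraMap_smul_gform] at h1
    simpa using h1
  refine ⟨{ D₀ with map_smul' := hreal }, fun c η hη p z hp => ?_, fun l θ η => ?_⟩
  · change postc (Φ z) (piTd 𝓐 (postc (ε z) (gproj z η))) p = 0
    have hc : Conc (c - z) (gproj z η) := fun k hk => hη k z (by omega)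
    ext v
    change Φ z (fun i => 𝓐.td (postc (LinearMap.proj i) (postc (ε z) (gproj z η))) p v) = 0
    have : ∀ i, 𝓐.td (postc (LinearMap.proj i) (postc (ε z) (gproj z η))) p = 0 := fun i =>
      𝓐.conc_td (c := c - z) (fun k hk => by
        rw [postc_apply, postc_apply, hc k hk]; ext; simp) p (by omega)
    simp only [this, AlternatingMap.zero_apply]
    exact map_zero _
  · change D₀ _ = _
    rw [hleib, (conc_single l θ).sgn, map_zsmul]
    rfl

end Existence

/-! ### Smooth functions and cut-off frames of a vector bundle. -/

section BundleFrames

set_option linter.unusedSectionVars false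

variable {n : ℕ} {M : Type*} [TopologicalSpace M] [ChartedSpace (EuclideanSpace ℝ (Fin n)) M]

/-- Used for `d² = 0`, through the compatibility of anchor and bracket. -/
instance : IsReduced (SmoothFun n M) :=
  ⟨fun f ⟨k, hk⟩ => by
    ext x
    have h : ∀ k : ℕ, (f ^ k) x = f x ^ k := fun k => by
      induction k with
      | zero => simp
      | succ k ih => rw [pow_succ, pow_succ, SmoothFun.mul_apply, ih]
    have := h k
    rw [hk, SmoothFun.zero_apply] at this
    exact eq_zero_of_pow_eq_zero this.symm⟩

theorem SmoothFun.sum_apply {ι : Type*} (s : Finset ι) (f : ι → SmoothFun n M) (x : M) :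
    (∑ i ∈ s, f i) x = ∑ i ∈ s, f i x := by
  classical
  induction s using Finset.induction_on with
  | empty => simp
  | insert i s hi ih => rw [Finset.sum_insert hi, Finset.sum_insert hi, SmoothFun.add_apply, ih]

theorem SmoothFun.prod_apply {ι : Type*} (s : Finset ι) (f : ι → SmoothFun n M) (x : M) :
    (∏ i ∈ s, f i) x = ∏ i ∈ s, f i x := by
  classical
  induction s using Finset.induction_on with
  | empty => simp
  | insert i s hi ih => rw [Finset.prod_insert hi, Finset.prod_insert hi, SmoothFun.mul_apply, ih]

variable {F : Type*} [NormedAddCommGroup F] [NormedSpace ℝ F] {E : M → Type*}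
  [∀ x, AddCommGroup (E x)] [∀ x, Module ℝ (E x)] [∀ x, TopologicalSpace (E x)]
  [TopologicalSpace (TotalSpace F E)] [FiberBundle F E] [VectorBundle ℝ F E]

theorem section_sum_apply {ι : Type*} (t : Finset ι) (s : ι → Cₛ^∞⟮𝓡 n; F, E⟯) (x : M) :
    (∑ i ∈ t, s i) x = ∑ i ∈ t, s i x := by
  classical
  induction t using Finset.induction_on with
  | empty => simp
  | insert i t hi ih => rw [Finset.sum_insert hi, Finset.sum_insert hi,
      ContMDiffSection.coe_add, Pi.add_apply, ih]

variable [FiniteDimensional ℝ F]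

variable (n F E) in
/-- A local frame of a vector bundle and its dual frame, both multiplied by a smooth function `g`
whose support lies in the domain of the frame, so that they are defined globally. -/
structure CutFrame where
  g : SmoothFun n M
  e : Fin (Module.finrank ℝ F) → Cₛ^∞⟮𝓡 n; F, E⟯
  ε : Fin (Module.finrank ℝ F) → Cₛ^∞⟮𝓡 n; F, E⟯ →ₗ[SmoothFun n M] SmoothFun n M
  basis : ∀ x, g x ≠ 0 → Module.Basis (Fin (Module.finrank ℝ F)) ℝ (E x)
  e_apply : ∀ a x (h : g x ≠ 0), e a x = g x • basis x h a
  e_zero : ∀ a x, g x = 0 → e a x = 0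
  ε_apply : ∀ a s x (h : g x ≠ 0), ε a s x = g x * (basis x h).repr (s x) a
  ε_zero : ∀ a s x, g x = 0 → ε a s x = 0

namespace CutFrame

variable (c : CutFrame n F E)

/-- The factor is a square because the frame and the dual frame are each multiplied by the cut-off
function. -/
theorem dual (a b) : c.ε a (c.e b) = if a = b then c.g * c.g else 0 := by
  ext x
  by_cases h : c.g x = 0
  · rw [c.ε_zero _ _ _ h]
    split_ifs <;> simp [h]
  · rw [c.ε_apply _ _ _ h, c.e_apply _ _ h, map_smul, Finsupp.smul_apply, Module.Basis.repr_self,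
      Finsupp.single_apply]
    by_cases hab : a = b
    · subst hab
      simp
    · simp [hab, Ne.symm hab]

theorem span (s : Cₛ^∞⟮𝓡 n; F, E⟯) : ∑ a, c.ε a s • c.e a = (c.g * c.g) • s := by
  ext x
  rw [section_sum_apply, section_smul_apply]
  by_cases h : c.g x = 0
  · simp [c.e_zero _ _ h, h]
  · simp only [section_smul_apply, c.ε_apply _ _ _ h, c.e_apply _ _ h, SmoothFun.mul_apply]
    conv_rhs => rw [← (c.basis x h).sum_repr (s x), Finset.smul_sum]
    refine Finset.sum_congr rfl fun a _ => ?_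
    rw [smul_smul, smul_smul]
    congr 1
    ring

theorem trace [∀ x, IsTopologicalAddGroup (E x)] [∀ x, ContinuousSMul ℝ (E x)]
    (φ : HomSection n F E F E) :
    (c.g * c.g) * homTrace φ = ∑ a, c.ε a (homEval φ (c.e a)) := by
  ext x
  rw [SmoothFun.sum_apply, SmoothFun.mul_apply, SmoothFun.mul_apply]
  by_cases h : c.g x = 0
  · simp [c.ε_zero _ _ _ h, h]
  · have e : homTrace φ x = LinearMap.trace ℝ (E x) (φ x : E x →ₗ[ℝ] E x) := rfl
    rw [e, LinearMap.trace_eq_matrix_trace ℝ (c.basis x h), Matrix.trace, Finset.mul_sum]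
    refine Finset.sum_congr rfl fun a _ => ?_
    have e' : homEval φ (c.e a) x = φ x (c.e a x) := rfl
    rw [c.ε_apply _ _ _ h, e', c.e_apply _ _ h, map_smul, map_smul, Finsupp.smul_apply,
      Matrix.diag_apply, LinearMap.toMatrix_apply, smul_eq_mul]
    exact mul_assoc _ _ _

end CutFrame

variable [ContMDiffVectorBundle ∞ F E (𝓡 n)]

/-- A section of a local frame, multiplied by a function `g` supported in the domain. -/
def cutSection (e : Trivialization F (TotalSpace.proj : TotalSpace F E → M))
    [MemTrivializationAtlas e] (g : SmoothFun n M) (hg : tsupport g ⊆ e.baseSet)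
    (a : Fin (Module.finrank ℝ F)) : Cₛ^∞⟮𝓡 n; F, E⟯ :=
  ⟨fun x => g x • e.localFrame (Module.finBasis ℝ F) a x,
    g.contMDiff.contMDiffOn.smul_section_of_tsupport e.open_baseSet hg
      (e.contMDiffOn_localFrame_baseSet ∞ _ a)⟩

/-- A coordinate in a local frame, multiplied by a function `g` supported in the domain. -/
def cutCoord (e : Trivialization F (TotalSpace.proj : TotalSpace F E → M))
    [MemTrivializationAtlas e] (g : SmoothFun n M) (hg : tsupport g ⊆ e.baseSet)
    (a : Fin (Module.finrank ℝ F)) : Cₛ^∞⟮𝓡 n; F, E⟯ →ₗ[SmoothFun n M] SmoothFun n M where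
  toFun s := ⟨fun x => g x * e.localFrameCoeff (𝓡 n) (Module.finBasis ℝ F) a x (s x), by
    refine contMDiff_of_tsupport fun x hx => ?_
    have hx' : x ∈ e.baseSet := hg (tsupport_mul_subset_left hx)
    exact g.contMDiff.contMDiffAt.mul
      (contMDiffAt_localFrameCoeff (Module.finBasis ℝ F) hx' s.contMDiff.contMDiffAt a)⟩
  map_add' s t := by
    ext x
    change g x * _ = g x * _ + g x * _
    rw [ContMDiffSection.coe_add, Pi.add_apply, map_add, mul_add]
  map_smul' f s := by
    ext x
    change g x * _ = f x * (g x * _)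
    rw [section_smul_apply, map_smul, smul_eq_mul]
    ring

/-- The frame of a local trivialization, multiplied by a function `g` supported in the domain. -/
def CutFrame.ofTrivialization (e : Trivialization F (TotalSpace.proj : TotalSpace F E → M))
    [MemTrivializationAtlas e] (g : SmoothFun n M) (hg : tsupport g ⊆ e.baseSet) :
    CutFrame n F E where
  g := g
  e := cutSection e g hg
  ε := cutCoord e g hg
  basis x h := e.basisAt (Module.finBasis ℝ F) (hg (subset_tsupport g h))
  e_apply a x h := by
    change g x • e.localFrame (Module.finBasis ℝ F) a x = _
    rw [e.localFrame_apply_of_mem_baseSet _ (hg (subset_tsupport g h))]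
  e_zero a x h := by
    change g x • e.localFrame (Module.finBasis ℝ F) a x = _
    rw [h, zero_smul]
  ε_apply a s x h := by
    change g x * _ = _
    rw [e.localFrameCoeff_apply_of_mem_baseSet _ (hg (subset_tsupport g h))]
  ε_zero a s x h := by
    change g x * _ = _
    rw [h, zero_mul]

variable [IsManifold (𝓡 n) ∞ M] [T2Space M] [SigmaCompactSpace M]

variable (n F E) in
/-- A locally finite family of cut-off local frames that cover the base. -/
theorem exists_cutFrames : ∃ c : M → CutFrame n F E,
    LocallyFinite (fun i => Function.support (c i).g) ∧ ∀ x, ∃ i, (c i).g x ≠ 0 := by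
  obtain ⟨ρ, hρ⟩ := SmoothPartitionOfUnity.exists_isSubordinate (𝓡 n) (isClosed_univ (X := M))
    (fun c => (trivializationAt F E c).baseSet) (fun c => (trivializationAt F E c).open_baseSet)
    (fun x _ => Set.mem_iUnion.2 ⟨x, FiberBundle.mem_baseSet_trivializationAt' x⟩)
  refine ⟨fun c => CutFrame.ofTrivialization (trivializationAt F E c) (ρ c) (hρ c),
    ρ.locallyFinite, fun x => ?_⟩
  by_contra! h
  have := ρ.sum_eq_one (Set.mem_univ x)
  have h' : ∀ c, ρ c x = 0 := h
  simp [h'] at this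

end BundleFrames

/-! ### Smoothness of bundle maps tested on sections. -/

section HomBundle

variable {n : ℕ} {M : Type*} [TopologicalSpace M] [ChartedSpace (EuclideanSpace ℝ (Fin n)) M]
  [IsManifold (𝓡 n) ∞ M] [T2Space M] [SigmaCompactSpace M]
  {F : Type*} [NormedAddCommGroup F] [NormedSpace ℝ F] [FiniteDimensional ℝ F] {E : M → Type*}
  [∀ x, AddCommGroup (E x)] [∀ x, Module ℝ (E x)] [∀ x, TopologicalSpace (E x)]
  [TopologicalSpace (TotalSpace F E)] [FiberBundle F E] [VectorBundle ℝ F E]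
  [ContMDiffVectorBundle ∞ F E (𝓡 n)]
  {F' : Type*} [NormedAddCommGroup F'] [NormedSpace ℝ F'] {E' : M → Type*}
  [∀ x, AddCommGroup (E' x)] [∀ x, Module ℝ (E' x)] [∀ x, TopologicalSpace (E' x)]
  [∀ x, IsTopologicalAddGroup (E' x)] [∀ x, ContinuousSMul ℝ (E' x)]
  [TopologicalSpace (TotalSpace F' E')] [FiberBundle F' E'] [VectorBundle ℝ F' E']
  [ContMDiffVectorBundle ∞ F' E' (𝓡 n)]

set_option linter.unusedSectionVars false

theorem contMDiffAt_clm_of_basis {ι : Type*} [Fintype ι] (b : Module.Basis ι ℝ F)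
    {A : M → F →L[ℝ] F'} {x₀ : M}
    (h : ∀ a, ContMDiffAt (𝓡 n) 𝓘(ℝ, F') ∞ (fun x => A x (b a)) x₀) :
    ContMDiffAt (𝓡 n) 𝓘(ℝ, F →L[ℝ] F') ∞ A x₀ := by
  have e : A = fun x => ∑ a, ContinuousLinearMap.smulRightL ℝ F F'
      (LinearMap.toContinuousLinearMap (b.coord a)) (A x (b a)) := by
    funext x
    ext v
    conv_lhs => rw [← b.sum_repr v, map_sum]
    simp
  rw [e]
  refine ContMDiffAt.sum fun a _ => ?_
  exact ((ContinuousLinearMap.smulRightL ℝ F F'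
      (LinearMap.toContinuousLinearMap (b.coord a))).contMDiff (n := ∞)).contMDiffAt.comp x₀ (h a)

/-- A family of linear maps between the fibres of two vector bundles that takes smooth sections to
smooth sections is smooth. -/
theorem contMDiff_hom_of_apply (φ : ∀ x, E x →L[ℝ] E' x)
    (h : ∀ s : Cₛ^∞⟮𝓡 n; F, E⟯,
      ContMDiff (𝓡 n) ((𝓡 n).prod 𝓘(ℝ, F')) ∞ fun x => TotalSpace.mk' F' x (φ x (s x))) :
    ContMDiff (𝓡 n) ((𝓡 n).prod 𝓘(ℝ, F →L[ℝ] F')) ∞ fun x => TotalSpace.mk' (F →L[ℝ] F') x (φ x) := by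
  intro x₀
  refine (contMDiffAt_hom_bundle _).2 ⟨contMDiffAt_id, ?_⟩
  let b := Module.finBasis ℝ F
  refine contMDiffAt_clm_of_basis b fun a => ?_
  let t := trivializationAt F E x₀
  let t' := trivializationAt F' E' x₀
  have ht : t.baseSet ∈ nhds x₀ :=
    t.open_baseSet.mem_nhds (FiberBundle.mem_baseSet_trivializationAt' x₀)
  have hx' : x₀ ∈ t'.baseSet := FiberBundle.mem_baseSet_trivializationAt' x₀
  -- The bump function extends the local frame section `a` to a global one that agrees with it near
  -- `x₀`, so the hypothesis on global sections applies.
  obtain ⟨g, -, hg⟩ := (SmoothBumpFunction.nhds_basis_tsupport (I := 𝓡 n) x₀).mem_iff.1 ht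
  let s : Cₛ^∞⟮𝓡 n; F, E⟯ := cutSection t ⟨g, g.contMDiff⟩ hg a
  have hs := (t'.contMDiffAt_section_iff (n := ∞) (IB := 𝓡 n) hx').1 (h s x₀)
  refine hs.congr_of_eventuallyEq ?_
  filter_upwards [ht, t'.open_baseSet.mem_nhds hx', g.eventuallyEq_one] with x hx hx' hgx
  have es : s x = t.symm x (b a) := by
    change g x • t.localFrame b a x = _
    rw [hgx, Pi.one_apply, one_smul, t.localFrame_apply_of_mem_baseSet _ hx]
    rfl
  rw [es]
  change ContinuousLinearMap.inCoordinates F E F' E' x₀ x x₀ x (φ x) (b a) = _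
  rw [ContinuousLinearMap.inCoordinates_eq hx hx']
  rfl

end HomBundle

/-- Each `f v_i` is a combination of the `r` elements `e_a`. As `q > r`, every term of the
multilinear expansion repeats one of them. -/
theorem pow_smul_alternating_eq_zero {R L : Type*} [CommRing R] [AddCommGroup L] [Module R L]
    {N : Type*} [AddCommGroup N] [Module R N] {f : R} {r q : ℕ} (e : Fin r → L)
    (ε : Fin r → L →ₗ[R] R) (h : ∀ v, ∑ a, ε a v • e a = f • v) (hq : r < q)
    (t : L [⋀^Fin q]→ₗ[R] N) (v : Fin q → L) : f ^ q • t v = 0 := by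
  classical
  have h1 : t (fun i => f • v i) = f ^ q • t v := by
    have := t.toMultilinearMap.map_smul_univ (fun _ => f) v
    simpa using this
  have h2 : t (fun i => ∑ a, ε a (v i) • e a) = 0 := by
    have := t.toMultilinearMap.map_sum (fun i a => ε a (v i) • e a)
    refine this.trans (Finset.sum_eq_zero fun ρ _ => ?_)
    refine (t.toMultilinearMap.map_smul_univ (fun i => ε (ρ i) (v i)) (fun i => e (ρ i))).trans ?_
    have h3 : t (fun i => e (ρ i)) = 0 := by
      have hρ : ¬ Function.Injective ρ := fun hi => by
        have := Fintype.card_le_of_injective ρ hi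
        simp only [Fintype.card_fin] at this
        omega
      exact t.map_eq_zero_of_not_injective _ fun hi => hρ hi.of_comp
    have h3' : t.toMultilinearMap (fun i => e (ρ i)) = 0 := h3
    rw [h3', smul_zero]
  rw [← h1, ← h2]
  simp only [h]

/-! ### Sections of Hom bundles as linear maps, the degree bound, and the retraction. -/

section HomEval

set_option linter.unusedSectionVars false

variable {n : ℕ} {M : Type*} [TopologicalSpace M] [ChartedSpace (EuclideanSpace ℝ (Fin n)) M]
  [IsManifold (𝓡 n) ∞ M] [T2Space M] [SigmaCompactSpace M]
  {F : Type*} [NormedAddCommGroup F] [NormedSpace ℝ F] [FiniteDimensional ℝ F] {E : M → Type*}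
  [∀ x, AddCommGroup (E x)] [∀ x, Module ℝ (E x)] [∀ x, TopologicalSpace (E x)]
  [TopologicalSpace (TotalSpace F E)] [FiberBundle F E] [VectorBundle ℝ F E]
  [ContMDiffVectorBundle ∞ F E (𝓡 n)]
  {F' : Type*} [NormedAddCommGroup F'] [NormedSpace ℝ F'] {E' : M → Type*}
  [∀ x, AddCommGroup (E' x)] [∀ x, Module ℝ (E' x)] [∀ x, TopologicalSpace (E' x)]
  [∀ x, IsTopologicalAddGroup (E' x)] [∀ x, ContinuousSMul ℝ (E' x)]
  [TopologicalSpace (TotalSpace F' E')] [FiberBundle F' E'] [VectorBundle ℝ F' E']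

/-- There are no alternating forms of degree larger than the rank. -/
theorem alternating_eq_zero_of_finrank_lt {q : ℕ} (hq : Module.finrank ℝ F < q)
    (t : Cₛ^∞⟮𝓡 n; F, E⟯ [⋀^Fin q]→ₗ[SmoothFun n M] SmoothFun n M) : t = 0 := by
  obtain ⟨c, -, hc⟩ := exists_cutFrames n F E
  ext v x
  obtain ⟨i, hi⟩ := hc x
  have h := pow_smul_alternating_eq_zero (c i).e (c i).ε (c i).span hq t v
  have h' := congrArg (fun f : SmoothFun n M => f x) h
  have hp : ∀ q : ℕ, (((c i).g * (c i).g) ^ q) x = ((c i).g x * (c i).g x) ^ q := fun q => by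
    induction q with
    | zero => simp
    | succ q ih => rw [pow_succ, pow_succ, SmoothFun.mul_apply, ih, SmoothFun.mul_apply]
  simp only [smul_eq_mul, SmoothFun.mul_apply, hp, SmoothFun.zero_apply] at h'
  exact (mul_eq_zero.1 h').resolve_left (pow_ne_zero _ (mul_ne_zero hi hi))

theorem homEval_injective : Function.Injective
    (homEval : HomSection n F E F' E' →ₗ[SmoothFun n M] _) := by
  intro φ ψ h
  obtain ⟨c, -, hc⟩ := exists_cutFrames n F E
  ext x v
  obtain ⟨i, hi⟩ := hc x
  have : (φ x : E x →ₗ[ℝ] E' x) = ψ x := by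
    refine ((c i).basis x hi).ext fun a => ?_
    have h1 : φ x ((c i).e a x) = ψ x ((c i).e a x) :=
      congrArg (fun s : Cₛ^∞⟮𝓡 n; F', E'⟯ => s x) (LinearMap.congr_fun h ((c i).e a))
    rw [(c i).e_apply a x hi, map_smul, map_smul] at h1
    exact smul_right_injective _ hi h1
  exact LinearMap.congr_fun this v

/-- Tensoriality: linearity over smooth functions makes `T s x` depend only on `s x`, through the
expansion of `s` in a cut-off frame at `x`. -/
theorem homEval_surjective [∀ x, IsTopologicalAddGroup (E x)] [∀ x, ContinuousSMul ℝ (E x)]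
    [ContMDiffVectorBundle ∞ F' E' (𝓡 n)] : Function.Surjective
    (homEval : HomSection n F E F' E' →ₗ[SmoothFun n M] _) := by
  intro T
  obtain ⟨c, -, hc⟩ := exists_cutFrames n F E
  choose i hi using hc
  have : ∀ x, T2Space (E x) := fun x => FiberBundle.t2Space F E x
  have : ∀ x, FiniteDimensional ℝ (E x) := fun x => VectorBundle.finiteDimensional ℝ F E x
  -- Since `e_a` is `g` times a basis vector at `x`, one division by `g x` is required. The frame is
  -- chosen separately at each point, so smoothness is not visible here; it follows from `φ x (s x)
  -- = T s x`.
  let φ : ∀ x, E x →L[ℝ] E' x := fun x => LinearMap.toContinuousLinearMap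
    (((c (i x)).g x)⁻¹ • ∑ a, (((c (i x)).basis x (hi x)).coord a).smulRight (T ((c (i x)).e a) x))
  have hφ : ∀ s x, φ x (s x) = T s x := by
    intro s x
    have h0 : ∑ a, (c (i x)).ε a s • T ((c (i x)).e a) = ((c (i x)).g * (c (i x)).g) • T s := by
      rw [← map_smul, ← (c (i x)).span, map_sum]
      simp only [map_smul]
    have h1 : ∑ a, (c (i x)).ε a s x • T ((c (i x)).e a) x =
        ((c (i x)).g x * (c (i x)).g x) • T s x := by
      have := congrArg (fun s : Cₛ^∞⟮𝓡 n; F', E'⟯ => s x) h0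
      simpa only [section_sum_apply, section_smul_apply, SmoothFun.mul_apply] using this
    simp only [(c (i x)).ε_apply _ _ _ (hi x), mul_smul, ← Finset.smul_sum] at h1
    have h2 := smul_right_injective (E' x) (hi x) h1
    simp only [φ, LinearMap.coe_toContinuousLinearMap', LinearMap.smul_apply, LinearMap.sum_apply,
      LinearMap.smulRight_apply, Module.Basis.coord_apply]
    rw [h2, smul_smul, inv_mul_cancel₀ (hi x), one_smul]
  refine ⟨⟨φ, contMDiff_hom_of_apply φ fun s => ?_⟩, ?_⟩
  · simp only [hφ]
    exact (T s).contMDiff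
  · ext s x
    exact hφ s x

variable (n F E) in
/-- The module of sections of a vector bundle is a retract of a product of copies of the ring of
smooth functions. -/
theorem exists_retract : ∃ (ε : Cₛ^∞⟮𝓡 n; F, E⟯ →ₗ[SmoothFun n M]
      (M × Fin (Module.finrank ℝ F) → SmoothFun n M))
    (Φ : (M × Fin (Module.finrank ℝ F) → SmoothFun n M) →ₗ[SmoothFun n M] Cₛ^∞⟮𝓡 n; F, E⟯),
    ∀ s, Φ (ε s) = s := by
  obtain ⟨c, hlf, hc⟩ := exists_cutFrames n F E
  have hq0 : ∀ x, Function.HasFiniteSupport fun i => (c i).g x * (c i).g x := fun x =>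
    (hlf.point_finite x).subset fun i hi => left_ne_zero_of_mul hi
  -- Coordinates followed by recombination in frame `i` multiply a section by `g_i²`. Dividing by
  -- the positive smooth function `∑ g_i²` turns this into a retraction.
  let q : M → ℝ := fun x => ∑ᶠ i, (c i).g x * (c i).g x
  have hqs : ContMDiff (𝓡 n) 𝓘(ℝ, ℝ) ∞ q :=
    contMDiff_finsum (fun i => (c i).g.contMDiff.mul (c i).g.contMDiff)
      (hlf.subset fun i x hx => left_ne_zero_of_mul hx)
  have hq : ∀ x, q x ≠ 0 := fun x => by
    obtain ⟨i, hi⟩ := hc x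
    exact (finsum_pos (f := fun j => (c j).g x * (c j).g x) (fun j => mul_self_nonneg _) ⟨i, mul_self_pos.2 hi⟩ (hq0 x)).ne'
  let φ : (M × Fin (Module.finrank ℝ F) → SmoothFun n M) → M → ∀ x, E x :=
    fun r i x => ∑ a, r (i, a) x • (c i).e a x
  have hφ0 : ∀ r i x, (c i).g x = 0 → φ r i x = 0 := fun r i x h => by
    simp [φ, (c i).e_zero _ _ h]
  have hφ : ∀ r x, Function.HasFiniteSupport fun i => φ r i x := fun r x =>
    (hlf.point_finite x).subset fun i hi => mt (hφ0 r i x) hi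
  have hφs : ∀ r i, ContMDiff (𝓡 n) ((𝓡 n).prod 𝓘(ℝ, F)) ∞
      fun x => TotalSpace.mk' F x (φ r i x) := fun r i =>
    ContMDiff.sum_section fun a _ => (r (i, a)).contMDiff.smul_section ((c i).e a).contMDiff
  refine ⟨LinearMap.pi fun p => (c p.1).ε p.2,
    { toFun := fun r => ⟨fun x => (q x)⁻¹ • ∑ᶠ i, φ r i x, (hqs.inv₀ hq).smul_section
        (ContMDiff.finsum_section_of_locallyFinite
          (hlf.subset fun i x hx => mt (hφ0 r i x) hx) (hφs r))⟩
      map_add' := fun r r' => ?_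
      map_smul' := fun f r => ?_ }, fun s => ?_⟩
  · ext x
    change (q x)⁻¹ • (∑ᶠ i, φ (r + r') i x) =
      (q x)⁻¹ • (∑ᶠ i, φ r i x) + (q x)⁻¹ • (∑ᶠ i, φ r' i x)
    rw [← smul_add, ← finsum_add_distrib (hφ r x) (hφ r' x)]
    congr 1
    refine finsum_congr fun i => ?_
    simp [φ, add_smul, Finset.sum_add_distrib]
  · ext x
    change (q x)⁻¹ • (∑ᶠ i, φ (f • r) i x) = f x • ((q x)⁻¹ • (∑ᶠ i, φ r i x))
    rw [smul_comm (f x), smul_finsum (f x)]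
    congr 1
    refine finsum_congr fun i => ?_
    simp [φ, mul_smul, Finset.smul_sum]
  · ext x
    change (q x)⁻¹ • ∑ᶠ i, ∑ a, (c i).ε a s x • (c i).e a x = s x
    have h : ∀ i, ∑ a, (c i).ε a s x • (c i).e a x = ((c i).g x * (c i).g x) • s x := fun i => by
      have := congrArg (fun s : Cₛ^∞⟮𝓡 n; F, E⟯ => s x) ((c i).span s)
      simpa only [section_sum_apply, section_smul_apply, SmoothFun.mul_apply] using this
    simp only [h]
    rw [← finsum_smul, smul_smul, inv_mul_cancel₀ (hq x), one_smul]

end HomEval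

/-! ### Frames of a graded vector bundle and the separation property. -/

section GradedBundle

set_option linter.unusedSectionVars false

variable {n : ℕ} {M : Type*} [TopologicalSpace M] [ChartedSpace (EuclideanSpace ℝ (Fin n)) M]
  {S : Finset ℤ} {F : S → Type*} [∀ z, NormedAddCommGroup (F z)] [∀ z, NormedSpace ℝ (F z)]
  [∀ z, FiniteDimensional ℝ (F z)] {E : S → M → Type*} [∀ z x, AddCommGroup (E z x)]
  [∀ z x, Module ℝ (E z x)] [∀ z x, TopologicalSpace (E z x)]
  [∀ z x, IsTopologicalAddGroup (E z x)] [∀ z x, ContinuousSMul ℝ (E z x)]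
  [∀ z, TopologicalSpace (TotalSpace (F z) (E z))] [∀ z, FiberBundle (F z) (E z)]
  [∀ z, VectorBundle ℝ (F z) (E z)]

variable (n F E) in
/-- The evaluation `Γ(Hom(E_l, E_j)) × Γ(E_l) → Γ(E_j)`. -/
abbrev gradedEval (l j : S) : HomSection n (F l) (E l) (F j) (E j) →ₗ[SmoothFun n M]
    Cₛ^∞⟮𝓡 n; F l, E l⟯ →ₗ[SmoothFun n M] Cₛ^∞⟮𝓡 n; F j, E j⟯ :=
  homEval

variable (n F E) in
/-- The fibrewise trace on `Γ(End(E_z))`. -/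
abbrev gradedTrace (z : S) :
    HomSection n (F z) (E z) (F z) (E z) →ₗ[SmoothFun n M] SmoothFun n M :=
  homTrace

/-- Local frames of the summands of a graded vector bundle, with a common factor. -/
def gradedFrame (c : ∀ z, CutFrame n (F z) (E z)) :
    GFrame (V := fun z => Cₛ^∞⟮𝓡 n; F z, E z⟯)
      (H := fun l j => HomSection n (F l) (E l) (F j) (E j))
      (gradedEval n F E) (gradedTrace n F E) where
  f := ∏ z, (c z).g * (c z).g
  rank z := Module.finrank ℝ (F z)
  e z := (c z).e
  -- The functionals absorb the factors of the other summands, so that all summands share the same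
  -- `f`.
  ε z a := (∏ y ∈ Finset.univ.erase z, (c y).g * (c y).g) • (c z).ε a
  dual z a b := by
    rw [LinearMap.smul_apply, (c z).dual]
    split_ifs
    · exact Finset.prod_erase_mul _ (fun z => (c z).g * (c z).g) (Finset.mem_univ z)
    · exact smul_zero _
  span z v := by
    simp only [LinearMap.smul_apply, smul_assoc]
    rw [← Finset.smul_sum, (c z).span, smul_smul,
      Finset.prod_erase_mul _ (fun z => (c z).g * (c z).g) (Finset.mem_univ z)]
  trace z φ := by
    simp only [LinearMap.smul_apply, ← Finset.smul_sum]
    have h := (c z).trace φ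
    rw [← Finset.prod_erase_mul _ (fun z => (c z).g * (c z).g) (Finset.mem_univ z), mul_smul]
    exact congrArg _ h

variable [IsManifold (𝓡 n) ∞ M] [T2Space M] [SigmaCompactSpace M]
  [∀ z, ContMDiffVectorBundle ∞ (F z) (E z) (𝓡 n)]

variable (n F E) in
theorem exists_gradedFrame_ne_zero (x : M) : ∃ fr : GFrame (V := fun z => Cₛ^∞⟮𝓡 n; F z, E z⟯)
      (H := fun l j => HomSection n (F l) (E l) (F j) (E j))
      (gradedEval n F E) (gradedTrace n F E), fr.f x ≠ 0 := by
  have h : ∀ z, ∃ c : CutFrame n (F z) (E z), c.g x ≠ 0 := fun z => by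
    obtain ⟨c, -, hc⟩ := exists_cutFrames n (F z) (E z)
    obtain ⟨i, hi⟩ := hc x
    exact ⟨c i, hi⟩
  choose c hc using h
  refine ⟨gradedFrame c, ?_⟩
  change (∏ z, (c z).g * (c z).g) x ≠ 0
  rw [SmoothFun.prod_apply]
  exact Finset.prod_ne_zero_iff.2 fun z _ => mul_ne_zero (hc z) (hc z)

variable (n F E) in
theorem separating_smoothFun : Separating (V := fun z => Cₛ^∞⟮𝓡 n; F z, E z⟯)
      (H := fun l j => HomSection n (F l) (E l) (F j) (E j))
      (gradedEval n F E) (gradedTrace n F E) (SmoothFun n M) := by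
  intro v hv
  ext x
  obtain ⟨fr, hfr⟩ := exists_gradedFrame_ne_zero n F E x
  have h := congrArg (fun f : SmoothFun n M => f x) (hv fr)
  simp only [smul_eq_mul, SmoothFun.mul_apply, SmoothFun.zero_apply] at h
  exact (mul_eq_zero.1 ((mul_eq_zero.1 h).resolve_left hfr)).resolve_left hfr

variable (n F E) in
theorem separating_section (z : S) : Separating (V := fun z => Cₛ^∞⟮𝓡 n; F z, E z⟯)
      (H := fun l j => HomSection n (F l) (E l) (F j) (E j))
      (gradedEval n F E) (gradedTrace n F E) Cₛ^∞⟮𝓡 n; F z, E z⟯ := by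
  intro v hv
  ext x
  obtain ⟨fr, hfr⟩ := exists_gradedFrame_ne_zero n F E x
  have h : fr.f x • fr.f x • v x = 0 := congrArg (fun s : Cₛ^∞⟮𝓡 n; F z, E z⟯ => s x) (hv fr)
  exact (smul_eq_zero.1 ((smul_eq_zero.1 h).resolve_left hfr)).resolve_left hfr

end GradedBundle

/-! ### Translation to Lie algebroids and the Pontryagin characters. -/

section Characters

set_option linter.unusedSectionVars false

variable {n : ℕ} {M : Type*} [TopologicalSpace M]
    [ChartedSpace (EuclideanSpace ℝ (Fin n)) M] [IsManifold (𝓡 n) ∞ M]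
    {FA : Type*} [NormedAddCommGroup FA] [NormedSpace ℝ FA]
    {A : M → Type*} [∀ x, AddCommGroup (A x)] [∀ x, Module ℝ (A x)] [∀ x, TopologicalSpace (A x)]
    [TopologicalSpace (TotalSpace FA A)] [FiberBundle FA A] [VectorBundle ℝ FA A]

/-- The bracket and the anchor of a Lie algebroid on the level of sections. -/
def LieAlgebroid.toAnchoredBracket (𝓐 : LieAlgebroid n FA A) :
    AnchoredBracket (SmoothFun n M) Cₛ^∞⟮𝓡 n; FA, A⟯ where
  br := 𝓐.bracket
  an := 𝓐.anchorDeriv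
  self := 𝓐.bracket_self
  jacobi := 𝓐.jacobi
  leib := 𝓐.leibniz

theorem LieAlgebroid.td_single (𝓐 : LieAlgebroid n FA A) (k : ℕ) (θ : ScalarForm n FA A k) :
    𝓐.toAnchoredBracket.td (Pi.single k θ) = Pi.single (k + 1) (𝓐.d k θ) :=
  𝓐.toAnchoredBracket.td_single k θ

variable {𝓐 : LieAlgebroid n FA A} {S : Finset ℤ} {F : S → Type*} [∀ z, NormedAddCommGroup (F z)]
    [∀ z, NormedSpace ℝ (F z)]
    {E : S → M → Type*} [∀ z x, AddCommGroup (E z x)] [∀ z x, Module ℝ (E z x)]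
    [∀ z x, TopologicalSpace (E z x)]
    [∀ z, TopologicalSpace (TotalSpace (F z) (E z))] [∀ z, FiberBundle (F z) (E z)]
    [∀ z, VectorBundle ℝ (F z) (E z)]

theorem GradedForm.wedge_eq_act {l : ℕ} (θ : ScalarForm n FA A l) (η : GradedForm n FA A F E) :
    GradedForm.wedge θ η = act (Pi.single l θ) η := by
  funext p z
  exact (tw_single_left _ θ (gproj z η) p).symm

theorem neg_one_pow_smul_eq_zsign {N : Type*} [AddCommGroup N] [Module ℝ N] (l : ℕ) (v : N) :
    (-1 : ℝ) ^ l • v = zsign l • v := by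
  rw [zsign_natCast, ← Int.cast_smul_eq_zsmul ℝ]
  simp

theorem ConnectionUpToHomotopy.isConn (D : ConnectionUpToHomotopy F E 𝓐) :
    IsConn 𝓐.toAnchoredBracket D.op where
  degree := D.degree
  leibniz l θ η := by
    have h := D.leibniz l θ η
    rw [GradedForm.wedge_eq_act, GradedForm.wedge_eq_act, GradedForm.wedge_eq_act,
      ← LieAlgebroid.td_single, neg_one_pow_smul_eq_zsign] at h
    exact h

/-- The connection up to homotopy given by an operator with the required properties. -/
def ConnectionUpToHomotopy.ofIsConn
    {D : Module.End ℝ (GForm (SmoothFun n M) Cₛ^∞⟮𝓡 n; FA, A⟯ fun z => Cₛ^∞⟮𝓡 n; F z, E z⟯)}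
    (hD : IsConn 𝓐.toAnchoredBracket D) : ConnectionUpToHomotopy F E 𝓐 where
  op := D
  degree := hD.degree
  leibniz l θ η := by
    rw [GradedForm.wedge_eq_act, GradedForm.wedge_eq_act, GradedForm.wedge_eq_act,
      ← LieAlgebroid.td_single, neg_one_pow_smul_eq_zsign]
    exact hD.leibniz l θ η

variable [∀ z x, IsTopologicalAddGroup (E z x)] [∀ z x, ContinuousSMul ℝ (E z x)]

theorem EndForm.hat_eq_hatOp (K : EndForm n FA A F E) (η : GradedForm n FA A F E) :
    K.hat η = hatOp (gradedEval n F E) K η := by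
  funext s j
  exact (hatOp_apply (ev := gradedEval n F E) K η s j).symm

variable [∀ z, FiniteDimensional ℝ (F z)]

variable [FiniteDimensional ℝ FA] [ContMDiffVectorBundle ∞ FA A (𝓡 n)]
    [∀ z, ContMDiffVectorBundle ∞ (F z) (E z) (𝓡 n)] [T2Space M] [SigmaCompactSpace M]

theorem gradedEval_bijective (l j : S) : Function.Bijective (gradedEval n F E l j) :=
  ⟨homEval_injective, homEval_surjective⟩

variable (n FA A) in
theorem exists_forall_alternating_eq_zero : ∃ N, ∀ q ≥ N,
    ∀ t : Cₛ^∞⟮𝓡 n; FA, A⟯ [⋀^Fin q]→ₗ[SmoothFun n M] SmoothFun n M, t = 0 :=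
  ⟨Module.finrank ℝ FA + 1, fun _ hq t => alternating_eq_zero_of_finrank_lt hq t⟩

theorem ConnectionUpToHomotopy.existsUnique_isCurvaturePower (D : ConnectionUpToHomotopy F E 𝓐)
    (i : ℕ) : ∃! K : EndForm n FA A F E, D.IsCurvaturePower i K := by
  obtain ⟨K, hK, hKT⟩ := exists_hatOp_eq (ev := gradedEval n F E) (tr := gradedTrace n F E)
    gradedEval_bijective (separating_section n F E) (exists_forall_alternating_eq_zero n FA A)
    (D.isConn.pow_mem i)
  refine ⟨K, ⟨fun p l j h => hK p l j (by push_cast; exact h), fun η => ?_⟩, fun K' hK' => ?_⟩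
  · rw [EndForm.hat_eq_hatOp]
    exact hKT η
  -- The operator alone determines `K`; homogeneity plays no role in the uniqueness.
  · refine hatOp_injective (ev := gradedEval n F E) (fun l j => (gradedEval_bijective l j).1) ?_
    refine LinearMap.ext fun η => ?_
    rw [hKT, ← EndForm.hat_eq_hatOp]
    exact hK'.2 η

theorem ConnectionUpToHomotopy.IsCurvaturePower.isTr {D : ConnectionUpToHomotopy F E 𝓐} {i : ℕ}
    {K : EndForm n FA A F E} (hK : D.IsCurvaturePower i K) :
    IsTr (gradedEval n F E) (gradedTrace n F E) (D.op ^ (2 * i)) (gtrTot (gradedTrace n F E) K) :=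
  isTr_gtrTot fun η => by rw [← EndForm.hat_eq_hatOp, hK.2 η]

/-- The inhomogeneous trace form is closed, and the component in degree `2i + 1` of this identity is
the claim. -/
theorem ConnectionUpToHomotopy.IsCurvaturePower.gtr_mem_closedForms
    {D : ConnectionUpToHomotopy F E 𝓐} {i : ℕ} {K : EndForm n FA A F E}
    (hK : D.IsCurvaturePower i K) : K.gtr (2 * i) ∈ 𝓐.closedForms (2 * i) :=
  congrFun (D.isConn.td_trace_pow (separating_smoothFun n F E) i hK.isTr) (2 * i + 1)

theorem ConnectionUpToHomotopy.IsCurvaturePower.gtr_sub_mem_exactForms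
    {D D' : ConnectionUpToHomotopy F E 𝓐} {i : ℕ} (hi : 1 ≤ i) {K K' : EndForm n FA A F E}
    (hK : D.IsCurvaturePower i K) (hK' : D'.IsCurvaturePower i K') :
    K'.gtr (2 * i) - K.gtr (2 * i) ∈ 𝓐.exactForms (2 * i) := by
  -- With `i + 1` in place of `i`, the degree `2 (i + 1)` is a successor, and the primitive is the
  -- component of `y` in degree `2 i + 1`.
  obtain ⟨i, rfl⟩ := Nat.exists_eq_add_of_le' hi
  obtain ⟨y, hy⟩ := D.isConn.exists_trace_pow_sub (separating_smoothFun n F E)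
    (fun m T hT => exists_isTr gradedEval_bijective (separating_section n F E)
      (exists_forall_alternating_eq_zero n FA A) hT) D'.isConn i
  have h := (hK'.isTr.sub hK.isTr).unique (separating_smoothFun n F E) hy
  exact ⟨y (2 * i + 1), (congrFun h (2 * (i + 1))).symm⟩

theorem ConnectionUpToHomotopy.IsCharacter.unique {D D' : ConnectionUpToHomotopy F E 𝓐} {i : ℕ}
    (hi : 1 ≤ i) {σ σ' : 𝓐.Cohomology (2 * i)} (h : D.IsCharacter i σ) (h' : D'.IsCharacter i σ') :
    σ = σ' := by
  obtain ⟨K, hK, hc, rfl⟩ := h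
  obtain ⟨K', hK', hc', rfl⟩ := h'
  exact (Submodule.Quotient.eq _).2 (hK'.gtr_sub_mem_exactForms hi hK)

variable (𝓐 F E) in
theorem ConnectionUpToHomotopy.nonempty : Nonempty (ConnectionUpToHomotopy F E 𝓐) := by
  choose ε Φ h using fun z => exists_retract n (F z) (E z)
  obtain ⟨D, hD⟩ := exists_isConn 𝓐.toAnchoredBracket (V := fun z => Cₛ^∞⟮𝓡 n; F z, E z⟯) ε Φ h
  exact ⟨.ofIsConn hD⟩

end Characters

end Algd

end

theorem mainTheorem9 {n : ℕ} {M : Type*} [TopologicalSpace M]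
    [ChartedSpace (EuclideanSpace ℝ (Fin n)) M] [IsManifold (𝓡 n) ∞ M] [T2Space M]
    [SigmaCompactSpace M]
    -- a smooth vector bundle `A → M` of finite rank with a Lie algebroid structure `𝓐`
    {FA : Type*} [NormedAddCommGroup FA] [NormedSpace ℝ FA] [FiniteDimensional ℝ FA]
    {A : M → Type*} [∀ x, AddCommGroup (A x)] [∀ x, Module ℝ (A x)] [∀ x, TopologicalSpace (A x)]
    [TopologicalSpace (TotalSpace FA A)] [FiberBundle FA A] [VectorBundle ℝ FA A]
    [ContMDiffVectorBundle ∞ FA A (𝓡 n)]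
    (𝓐 : Algd.LieAlgebroid n FA A)
    -- a graded vector bundle `⊕_z E_z[z]`, `z ∈ S`, of finite rank
    {S : Finset ℤ} {F : S → Type*} [∀ z, NormedAddCommGroup (F z)] [∀ z, NormedSpace ℝ (F z)]
    [∀ z, FiniteDimensional ℝ (F z)]
    {E : S → M → Type*} [∀ z x, AddCommGroup (E z x)] [∀ z x, Module ℝ (E z x)]
    [∀ z x, TopologicalSpace (E z x)] [∀ z x, IsTopologicalAddGroup (E z x)]
    [∀ z x, ContinuousSMul ℝ (E z x)]
    [∀ z, TopologicalSpace (TotalSpace (F z) (E z))] [∀ z, FiberBundle (F z) (E z)]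
    [∀ z, VectorBundle ℝ (F z) (E z)] [∀ z, ContMDiffVectorBundle ∞ (F z) (E z) (𝓡 n)]
    (i : ℕ) (hi : 1 ≤ i) :
    -- the curvature power `R_D^i` is well defined
    (∀ D : Algd.ConnectionUpToHomotopy F E 𝓐,
      ∃! K : Algd.EndForm n FA A F E, D.IsCurvaturePower i K) ∧
    -- its graded trace is closed
    (∀ (D : Algd.ConnectionUpToHomotopy F E 𝓐) (K : Algd.EndForm n FA A F E),
      D.IsCurvaturePower i K → K.gtr (2 * i) ∈ 𝓐.closedForms (2 * i)) ∧
    -- the class of the graded trace does not depend on `D`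
    (∀ (D D' : Algd.ConnectionUpToHomotopy F E 𝓐) (σ σ' : 𝓐.Cohomology (2 * i)),
      D.IsCharacter i σ → D'.IsCharacter i σ' → σ = σ') ∧
    -- the `i`-th `A`-Pontryagin character of the graded bundle is well defined
    (∃! σ : 𝓐.Cohomology (2 * i), ∃ D : Algd.ConnectionUpToHomotopy F E 𝓐, D.IsCharacter i σ) := by
  refine ⟨fun D => D.existsUnique_isCurvaturePower i, fun D K hK => hK.gtr_mem_closedForms,
    fun D D' σ σ' h h' => h.unique hi h', ?_⟩
  obtain ⟨D⟩ := Algd.ConnectionUpToHomotopy.nonempty 𝓐 F E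
  obtain ⟨K, hK, -⟩ := D.existsUnique_isCurvaturePower i
  exact ⟨𝓐.cohomologyClass _ hK.gtr_mem_closedForms, ⟨D, K, hK, hK.gtr_mem_closedForms, rfl⟩,
    fun σ ⟨D', h⟩ => h.unique hi ⟨K, hK, hK.gtr_mem_closedForms, rfl⟩⟩
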